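/- Let $d,n\ge1$ and let $V:\mathbb Z^d\to\mathbb R^{n\times n}$. Put $\hat V(\theta)=\sum_{z\in\mathbb Z^d}V(z)e^{iz\cdot\theta}$ for $\theta\in T^d=\mathbb R^d/2\pi\mathbb Z^d$, and assume: * (E1) there are $C,\kappa>0$ with $|V_{kl}(z)|\le Ce^{-\kappa|z|}$ for all $z,k,l$; * (E2) $V_{lk}(-z)=V_{kl}(z)$ for all $z,k,l$; * (E3) $\hat V(\theta)$ is non-negative definite for every $\theta$; * (E4) for every dispersion relation $\omega$, that is, every real-analytic function $\omega\ge0$ on a non-empty open set $U$ of $\theta$'s such that $\omega(\theta)^2$ is an eigenvalue of $\hat V(\theta)$ for all $\theta\in U$, the determinant of the $d\times d$ Hessian $\big(\partial^2\omega/\partial\theta_i\partial\theta_j\big)$ does not vanish identically on $U$; * $\det\hat V(\theta)\ne0$ for every $\theta$. Let $\alpha<-d/2$, and let $\mathcal H_\alpha$ be the Hilbert space of pairs $Y=(Y^0,Y^1)=(u,v)$ of functions $\mathbb Z^d\to\mathbb R^n$ with $\|Y\|_\alpha^2=\sum_x(|u(x)|^2+|v(x)|^2)(1+|x|^2)^\alpha<\infty$.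 For $Y_0\in\mathcal H_\alpha$ let $U(t)Y_0=(u(\cdot,t),\dot u(\cdot,t))\in C(\mathbb R,\mathcal H_\alpha)$ be the unique solution of $$\ddot u(x,t)=-\sum_{y\in\mathbb Z^d}V(x-y)u(y,t),\qquad (u,\dot u)|_{t=0}=Y_0 .$$ A Borel probability measure $\mu$ on $\mathcal H_\alpha$ is called Gaussian (of zero mean) if $\int e^{i\langle Y,\Psi\rangle}\mu(dY)=e^{-\frac12Q(\Psi,\Psi)}$ for all finitely supported $\Psi=(\Psi^0,\Psi^1)$, where $\langle Y,\Psi\rangle=\sum_{i=0,1}\sum_x Y^i(x)\cdot\Psi^i(x)$ and $Q$ is a real non-negative quadratic form. Let $T_\pm\ge0$ and let $g_\pm$ be the Gibbs measure at temperature $T_\pm$, i.e. the Gaussian measure on $\mathcal H_\alpha$ with $Q(\Psi,\Psi)=\sum_{i,j=0,1}\sum_{x,y}\Psi^i(x)\cdot q_\pm^{ij}(x-y)\Psi^j(y)$, where $q_\pm^{ij}(z)=(2\pi)^{-d}\int_{T^d}e^{-iz\cdot\theta}\hat q_\pm^{ij}(\theta)\,d\theta$ and $$\hat q_\pm^{00}=T_\pm\hat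 V^{-1},\qquad \hat q_\pm^{11}=T_\pm I,\qquad \hat q_\pm^{01}=\hat q_\pm^{10}=0 .$$ Let $\zeta_\pm:\mathbb Z\to\mathbb R$ satisfy, for some $a$, $\zeta_\pm(s)=1$ for $\pm s>a$ and $\zeta_\pm(s)=0$ for $\pm s<-a$, and let $g_0$ be the distribution of $Y_0(x)=\zeta_-(x_d)Y_-(x)+\zeta_+(x_d)Y_+(x)$, where $(Y_-,Y_+)$ has distribution $g_-\times g_+$ and $x_d$ is the last coordinate of $x$. Let $g_t$ be the distribution of $U(t)Y_0$. Then there is a Gaussian Borel probability measure $g_\infty$ on $\mathcal H_\alpha$ such that $g_t\to g_\infty$ weakly on $\mathcal H_\alpha$ as $t\to\infty$, i.e. $\int f\,dg_t\to\int f\,dg_\infty$ for every bounded continuous $f:\mathcal H_\alpha\to\mathbb R$. -/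

import Mathlib

open scoped ComplexOrder BoundedContinuousFunction ENNReal

namespace HarmonicCrystal

/-! ## The phase space -/

/-- The lattice `ℤ^d`. -/
abbrev Lattice (d : ℕ) : Type := Fin d → ℤ

/-- The values `(u(x), v(x)) ∈ ℝⁿ × ℝⁿ` of the field at a lattice point, normed by
`|(u, v)|² = |u|² + |v|²`. -/
abbrev PhaseVec (n : ℕ) : Type :=
  WithLp 2 (EuclideanSpace ℝ (Fin n) × EuclideanSpace ℝ (Fin n))

/-- `|x|²` for `x ∈ ℤ^d`, with the Euclidean norm. -/
def latticeSq {d : ℕ} (x : Lattice d) : ℝ := ∑ i, (x i : ℝ) ^ 2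

theorem latticeSq_nonneg {d : ℕ} (x : Lattice d) : 0 ≤ latticeSq x :=
  Finset.sum_nonneg fun _ _ => sq_nonneg _

/-- The weight `(1 + |x|²)^α`. -/
noncomputable def weight {d : ℕ} (α : ℝ) (x : Lattice d) : ℝ := (1 + latticeSq x) ^ α

theorem weight_pos {d : ℕ} (α : ℝ) (x : Lattice d) : 0 < weight α x :=
  Real.rpow_pos_of_pos (by linarith [latticeSq_nonneg x]) α

/-- Auxiliary isometric rescaling: `Y` lies in the weighted space iff `√weight • Y` is in `ℓ²`. -/
theorem memℓp_iff {d n : ℕ} (α : ℝ) (Y : Lattice d → PhaseVec n) :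
    Memℓp (fun x => √(weight α x) • Y x) 2 ↔ Summable fun x => weight α x * ‖Y x‖ ^ 2 := by
  rw [memℓp_gen_iff (by norm_num)]
  refine summable_congr fun x => ?_
  simp [norm_smul, mul_pow, Real.sq_sqrt (weight_pos α x).le]

/-- The underlying vector space of `H_α`. -/
def phaseSubmodule (d n : ℕ) (α : ℝ) : Submodule ℝ (Lattice d → PhaseVec n) where
  carrier := {Y | Summable fun x => weight α x * ‖Y x‖ ^ 2}
  zero_mem' := by simp
  add_mem' := by
    intro Y Z hY hZ
    refine (memℓp_iff α (Y + Z)).1 ?_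
    have h := ((memℓp_iff α Y).2 hY).add ((memℓp_iff α Z).2 hZ)
    convert h using 1
    funext x
    exact smul_add _ _ _
  smul_mem' := by
    intro c Y hY
    refine (memℓp_iff α (c • Y)).1 ?_
    have h := ((memℓp_iff α Y).2 hY).const_smul c
    convert h using 1
    funext x
    exact smul_comm (√(weight α x)) c (Y x)

/-- The Hilbert space `H_α` of pairs `Y = (u, v)` of `ℝⁿ`-valued functions on `ℤ^d` with
`‖Y‖²_α = ∑ₓ (|u(x)|² + |v(x)|²)(1 + |x|²)^α < ∞` (see `PhaseSpace.norm_sq`). -/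
def PhaseSpace (d n : ℕ) (α : ℝ) : Type := phaseSubmodule d n α

namespace PhaseSpace

variable {d n : ℕ} {α : ℝ}

instance : AddCommGroup (PhaseSpace d n α) := inferInstanceAs (AddCommGroup (phaseSubmodule d n α))

instance : Module ℝ (PhaseSpace d n α) := inferInstanceAs (Module ℝ (phaseSubmodule d n α))

instance : CoeFun (PhaseSpace d n α) (fun _ => Lattice d → PhaseVec n) := ⟨fun Y => Y.1⟩

/-- The linear embedding `Y ↦ (1 + |x|²)^{α/2} Y(x)` of `H_α` into `ℓ²`. -/
noncomputable def toL2 : PhaseSpace d n α →ₗ[ℝ] lp (fun _ : Lattice d => PhaseVec n) 2 where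
  toFun Y := ⟨fun x => √(weight α x) • Y x, (memℓp_iff α Y.1).2 Y.2⟩
  map_add' Y Z := by
    ext1
    funext x
    exact smul_add _ _ _
  map_smul' c Y := by
    ext1
    funext x
    exact smul_comm (√(weight α x)) c (Y x)

theorem toL2_injective : Function.Injective (toL2 : PhaseSpace d n α → _) := by
  intro Y Z h
  apply Subtype.ext
  funext x
  have hx : √(weight α x) • Y x = √(weight α x) • Z x :=
    congrFun (congrArg Subtype.val h) x
  exact smul_right_injective _ (Real.sqrt_pos.2 (weight_pos α x)).ne' hx

noncomputable instance : NormedAddCommGroup (PhaseSpace d n α) :=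
  NormedAddCommGroup.induced (PhaseSpace d n α) _ toL2 toL2_injective

noncomputable instance : NormedSpace ℝ (PhaseSpace d n α) :=
  NormedSpace.induced ℝ (PhaseSpace d n α) _ toL2

/-- The norm of `H_α` is the weighted `ℓ²` norm. -/
theorem norm_sq (Y : PhaseSpace d n α) :
    ‖Y‖ ^ 2 = ∑' x, (‖(Y x).fst‖ ^ 2 + ‖(Y x).snd‖ ^ 2) * (1 + latticeSq x) ^ α := by
  have h : ‖Y‖ = ‖toL2 Y‖ := rfl
  have h2 := lp.norm_rpow_eq_tsum (p := 2) (by norm_num) (toL2 Y)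
  norm_num at h2
  rw [h, h2]
  refine tsum_congr fun x => ?_
  have hx : (toL2 Y : Lattice d → PhaseVec n) x = √(weight α x) • Y x := rfl
  rw [hx, norm_smul, mul_pow, ← WithLp.prod_norm_sq_eq_of_L2, mul_comm, Real.norm_eq_abs,
    sq_abs, Real.sq_sqrt (weight_pos α x).le, weight]

noncomputable instance : MeasurableSpace (PhaseSpace d n α) := borel _

instance : BorelSpace (PhaseSpace d n α) := ⟨rfl⟩

end PhaseSpace

/-! ## The interaction matrix and the conditions on it -/

/-- The phase `z · θ`. -/
def phase {d : ℕ} (z : Lattice d) (θ : Fin d → ℝ) : ℝ := ∑ i, (z i : ℝ) * θ i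

/-- `V̂(θ) = ∑_z V(z) e^{i z·θ}`. Points of the torus `ℝ^d / 2πℤ^d` are represented by points of
`ℝ^d`. -/
noncomputable def symbol {d n : ℕ} (V : Lattice d → Matrix (Fin n) (Fin n) ℝ)
    (θ : Fin d → ℝ) : Matrix (Fin n) (Fin n) ℂ :=
  Matrix.of fun k l => ∑' z, (V z k l : ℂ) * Complex.exp (Complex.I * (phase z θ : ℂ))

/-- Exponential decay of the interaction. -/
def ExpDecay {d n : ℕ} (V : Lattice d → Matrix (Fin n) (Fin n) ℝ) : Prop :=
  ∃ C κ : ℝ, 0 < C ∧ 0 < κ ∧ ∀ z k l, |V z k l| ≤ C * Real.exp (-κ * √(latticeSq z))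

/-- Symmetry: `V_{lk}(-z) = V_{kl}(z)`. (`V` is real by its type.) -/
def Symmetric {d n : ℕ} (V : Lattice d → Matrix (Fin n) (Fin n) ℝ) : Prop :=
  ∀ z k l, V (-z) l k = V z k l

/-- `V̂(θ)` is non-negative definite for every `θ`. -/
def NonnegDefinite {d n : ℕ} (V : Lattice d → Matrix (Fin n) (Fin n) ℝ) : Prop :=
  ∀ θ, (symbol V θ).PosSemidef

/-- `ω` is a real-analytic branch of the dispersion relations on the open set `U`: `ω(θ) ≥ 0` and
`ω(θ)²` is an eigenvalue of `V̂(θ)`; that is, `ω(θ)` is an eigenvalue of `V̂(θ)^{1/2}`. -/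
structure IsDispersionBranch {d n : ℕ} (V : Lattice d → Matrix (Fin n) (Fin n) ℝ)
    (U : Set (Fin d → ℝ)) (ω : (Fin d → ℝ) → ℝ) : Prop where
  isOpen : IsOpen U
  nonempty : U.Nonempty
  analytic : AnalyticOnNhd ℝ ω U
  nonneg : ∀ θ ∈ U, 0 ≤ ω θ
  eigenvalue : ∀ θ ∈ U,
    Module.End.HasEigenvalue (Matrix.toLin' (symbol V θ)) ((ω θ : ℂ) ^ 2)

/-- The `d × d` Hessian matrix `(∂²ω / ∂θ_i ∂θ_j)(θ)`. -/
noncomputable def hessian {d : ℕ} (ω : (Fin d → ℝ) → ℝ) (θ : Fin d → ℝ) :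
    Matrix (Fin d) (Fin d) ℝ :=
  Matrix.of fun i j => iteratedFDeriv ℝ 2 ω θ ![Pi.single i 1, Pi.single j 1]

/-- For no (local, real-analytic) dispersion relation does the Hessian determinant vanish
identically. -/
def NondegenerateHessians {d n : ℕ} (V : Lattice d → Matrix (Fin n) (Fin n) ℝ) : Prop :=
  ∀ U ω, IsDispersionBranch V U ω → ∃ θ ∈ U, (hessian ω θ).det ≠ 0

/-! ## The dynamics -/

/-- `Y = (u, v) ∈ C(ℝ, H_α)` solves `u̇(x,t) = v(x,t)`, `v̇(x,t) = -∑_y V(x - y) u(y,t)`. -/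
structure IsSolution {d n : ℕ} {α : ℝ} (V : Lattice d → Matrix (Fin n) (Fin n) ℝ)
    (Y : ℝ → PhaseSpace d n α) : Prop where
  continuous : Continuous Y
  deriv_fst : ∀ t x, HasDerivAt (fun s => (Y s x).fst) (Y t x).snd t
  deriv_snd : ∀ t x, HasDerivAt (fun s => (Y s x).snd)
    (-∑' y, Matrix.toEuclideanLin (V (x - y)) (Y t y).fst) t

open Classical in
/-- `U(t) Y₀ = Y(t)`, where `Y ∈ C(ℝ, H_α)` is the (unique) solution with `Y(0) = Y₀`. -/
noncomputable def flow {d n : ℕ} {α : ℝ} (V : Lattice d → Matrix (Fin n) (Fin n) ℝ)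
    (t : ℝ) (Y₀ : PhaseSpace d n α) : PhaseSpace d n α :=
  if h : ∃ Y : ℝ → PhaseSpace d n α, IsSolution V Y ∧ Y 0 = Y₀ then h.choose t else 0

/-! ## Gaussian measures and Gibbs measures -/

/-- The space of test functions: finitely supported `Ψ = (Ψ⁰, Ψ¹)`. -/
abbrev TestSpace (d n : ℕ) : Type := Lattice d →₀ PhaseVec n

/-- `⟨Y, Ψ⟩ = ∑_{i=0,1} ∑_x (Yⁱ(x), Ψⁱ(x))`. -/
noncomputable def pairing {d n : ℕ} {α : ℝ} (Y : PhaseSpace d n α) (Ψ : TestSpace d n) : ℝ :=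
  ∑ x ∈ Ψ.support, inner ℝ (Y x) (Ψ x)

/-- The characteristic functional `μ̂(Ψ) = ∫ exp(i⟨Y, Ψ⟩) μ(dY)`. -/
noncomputable def charFunctional {d n : ℕ} {α : ℝ}
    (μ : MeasureTheory.Measure (PhaseSpace d n α)) (Ψ : TestSpace d n) : ℂ :=
  ∫ Y, Complex.exp (Complex.I * (pairing Y Ψ : ℂ)) ∂μ

/-- `μ` is Gaussian (of zero mean): `μ̂(Ψ) = exp(-Q(Ψ,Ψ)/2)` for a real non-negative quadratic
form `Q` on the test functions. -/
def IsGaussianMeasure {d n : ℕ} {α : ℝ}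
    (μ : MeasureTheory.Measure (PhaseSpace d n α)) : Prop :=
  ∃ Q : QuadraticForm ℝ (TestSpace d n), (∀ Ψ, 0 ≤ Q Ψ) ∧
    ∀ Ψ, charFunctional μ Ψ = Complex.exp (-(1 / 2 : ℂ) * (Q Ψ : ℂ))

/-- The components `w⁰ = u`, `w¹ = v` of `w = (u, v)`. -/
def comp {n : ℕ} (w : PhaseVec n) : Fin 2 → EuclideanSpace ℝ (Fin n) := ![w.fst, w.snd]

/-- The matrix function `z ↦ (2π)^{-d} ∫_{T^d} e^{-i z·θ} f(θ) dθ`. The real part is taken in order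
to land in real matrices; it changes nothing for a symbol with `f(-θ)` the entrywise complex
conjugate of `f(θ)`. -/
noncomputable def invFourier {d n : ℕ} (f : (Fin d → ℝ) → Matrix (Fin n) (Fin n) ℂ)
    (z : Lattice d) : Matrix (Fin n) (Fin n) ℝ :=
  Matrix.of fun k l => ((((2 * Real.pi) ^ d)⁻¹ : ℝ) *
    ∫ θ in Set.Icc (fun _ : Fin d => -Real.pi) (fun _ => Real.pi),
      Complex.exp (-(Complex.I * (phase z θ : ℂ))) * f θ k l : ℂ).re

/-- The quadratic form `∑_{i,j} ∑_{x,y} (q^{ij}(x - y), Ψⁱ(x) ⊗ Ψʲ(y))` of translation invariant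
correlation functions `q^{ij}`. -/
noncomputable def correlationForm {d n : ℕ}
    (q : Fin 2 → Fin 2 → Lattice d → Matrix (Fin n) (Fin n) ℝ) (Ψ : TestSpace d n) : ℝ :=
  ∑ i, ∑ j, ∑ x ∈ Ψ.support, ∑ y ∈ Ψ.support, ∑ k, ∑ l,
    q i j (x - y) k l * comp (Ψ x) i k * comp (Ψ y) j l

/-- The Fourier transforms of the correlation functions of the Gibbs measure at temperature `T`:
`q̂⁰⁰ = T V̂⁻¹`, `q̂¹¹ = T I`, `q̂⁰¹ = q̂¹⁰ = 0`. -/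
noncomputable def gibbsSymbol {d n : ℕ} (V : Lattice d → Matrix (Fin n) (Fin n) ℝ) (T : ℝ)
    (i j : Fin 2) (θ : Fin d → ℝ) : Matrix (Fin n) (Fin n) ℂ :=
  ![![(T : ℂ) • (symbol V θ)⁻¹, 0], ![0, (T : ℂ) • 1]] i j

/-- `μ` is the Gibbs measure at temperature `T`: the Borel probability measure on `H_α` that is
Gaussian with the correlation functions given by `gibbsSymbol`. -/
def IsGibbs {d n : ℕ} {α : ℝ} (V : Lattice d → Matrix (Fin n) (Fin n) ℝ) (T : ℝ)
    (μ : MeasureTheory.Measure (PhaseSpace d n α)) : Prop :=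
  MeasureTheory.IsProbabilityMeasure μ ∧ ∀ Ψ, charFunctional μ Ψ =
    Complex.exp (-(1 / 2 : ℂ) *
      (correlationForm (fun i j => invFourier (gibbsSymbol V T i j)) Ψ : ℂ))

open Classical in
/-- The Gibbs measure at temperature `T` on `H_α` (a measure is determined by its characteristic
functional). The default value `0`, if there were none, is not a probability measure. -/
noncomputable def gibbsMeasure {d n : ℕ} (α : ℝ) (V : Lattice d → Matrix (Fin n) (Fin n) ℝ)
    (T : ℝ) : MeasureTheory.Measure (PhaseSpace d n α) :=
  if h : ∃ μ : MeasureTheory.Measure (PhaseSpace d n α), IsGibbs V T μ then h.choose else 0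

/-! ## The two-temperature initial measure -/

/-- Functions `ζ_±` on `ℤ` with `ζ_±(s) = 1` for `±s > a` and `ζ_±(s) = 0` for `±s < -a`. -/
structure CutoffPair where
  a : ℝ
  minus : ℤ → ℝ
  plus : ℤ → ℝ
  plus_one : ∀ s : ℤ, a < s → plus s = 1
  plus_zero : ∀ s : ℤ, (s : ℝ) < -a → plus s = 0
  minus_one : ∀ s : ℤ, a < -(s : ℝ) → minus s = 1
  minus_zero : ∀ s : ℤ, -(s : ℝ) < -a → minus s = 0

theorem bounded_of_cutoff {a : ℝ} {ζ : ℤ → ℝ} (h : ∀ s : ℤ, a < |(s : ℝ)| → |ζ s| ≤ 1) :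
    ∃ C : ℝ, ∀ s, |ζ s| ≤ C := by
  have hfin : ((fun s => |ζ s|) '' Set.Icc (-⌈a⌉) ⌈a⌉).Finite :=
    (Set.finite_Icc _ _).image _
  obtain ⟨C, hC⟩ := hfin.bddAbove
  refine ⟨max C 1, fun s => ?_⟩
  by_cases hs : a < |(s : ℝ)|
  · exact (h s hs).trans (le_max_right _ _)
  · refine le_trans (hC ?_) (le_max_left _ _)
    have h1 : |(s : ℝ)| ≤ (⌈a⌉ : ℝ) := (not_lt.1 hs).trans (Int.le_ceil a)
    have h2 : |s| ≤ ⌈a⌉ := by exact_mod_cast h1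
    have h3 := abs_le.1 h2
    exact ⟨s, h3, rfl⟩

theorem CutoffPair.minus_bounded (ζ : CutoffPair) : ∃ C : ℝ, ∀ s, |ζ.minus s| ≤ C := by
  refine bounded_of_cutoff (a := ζ.a) fun s hs => ?_
  rcases lt_abs.1 hs with h | h
  · simp [ζ.minus_zero s (by linarith)]
  · simp [ζ.minus_one s h]

theorem CutoffPair.plus_bounded (ζ : CutoffPair) : ∃ C : ℝ, ∀ s, |ζ.plus s| ≤ C := by
  refine bounded_of_cutoff (a := ζ.a) fun s hs => ?_
  rcases lt_abs.1 hs with h | h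
  · simp [ζ.plus_one s h]
  · simp [ζ.plus_zero s (by linarith)]

/-- The last coordinate `x_d` of `x ∈ ℤ^d`, `d ≥ 1`. -/
def lastCoord {d : ℕ} [NeZero d] (x : Lattice d) : ℤ :=
  x ⟨d - 1, Nat.sub_lt (NeZero.pos d) Nat.one_pos⟩

/-- The function `x ↦ ζ(x_d) Y(x)` of `H_α`, for bounded `ζ` and `Y ∈ H_α`. -/
def cutoffMul {d n : ℕ} [NeZero d] {α : ℝ} (ζ : ℤ → ℝ) (hζ : ∃ C : ℝ, ∀ s, |ζ s| ≤ C)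
    (Y : PhaseSpace d n α) : PhaseSpace d n α :=
  ⟨fun x => ζ (lastCoord x) • Y x, by
    obtain ⟨C, hC⟩ := hζ
    have hY : Summable fun x => weight α x * ‖Y x‖ ^ 2 := Y.2
    refine Summable.of_nonneg_of_le
      (fun x => mul_nonneg (weight_pos α x).le (sq_nonneg _)) (fun x => ?_) (hY.mul_left (C ^ 2))
    have h1 : ζ (lastCoord x) ^ 2 ≤ C ^ 2 := sq_le_sq' (abs_le.1 (hC _)).1 (abs_le.1 (hC _)).2
    have h2 : 0 ≤ weight α x * ‖Y x‖ ^ 2 := mul_nonneg (weight_pos α x).le (sq_nonneg _)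
    have h3 := mul_le_mul_of_nonneg_right h1 h2
    rw [norm_smul, mul_pow, Real.norm_eq_abs, sq_abs]
    linarith⟩

/-- The distribution `g₀` of `Y₀(x) = ζ_-(x_d) Y_-(x) + ζ_+(x_d) Y_+(x)`, where `(Y_-, Y_+)` has
the distribution `g_- × g_+`, the product of the Gibbs measures at temperatures `T_-`, `T_+`. -/
noncomputable def twoTemperature {d n : ℕ} [NeZero d] (α : ℝ)
    (V : Lattice d → Matrix (Fin n) (Fin n) ℝ) (Tm Tp : ℝ) (ζ : CutoffPair) :
    MeasureTheory.Measure (PhaseSpace d n α) :=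
  ((gibbsMeasure α V Tm).prod (gibbsMeasure α V Tp)).map fun Y =>
    cutoffMul ζ.minus ζ.minus_bounded Y.1 + cutoffMul ζ.plus ζ.plus_bounded Y.2

end HarmonicCrystal

/-!
The dynamics is linear, so all the measures involved are Gaussian and the theorem is about their
covariances: if the covariance form `Q_t` of the law at time `t` converges at every test function
and is bounded, uniformly in `t`, on test functions supported at one site, then the laws converge
weakly (`tendsto_integral_of_tendsto_covariance`). The reason is that the weights `(1 + |x|²)^α`
are summable for `α < -d/2`, so that restriction to a finite set of sites changes a random state by
little in `H_α`, uniformly in `t`. For the same reason a bounded covariance form is the covariance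
of a Gaussian measure on `H_α` (`exists_gaussian`); this yields the limit measure and the Gibbs
measures. The flow is the exponential of a bounded operator on `H_α` (`flow_eq_exp`).

By duality, `Q_t(Ψ, Ψ)` is the covariance of the initial measure, taken at the sequence `c_t ∈ ℓ²`
into which the adjoint dynamics carries `Ψ` (`charFunctional_evolved`). Let `𝒱` be convolution by
`V` on `ℓ²(ℤ^d, ℂⁿ)`, which by the assumptions is self-adjoint and bounded below by some `m > 0`.
The covariance of the Gibbs measure at `(u, v)` is `T (‖𝒱^{-1/2} u‖² + ‖v‖²)`
(`correlationForm_gibbsSymbol`), which is half the sum of `T ‖𝒱^{-1/2} u ± i v‖²`. The adjoint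
dynamics acts on the normal modes `𝒱^{-1/2} u ± i v` as `exp (± i t √𝒱)` (`normalMode_dualTraj`);
in particular `c_t` is bounded in `ℓ²`. Hence `Q_t(Ψ, Ψ)` is a combination of the squared norms of
the normal modes of `ζ_± c_t`. If the cutoffs `ζ_±` commuted with `𝒱^{-1/2}`, these would be
the squared norms of `ζ_± exp (± i t √𝒱) w` with a fixed `w ∈ ℓ²`, and these are, up to what
happens near the hyperplane `x_d = 0`, the masses of a wave packet in the two half spaces.

It remains to see that wave packets leave every slab `|x_d| ≤ R` and that their masses in half
spaces converge (`escapes_evol`). As `𝒱` has a summable kernel, its commutator with `ζ_±` is small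
on packets far from the hyperplane, so it vanishes asymptotically along the evolution; by polynomial
approximation the same holds for continuous functions of `𝒱` (`asympCommute_fc`), and `Q_t(Ψ, Ψ)`
converges (`exists_tendsto_gibbsForm`).

For the escape of wave packets, consider the law of `x_d / t` under the probabilities `|w_t(x)|²`,
where `w_t = exp (i t √𝒱) w` is normalized. Multiplication by `e^{i a x_d}` is translation by `a` in
Fourier space, so the characteristic function of this law is an average over the torus of
`⟨ŵ_t(θ), ŵ_t(θ + (s/t) e_d)⟩`, up to the sign of `s`. At a point near which the distinct
eigenvalues of the symbol are squares of differentiable branches `ω_k`, the integrand converges to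
`∑ ‖P_k ŵ(θ)‖² exp (i s ∂_d ω_k(θ))`, with `P_k` the spectral projections. By Lévy's continuity
theorem the law of `x_d / t` converges to the law of the velocity `∂_d ω_k`, and the latter
has no atom at zero if `∂_d ω_k ≠ 0` almost everywhere (`exists_velocity_law`).

Finally, almost every `θ` has these properties (`ae_isRegularPoint`). Where the number of distinct
eigenvalues is maximal, they are simple zeros of a determinant that depends analytically on `θ`
through the traces of the powers of the symbol, so by the implicit function theorem they are
analytic; the exceptional set is the zero set of a nonzero analytic function. If `∂_d ω_k` vanished
on a set of positive measure, then, again by analyticity, it would vanish on an open set, and there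
the Hessian of `ω_k` would have a zero row, against its nondegeneracy.
-/


namespace HarmonicCrystal

open Filter Topology

/-! ### Weights and summability on the lattice -/

theorem one_add_latticeSq_pos {d : ℕ} (x : Lattice d) : 0 < 1 + latticeSq x := by
  linarith [latticeSq_nonneg x]

theorem sq_apply_le_latticeSq {d : ℕ} (x : Lattice d) (i : Fin d) :
    (x i : ℝ) ^ 2 ≤ latticeSq x :=
  Finset.single_le_sum (f := fun i => (x i : ℝ) ^ 2) (fun _ _ => sq_nonneg _) (Finset.mem_univ i)

theorem norm_cast_sq_le_latticeSq {d : ℕ} (x : Lattice d) :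
    ‖fun i => (x i : ℝ)‖ ^ 2 ≤ latticeSq x := by
  have h : ‖fun i => (x i : ℝ)‖ ≤ √(latticeSq x) :=
    (pi_norm_le_iff_of_nonneg (Real.sqrt_nonneg _)).2 fun i => by
      rw [Real.norm_eq_abs]
      exact Real.abs_le_sqrt (sq_apply_le_latticeSq x i)
  calc ‖fun i => (x i : ℝ)‖ ^ 2 ≤ √(latticeSq x) ^ 2 := by gcongr
    _ = latticeSq x := Real.sq_sqrt (latticeSq_nonneg x)

theorem summable_weight {d : ℕ} {α : ℝ} (hα : α < -(d : ℝ) / 2) :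
    Summable fun x : Lattice d => weight α x := by
  let b := Pi.basisFun ℝ (Fin d)
  let L : Submodule ℤ (Fin d → ℝ) := Submodule.span ℤ (Set.range b)
  have hfr : Module.finrank ℤ L = d := by
    rw [ZLattice.rank ℝ L]
    simp
  let φ : Lattice d → L := fun x => ⟨fun i => (x i : ℝ), by
    have : (fun i => (x i : ℝ)) = ∑ i, x i • b i := by
      funext j
      simp [b, Pi.single_apply]
    rw [this]
    exact Submodule.sum_mem _ fun i _ =>
      Submodule.smul_mem _ _ (Submodule.subset_span ⟨i, rfl⟩)⟩
  have hφ : Function.Injective φ := by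
    intro x y h
    funext i
    have : (x i : ℝ) = y i := congrFun (congrArg Subtype.val h) i
    exact_mod_cast this
  have hs : Summable fun z : L => ‖z‖ ^ (2 * α) := by
    apply ZLattice.summable_norm_rpow
    rw [hfr]
    linarith
  have hs' := hs.comp_injective hφ
  refine Summable.of_norm_bounded_eventually hs' ?_
  refine (Set.finite_singleton (0 : Lattice d)).subset fun x hx => ?_
  by_contra h0
  apply hx
  have hpos : 0 < ‖fun i => (x i : ℝ)‖ := by
    rw [norm_pos_iff]
    intro h
    apply h0
    funext i
    have := congrFun h i
    simpa using this
  rw [Set.mem_ofPred_eq, Real.norm_of_nonneg (weight_pos α x).le]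
  have hd0 : (0 : ℝ) ≤ d := Nat.cast_nonneg d
  calc weight α x ≤ (‖fun i => (x i : ℝ)‖ ^ 2) ^ α := by
        refine Real.rpow_le_rpow_of_nonpos (by positivity) ?_ (by linarith)
        linarith [norm_cast_sq_le_latticeSq x]
    _ = ‖φ x‖ ^ (2 * α) := by
        rw [← Real.rpow_natCast, ← Real.rpow_mul (norm_nonneg _)]
        norm_cast

theorem latticeSq_add_le {d : ℕ} (x z : Lattice d) :
    1 + latticeSq (x + z) ≤ 2 * (1 + latticeSq z) * (1 + latticeSq x) := by
  have h : latticeSq (x + z) ≤ 2 * latticeSq x + 2 * latticeSq z := by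
    unfold latticeSq
    rw [Finset.mul_sum, Finset.mul_sum, ← Finset.sum_add_distrib]
    refine Finset.sum_le_sum fun i _ => ?_
    simp only [Pi.add_apply, Int.cast_add]
    nlinarith [sq_nonneg ((x i : ℝ) - z i)]
  nlinarith [latticeSq_nonneg x, latticeSq_nonneg z,
    mul_nonneg (latticeSq_nonneg x) (latticeSq_nonneg z)]

theorem latticeSq_neg {d : ℕ} (x : Lattice d) : latticeSq (-x) = latticeSq x := by
  simp [latticeSq]

/-- **Peetre's inequality** for the weights with a negative exponent. -/
theorem weight_le_mul_weight_sub {d : ℕ} {α : ℝ} (hα : α ≤ 0) (x z : Lattice d) :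
    weight α x ≤ (2 * (1 + latticeSq z)) ^ (-α) * weight α (x - z) := by
  have h := latticeSq_add_le x (-z)
  rw [latticeSq_neg, ← sub_eq_add_neg] at h
  have hx := one_add_latticeSq_pos x
  have hz := one_add_latticeSq_pos z
  have hxz := one_add_latticeSq_pos (x - z)
  unfold weight
  have h1 : (2 * (1 + latticeSq z) * (1 + latticeSq x)) ^ α ≤ (1 + latticeSq (x - z)) ^ α :=
    Real.rpow_le_rpow_of_nonpos hxz h hα
  rw [Real.mul_rpow (by positivity) hx.le] at h1
  calc (1 + latticeSq x) ^ α
      = (2 * (1 + latticeSq z)) ^ (-α) *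
        ((2 * (1 + latticeSq z)) ^ α * (1 + latticeSq x) ^ α) := by
        rw [← mul_assoc, ← Real.rpow_add (by positivity)]
        simp
    _ ≤ _ := by gcongr

theorem exists_rpow_le_mul_exp (p : ℝ) {ε : ℝ} (hε : 0 < ε) :
    ∃ C : ℝ, 0 < C ∧ ∀ {d : ℕ} (z : Lattice d),
      (1 + latticeSq z) ^ p ≤ C * Real.exp (ε * √(latticeSq z)) := by
  -- `(1 + r²)^p ≤ (1 + r)^{2k} ≤ (2k)! ε^{-2k} e^{ε(1+r)}` for a natural number `k ≥ p`
  obtain ⟨k, hk⟩ := exists_nat_ge p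
  refine ⟨(2 * k).factorial / ε ^ (2 * k) * Real.exp ε, by positivity, fun z => ?_⟩
  set r := √(latticeSq z)
  have hr : 0 ≤ r := Real.sqrt_nonneg _
  have hr2 : latticeSq z = r ^ 2 := (Real.sq_sqrt (latticeSq_nonneg z)).symm
  have h1 : (1 + latticeSq z) ^ p ≤ (1 + latticeSq z) ^ (k : ℝ) :=
    Real.rpow_le_rpow_of_exponent_le (by linarith [latticeSq_nonneg z]) hk
  have h2 : (1 + latticeSq z) ^ (k : ℝ) ≤ (1 + r) ^ (2 * k) := by
    rw [Real.rpow_natCast, pow_mul, hr2]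
    gcongr
    nlinarith
  have h3 : (ε * (1 + r)) ^ (2 * k) / (2 * k).factorial ≤ Real.exp (ε * (1 + r)) :=
    Real.pow_div_factorial_le_exp _ (by positivity) _
  rw [div_le_iff₀ (by positivity), mul_pow] at h3
  calc (1 + latticeSq z) ^ p ≤ (1 + r) ^ (2 * k) := h1.trans h2
    _ = ε ^ (2 * k) * (1 + r) ^ (2 * k) / ε ^ (2 * k) := by field_simp
    _ ≤ Real.exp (ε * (1 + r)) * (2 * k).factorial / ε ^ (2 * k) := by gcongr
    _ = _ := by rw [mul_add, Real.exp_add, mul_one]; ring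

theorem summable_exp_neg {d : ℕ} {ε : ℝ} (hε : 0 < ε) :
    Summable fun z : Lattice d => Real.exp (-ε * √(latticeSq z)) := by
  obtain ⟨C, hC, h⟩ := exists_rpow_le_mul_exp (d + 1 : ℝ) hε
  have hd0 : (0 : ℝ) ≤ d := Nat.cast_nonneg d
  refine Summable.of_nonneg_of_le (fun z => (Real.exp_pos _).le) (fun z => ?_)
    ((summable_weight (d := d) (α := -(d + 1 : ℝ)) (by linarith)).mul_left C)
  have hp := one_add_latticeSq_pos z
  have := h z
  rw [weight, Real.rpow_neg hp.le, neg_mul, Real.exp_neg, ← div_eq_mul_inv,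
    le_div_iff₀ (by positivity), inv_mul_le_iff₀ (Real.exp_pos _), mul_comm _ C]
  exact this

/-- An exponentially decaying interaction is summable against exponential weights of smaller
rate. -/
theorem ExpDecay.exists_summable_exp {d n : ℕ} {V : Lattice d → Matrix (Fin n) (Fin n) ℝ}
    (hV : ExpDecay V) : ∃ κ : ℝ, 0 < κ ∧ ∀ k l,
      Summable fun z => |V z k l| * Real.exp (κ * √(latticeSq z)) := by
  obtain ⟨C, κ, hC, hκ, h⟩ := hV
  refine ⟨κ / 2, by positivity, fun k l => ?_⟩
  refine Summable.of_nonneg_of_le (fun z => by positivity) (fun z => ?_)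
    ((summable_exp_neg (d := d) (half_pos hκ)).mul_left C)
  calc |V z k l| * Real.exp (κ / 2 * √(latticeSq z))
      ≤ C * Real.exp (-κ * √(latticeSq z)) * Real.exp (κ / 2 * √(latticeSq z)) := by
        gcongr; exact h z k l
    _ = _ := by rw [mul_assoc, ← Real.exp_add]; ring_nf

theorem ExpDecay.summable_abs {d n : ℕ} {V : Lattice d → Matrix (Fin n) (Fin n) ℝ}
    (hV : ExpDecay V) (k l : Fin n) : Summable fun z => |V z k l| := by
  obtain ⟨κ, hκ, h⟩ := hV.exists_summable_exp
  refine Summable.of_nonneg_of_le (fun z => abs_nonneg _) (fun z => ?_) (h k l)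
  exact le_mul_of_one_le_right (abs_nonneg _) (Real.one_le_exp (by positivity))

theorem ExpDecay.summable_rpow {d n : ℕ} {V : Lattice d → Matrix (Fin n) (Fin n) ℝ}
    (hV : ExpDecay V) (p : ℝ) (k l : Fin n) :
    Summable fun z => |V z k l| * (1 + latticeSq z) ^ p := by
  obtain ⟨κ, hκ, h⟩ := hV.exists_summable_exp
  obtain ⟨C, hC, hp⟩ := exists_rpow_le_mul_exp p hκ
  refine Summable.of_nonneg_of_le (fun z => ?_) (fun z => ?_) ((h k l).mul_left C)
  · have := one_add_latticeSq_pos z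
    positivity
  · calc _ ≤ |V z k l| * (C * Real.exp (κ * √(latticeSq z))) := by gcongr; exact hp z
      _ = _ := by ring

/-! ### Weighted shifts on square summable lattice functions -/

section WeightedShift

variable {𝕜 F : Type*} [RCLike 𝕜] [NormedAddCommGroup F] [NormedSpace 𝕜 F] {d : ℕ}

theorem norm_sq_eq_tsum (f : lp (fun _ : Lattice d => F) 2) : ‖f‖ ^ 2 = ∑' x, ‖f x‖ ^ 2 := by
  have h := lp.norm_rpow_eq_tsum (p := 2) (by norm_num) f
  norm_num at h
  exact h

theorem summable_norm_sq (f : lp (fun _ : Lattice d => F) 2) : Summable fun x => ‖f x‖ ^ 2 := by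
  have h := (lp.memℓp f).summable (p := 2) (by norm_num)
  norm_num at h
  exact h

theorem memlp_two_of_summable {f : Lattice d → F} (h : Summable fun x => ‖f x‖ ^ 2) :
    Memℓp f 2 := by
  rw [memℓp_gen_iff (by norm_num)]
  norm_num
  exact h

theorem norm_le_of_forall_sq_le {f : lp (fun _ : Lattice d => F) 2} {g : Lattice d → ℝ} {C : ℝ}
    (hC : 0 ≤ C) (hg : HasSum g (C ^ 2)) (h : ∀ x, ‖f x‖ ^ 2 ≤ g x) : ‖f‖ ≤ C := by
  refine le_of_sq_le_sq ?_ hC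
  rw [norm_sq_eq_tsum, ← hg.tsum_eq]
  exact (summable_norm_sq f).tsum_le_tsum h hg.summable

/-- The operator `(T f)(x) = c(x) M f(x - z)` on `ℓ²(ℤ^d; F)`, for a bounded function `c` and a
bounded operator `M` on `F`. -/
noncomputable def wshift (c : Lattice d → 𝕜) (B : ℝ) (hB : ∀ x, ‖c x‖ ≤ B) (z : Lattice d)
    (M : F →L[𝕜] F) : lp (fun _ : Lattice d => F) 2 →L[𝕜] lp (fun _ : Lattice d => F) 2 :=
  have hB0 : 0 ≤ B := (norm_nonneg _).trans (hB 0)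
  have key : ∀ (f : lp (fun _ : Lattice d => F) 2) (x : Lattice d),
      ‖c x • M (f (x - z))‖ ^ 2 ≤ (B * ‖M‖) ^ 2 * ‖f (x - z)‖ ^ 2 := fun f x => by
    rw [← mul_pow, norm_smul]
    refine pow_le_pow_left₀ (by positivity) ?_ 2
    rw [mul_assoc]
    exact mul_le_mul (hB x) (M.le_opNorm _) (norm_nonneg _) hB0
  have hsum : ∀ f : lp (fun _ : Lattice d => F) 2,
      HasSum (fun x => (B * ‖M‖) ^ 2 * ‖f (x - z)‖ ^ 2) ((B * ‖M‖ * ‖f‖) ^ 2) := fun f => by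
    rw [mul_pow _ ‖f‖]
    refine HasSum.mul_left _ ?_
    rw [norm_sq_eq_tsum]
    exact ((Equiv.subRight z).hasSum_iff (f := fun x => ‖f x‖ ^ 2)).2 (summable_norm_sq f).hasSum
  LinearMap.mkContinuous
    { toFun := fun f => ⟨fun x => c x • M (f (x - z)), memlp_two_of_summable <|
        Summable.of_nonneg_of_le (fun _ => sq_nonneg _) (key f) (hsum f).summable⟩
      map_add' := fun f g => by
        ext1; funext x
        simp only [lp.coeFn_add, Pi.add_apply, map_add, smul_add]
      map_smul' := fun a f => by
        ext1; funext x
        simp only [lp.coeFn_smul, Pi.smul_apply, map_smul, RingHom.id_apply]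
        exact smul_comm _ _ _ }
    (B * ‖M‖) fun f => norm_le_of_forall_sq_le (by positivity) (hsum f) (key f)

@[simp]
theorem wshift_apply (c : Lattice d → 𝕜) (B : ℝ) (hB : ∀ x, ‖c x‖ ≤ B) (z : Lattice d)
    (M : F →L[𝕜] F) (f : lp (fun _ : Lattice d => F) 2) (x : Lattice d) :
    wshift c B hB z M f x = c x • M (f (x - z)) := rfl

theorem norm_wshift_le (c : Lattice d → 𝕜) (B : ℝ) (hB : ∀ x, ‖c x‖ ≤ B) (z : Lattice d)
    (M : F →L[𝕜] F) : ‖wshift c B hB z M‖ ≤ B * ‖M‖ := by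
  rw [wshift]
  exact LinearMap.mkContinuous_norm_le _
    (mul_nonneg ((norm_nonneg _).trans (hB 0)) (norm_nonneg _)) _

variable (𝕜 F) in
/-- The value at a lattice point, as a continuous linear map on `ℓ²(ℤ^d; F)`. -/
noncomputable def evalAt (x : Lattice d) : lp (fun _ : Lattice d => F) 2 →L[𝕜] F :=
  LinearMap.mkContinuous
    { toFun := fun f => f x, map_add' := fun _ _ => rfl, map_smul' := fun _ _ => rfl } 1
    fun f => by rw [one_mul]; exact lp.norm_apply_le_norm (by norm_num) f x

/-- Values of an absolutely convergent series of operators. -/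
theorem tsum_apply_apply [CompleteSpace F] {ι : Type*}
    {a : ι → lp (fun _ : Lattice d => F) 2 →L[𝕜] lp (fun _ : Lattice d => F) 2}
    (ha : Summable a) (f : lp (fun _ : Lattice d => F) 2) (x : Lattice d) :
    HasSum (fun i => a i f x) ((∑' i, a i) f x) :=
  (((evalAt 𝕜 F x).comp (ContinuousLinearMap.apply 𝕜 _ f)).hasSum ha.hasSum)

end WeightedShift

end HarmonicCrystal

namespace HarmonicCrystal

open Filter Topology

/-! ### The phase space as a Hilbert space -/

/-- Square summable real phase fields. -/
abbrev RSeq (d n : ℕ) : Type := lp (fun _ : Lattice d => PhaseVec n) 2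

namespace PhaseSpace

variable {d n : ℕ} {α : ℝ}

theorem sqrt_weight_pos (α : ℝ) (x : Lattice d) : 0 < √(weight α x) :=
  Real.sqrt_pos.2 (weight_pos α x)

@[simp] theorem sub_apply (Y Z : PhaseSpace d n α) (x : Lattice d) : (Y - Z) x = Y x - Z x := rfl

@[ext] theorem ext {Y Z : PhaseSpace d n α} (h : ∀ x, Y x = Z x) : Y = Z :=
  Subtype.ext (funext h)

theorem toL2_surjective : Function.Surjective (toL2 : PhaseSpace d n α → RSeq d n) := by
  intro f
  have hf : (fun x => √(weight α x) • (√(weight α x))⁻¹ • f x) = f := by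
    funext x
    rw [smul_smul, mul_inv_cancel₀ (sqrt_weight_pos α x).ne', one_smul]
  refine ⟨⟨fun x => (√(weight α x))⁻¹ • f x, ?_⟩, ?_⟩
  · refine (memℓp_iff α _).1 ?_
    rw [hf]
    exact lp.memℓp f
  · ext1
    exact hf

/-- The isometry `Y ↦ (1 + |x|²)^{α/2} Y(x)` of `H_α` onto `ℓ²`. -/
noncomputable def isoL2 : PhaseSpace d n α ≃ₗᵢ[ℝ] RSeq d n :=
  LinearIsometryEquiv.mk (LinearEquiv.ofBijective toL2 ⟨toL2_injective, toL2_surjective⟩)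
    fun _ => rfl

theorem isoL2_apply (Y : PhaseSpace d n α) (x : Lattice d) :
    isoL2 Y x = √(weight α x) • Y x := rfl

theorem isoL2_symm_apply (f : RSeq d n) (x : Lattice d) :
    (isoL2 (α := α)).symm f x = (√(weight α x))⁻¹ • f x := by
  have h := isoL2_apply ((isoL2 (α := α)).symm f) x
  rw [LinearIsometryEquiv.apply_symm_apply] at h
  rw [h, smul_smul, inv_mul_cancel₀ (sqrt_weight_pos α x).ne', one_smul]

instance : CompleteSpace (PhaseSpace d n α) :=
  (completeSpace_congr (e := (isoL2 (d := d) (n := n) (α := α)).toEquiv)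
    (isoL2 (α := α)).isometry.isUniformEmbedding).2 inferInstance

end PhaseSpace

instance RSeq.separableSpace {d n : ℕ} : TopologicalSpace.SeparableSpace (RSeq d n) := by
  classical
  let S : Set (RSeq d n) := ⋃ x, Set.range (lp.single (E := fun _ : Lattice d => PhaseVec n) 2 x)
  have hS : TopologicalSpace.IsSeparable S :=
    TopologicalSpace.IsSeparable.iUnion fun x =>
      TopologicalSpace.isSeparable_range (lp.isometry_single x).continuous
  have hd : closure (Submodule.span ℝ S : Set (RSeq d n)) = Set.univ := by
    refine Set.eq_univ_of_forall fun f => ?_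
    have h := lp.hasSum_single (p := 2) (by norm_num) f
    refine mem_closure_of_tendsto h (Eventually.of_forall fun s => ?_)
    exact Submodule.sum_mem _ fun x _ => Submodule.subset_span (Set.mem_iUnion.2 ⟨x, f x, rfl⟩)
  have := (hS.span (R := ℝ)).closure
  rw [hd] at this
  exact TopologicalSpace.isSeparable_univ_iff.1 this

instance {d n : ℕ} {α : ℝ} : TopologicalSpace.SeparableSpace (PhaseSpace d n α) :=
  (PhaseSpace.isoL2 (α := α)).symm.surjective.denseRange.separableSpace
    (PhaseSpace.isoL2 (α := α)).symm.continuous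

instance {d n : ℕ} {α : ℝ} : SecondCountableTopology (PhaseSpace d n α) :=
  UniformSpace.secondCountable_of_separable _

/-! ### The generator of the dynamics -/

theorem norm_le_sum_norm_apply {𝕜 ι : Type*} [RCLike 𝕜] [Fintype ι] (x : EuclideanSpace 𝕜 ι) :
    ‖x‖ ≤ ∑ i, ‖x i‖ := by
  rw [EuclideanSpace.norm_eq]
  refine Real.sqrt_le_iff.2 ⟨Finset.sum_nonneg fun _ _ => norm_nonneg _, ?_⟩
  exact Finset.sum_sq_le_sq_sum_of_nonneg fun _ _ => norm_nonneg _

theorem norm_toEuclideanLin_le {𝕜 : Type*} [RCLike 𝕜] {n : ℕ} (M : Matrix (Fin n) (Fin n) 𝕜)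
    (u : EuclideanSpace 𝕜 (Fin n)) :
    ‖Matrix.toEuclideanLin M u‖ ≤ (∑ k, ∑ l, ‖M k l‖) * ‖u‖ := by
  refine (norm_le_sum_norm_apply _).trans ?_
  rw [Finset.sum_mul]
  refine Finset.sum_le_sum fun k _ => ?_
  rw [Finset.sum_mul]
  change ‖∑ l, M k l * u l‖ ≤ _
  refine (norm_sum_le _ _).trans (Finset.sum_le_sum fun l _ => ?_)
  rw [norm_mul]
  gcongr
  exact PiLp.norm_apply_le (p := 2) u l

section Generator

variable {d n : ℕ} (V : Lattice d → Matrix (Fin n) (Fin n) ℝ)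

/-- The projection `(u, v) ↦ u`. -/
noncomputable abbrev fstL (n : ℕ) : PhaseVec n →L[ℝ] EuclideanSpace ℝ (Fin n) :=
  WithLp.fstL 2 ℝ _ _

/-- The projection `(u, v) ↦ v`. -/
noncomputable abbrev sndL (n : ℕ) : PhaseVec n →L[ℝ] EuclideanSpace ℝ (Fin n) :=
  WithLp.sndL 2 ℝ _ _

@[simp] theorem fstL_apply (w : PhaseVec n) : fstL n w = w.fst := rfl

@[simp] theorem sndL_apply (w : PhaseVec n) : sndL n w = w.snd := rfl

/-- The block `(u, v) ↦ (δ_{z0} v, -V(z) u)` of the generator `(u, v) ↦ (v, -V * u)`. -/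
noncomputable def genBlock (z : Lattice d) : PhaseVec n →L[ℝ] PhaseVec n :=
  ((WithLp.prodContinuousLinearEquiv 2 ℝ (EuclideanSpace ℝ (Fin n)) (EuclideanSpace ℝ (Fin n))).symm :
    _ →L[ℝ] PhaseVec n) ∘L
    (((if z = 0 then (1 : ℝ) else 0) • sndL n).prod
      (-((Matrix.toEuclideanLin (V z)).toContinuousLinearMap ∘L fstL n)))

theorem genBlock_fst (z : Lattice d) (w : PhaseVec n) :
    (genBlock V z w).fst = if z = 0 then w.snd else 0 := by
  change (if z = 0 then (1 : ℝ) else 0) • w.snd = _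
  split_ifs <;> simp

theorem genBlock_snd (z : Lattice d) (w : PhaseVec n) :
    (genBlock V z w).snd = -Matrix.toEuclideanLin (V z) w.fst := rfl

theorem phaseVec_norm_le (w : PhaseVec n) : ‖w‖ ≤ ‖w.fst‖ + ‖w.snd‖ := by
  refine le_of_sq_le_sq ?_ (by positivity)
  rw [WithLp.prod_norm_sq_eq_of_L2]
  nlinarith [mul_nonneg (norm_nonneg w.fst) (norm_nonneg w.snd)]

theorem norm_fst_le (w : PhaseVec n) : ‖w.fst‖ ≤ ‖w‖ := by
  refine le_of_sq_le_sq ?_ (by positivity)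
  rw [WithLp.prod_norm_sq_eq_of_L2]
  nlinarith [sq_nonneg ‖w.snd‖]

theorem norm_snd_le (w : PhaseVec n) : ‖w.snd‖ ≤ ‖w‖ := by
  refine le_of_sq_le_sq ?_ (by positivity)
  rw [WithLp.prod_norm_sq_eq_of_L2]
  nlinarith [sq_nonneg ‖w.fst‖]

theorem norm_genBlock_le (z : Lattice d) :
    ‖genBlock V z‖ ≤ (if z = 0 then 1 else 0) + ∑ k, ∑ l, |V z k l| := by
  refine ContinuousLinearMap.opNorm_le_bound _ (by positivity) fun w => ?_
  refine (phaseVec_norm_le _).trans ?_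
  rw [genBlock_fst, genBlock_snd, add_mul, norm_neg]
  gcongr
  · split_ifs
    · simpa using norm_snd_le w
    · simp
  · refine (norm_toEuclideanLin_le _ _).trans ?_
    simp only [Real.norm_eq_abs]
    gcongr
    exact norm_fst_le w

/-- The ratio `√(w(x) / w(x - z))` of weights, the symbol of the shift by `z` after the isometry of
`H_α` with `ℓ²`. -/
noncomputable def weightRatio (α : ℝ) (z x : Lattice d) : ℝ :=
  √(weight α x) / √(weight α (x - z))

theorem norm_weightRatio_le {α : ℝ} (hα : α ≤ 0) (z x : Lattice d) :
    ‖weightRatio α z x‖ ≤ √((2 * (1 + latticeSq z)) ^ (-α)) := by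
  have h1 := weight_pos α (x - z)
  rw [weightRatio, Real.norm_of_nonneg (by positivity), ← Real.sqrt_div (weight_pos α x).le]
  refine Real.sqrt_le_sqrt ?_
  rw [div_le_iff₀ h1]
  exact weight_le_mul_weight_sub hα x z

/-- The generator, conjugated with the isometry of `H_α` with `ℓ²`. -/
noncomputable def genL2 {α : ℝ} (hα : α ≤ 0) : RSeq d n →L[ℝ] RSeq d n :=
  ∑' z, wshift (weightRatio α z) _ (norm_weightRatio_le hα z) z (genBlock V z)

variable {V} in
theorem summable_genL2 (hV : ExpDecay V) {α : ℝ} (hα : α ≤ 0) :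
    Summable fun z => wshift (weightRatio α z) _ (norm_weightRatio_le hα z) z (genBlock V z) := by
  refine Summable.of_norm_bounded (g := fun z => (√((2 * (1 + latticeSq z)) ^ (-α)) *
    ((if z = 0 then 1 else 0) + ∑ k, ∑ l, |V z k l|))) ?_ fun z =>
    (norm_wshift_le _ _ _ _ _).trans (by gcongr; exact norm_genBlock_le V z)
  simp only [mul_add (√ _)]
  refine Summable.add ?_ ?_
  · refine summable_of_ne_finset_zero (s := {0}) fun z hz => ?_
    rw [if_neg (by simpa using hz), mul_zero]
  · have h : ∀ z : Lattice d, √((2 * (1 + latticeSq z)) ^ (-α)) =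
        √(2 ^ (-α)) * (1 + latticeSq z) ^ (-α / 2) := fun z => by
      have hz := one_add_latticeSq_pos z
      rw [Real.mul_rpow (by norm_num) hz.le, Real.sqrt_mul (by positivity),
        Real.sqrt_eq_rpow ((1 + latticeSq z) ^ (-α)), ← Real.rpow_mul hz.le]
      ring_nf
    simp only [h, Finset.mul_sum]
    refine summable_sum fun k _ => summable_sum fun l _ => ?_
    refine ((hV.summable_rpow (-α / 2) k l).mul_left (√(2 ^ (-α)))).congr fun z => by ring

variable {V} in
/-- The coordinates of the generator on `H_α`. -/
theorem hasSum_genL2 (hV : ExpDecay V) {α : ℝ} (hα : α ≤ 0) (f : RSeq d n) (x : Lattice d) :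
    HasSum (fun z => weightRatio α z x • genBlock V z (f (x - z))) (genL2 V hα f x) :=
  tsum_apply_apply (summable_genL2 hV hα) f x

/-- The generator `(u, v) ↦ (v, -V * u)` on `H_α`. -/
noncomputable def phaseGen {α : ℝ} (hα : α ≤ 0) : PhaseSpace d n α →L[ℝ] PhaseSpace d n α :=
  (PhaseSpace.isoL2 (α := α)).symm.toContinuousLinearEquiv.toContinuousLinearMap ∘L genL2 V hα ∘L
    (PhaseSpace.isoL2 (α := α)).toContinuousLinearEquiv.toContinuousLinearMap

theorem isoL2_phaseGen {α : ℝ} (hα : α ≤ 0) (Y : PhaseSpace d n α) :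
    PhaseSpace.isoL2 (phaseGen V hα Y) = genL2 V hα (PhaseSpace.isoL2 Y) := by
  simp [phaseGen]

variable {V} in
theorem hasSum_phaseGen (hV : ExpDecay V) {α : ℝ} (hα : α ≤ 0) (Y : PhaseSpace d n α)
    (x : Lattice d) : HasSum (fun z => genBlock V z (Y (x - z))) (phaseGen V hα Y x) := by
  have h := hasSum_genL2 hV hα (PhaseSpace.isoL2 Y) x
  rw [← isoL2_phaseGen, PhaseSpace.isoL2_apply] at h
  have h2 := h.const_smul (√(weight α x))⁻¹
  rw [smul_smul, inv_mul_cancel₀ (PhaseSpace.sqrt_weight_pos α x).ne', one_smul] at h2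
  convert h2 using 2 with z
  rw [PhaseSpace.isoL2_apply, map_smul, smul_smul, smul_smul, weightRatio]
  have h1 := (PhaseSpace.sqrt_weight_pos α x).ne'
  have h3 := (PhaseSpace.sqrt_weight_pos α (x - z)).ne'
  rw [show (√(weight α x))⁻¹ * (√(weight α x) / √(weight α (x - z))) * √(weight α (x - z)) = 1 by
    field_simp, one_smul]

variable {V} in
theorem phaseGen_fst (hV : ExpDecay V) {α : ℝ} (hα : α ≤ 0) (Y : PhaseSpace d n α)
    (x : Lattice d) : (phaseGen V hα Y x).fst = (Y x).snd := by
  have h := (fstL n).hasSum (hasSum_phaseGen hV hα Y x)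
  refine h.unique ?_
  convert hasSum_ite_eq (0 : Lattice d) (Y x).snd using 2 with z
  simp only [fstL_apply, genBlock_fst]
  split_ifs with hz
  · rw [hz, sub_zero]
  · rfl

variable {V} in
theorem phaseGen_snd (hV : ExpDecay V) {α : ℝ} (hα : α ≤ 0) (Y : PhaseSpace d n α)
    (x : Lattice d) : (phaseGen V hα Y x).snd =
      -∑' y, Matrix.toEuclideanLin (V (x - y)) (Y y).fst := by
  have h := (sndL n).hasSum (hasSum_phaseGen hV hα Y x)
  rw [← (Equiv.subLeft x).hasSum_iff] at h
  rw [← tsum_neg]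
  refine h.tsum_eq.symm.trans (tsum_congr fun y => ?_)
  simp [genBlock_snd]

variable (d n) in
/-- Evaluation at a lattice point on `H_α`. -/
noncomputable def PhaseSpace.evalL (α : ℝ) (x : Lattice d) : PhaseSpace d n α →L[ℝ] PhaseVec n :=
  (√(weight α x))⁻¹ • (evalAt ℝ (PhaseVec n) x ∘L
    (PhaseSpace.isoL2 (α := α)).toContinuousLinearEquiv.toContinuousLinearMap)

@[simp]
theorem PhaseSpace.evalL_apply {α : ℝ} (x : Lattice d) (Y : PhaseSpace d n α) :
    PhaseSpace.evalL d n α x Y = Y x := by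
  have h1 := (PhaseSpace.sqrt_weight_pos α x).ne'
  change (√(weight α x))⁻¹ • (√(weight α x) • Y x) = Y x
  rw [smul_smul, inv_mul_cancel₀ h1, one_smul]

theorem PhaseSpace.hasDerivAt_fst {α : ℝ} {Y : ℝ → PhaseSpace d n α} {Y' : PhaseSpace d n α} {t : ℝ}
    (h : HasDerivAt Y Y' t) (x : Lattice d) :
    HasDerivAt (fun s => (Y s x).fst) (Y' x).fst t := by
  have := (fstL n ∘L PhaseSpace.evalL d n α x).hasFDerivAt.comp_hasDerivAt t h
  simp only [ContinuousLinearMap.comp_apply, PhaseSpace.evalL_apply, fstL_apply] at this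
  refine HasDerivAt.congr_of_eventuallyEq this (Eventually.of_forall fun s => ?_)
  simp only [Function.comp_apply, ContinuousLinearMap.comp_apply, PhaseSpace.evalL_apply,
    fstL_apply]

theorem PhaseSpace.hasDerivAt_snd {α : ℝ} {Y : ℝ → PhaseSpace d n α} {Y' : PhaseSpace d n α} {t : ℝ}
    (h : HasDerivAt Y Y' t) (x : Lattice d) :
    HasDerivAt (fun s => (Y s x).snd) (Y' x).snd t := by
  have := (sndL n ∘L PhaseSpace.evalL d n α x).hasFDerivAt.comp_hasDerivAt t h
  simp only [ContinuousLinearMap.comp_apply, PhaseSpace.evalL_apply, sndL_apply] at this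
  refine HasDerivAt.congr_of_eventuallyEq this (Eventually.of_forall fun s => ?_)
  simp only [Function.comp_apply, ContinuousLinearMap.comp_apply, PhaseSpace.evalL_apply,
    sndL_apply]

/-! ### The flow -/

/-- The group generated by a bounded operator solves the corresponding linear equation. -/
theorem hasDerivAt_exp_smul_apply {E : Type*} [NormedAddCommGroup E] [NormedSpace ℝ E]
    [CompleteSpace E] (A : E →L[ℝ] E) (y : E) (t : ℝ) :
    HasDerivAt (fun s : ℝ => NormedSpace.exp (s • A) y) (A (NormedSpace.exp (t • A) y)) t := by
  have h := hasDerivAt_exp_smul_const' (𝕂 := ℝ) A t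
  exact ((ContinuousLinearMap.apply ℝ E y).hasFDerivAt.comp_hasDerivAt t h)

/-- Uniqueness for linear equations with a bounded generator. -/
theorem eq_exp_smul_apply {E : Type*} [NormedAddCommGroup E] [NormedSpace ℝ E]
    [CompleteSpace E] (A : E →L[ℝ] E) {Y : ℝ → E} (hY : ∀ t, HasDerivAt Y (A (Y t)) t) (t : ℝ) :
    Y t = NormedSpace.exp (t • A) (Y 0) := by
  have h := ODE_solution_unique_univ (v := fun _ y => A y) (s := fun _ => Set.univ) (K := ‖A‖₊)
    (t₀ := 0) (f := Y) (g := fun s : ℝ => NormedSpace.exp (s • A) (Y 0))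
    (fun _ => A.lipschitz.lipschitzOnWith) (fun t => ⟨hY t, Set.mem_univ _⟩)
    (fun t => ⟨hasDerivAt_exp_smul_apply A _ t, Set.mem_univ _⟩) (by simp)
  exact congrFun h t

variable {V}

theorem isSolution_exp (hV : ExpDecay V) {α : ℝ} (hα : α ≤ 0) (Y₀ : PhaseSpace d n α) :
    IsSolution V fun t : ℝ => NormedSpace.exp (t • phaseGen V hα) Y₀ := by
  have h := hasDerivAt_exp_smul_apply (phaseGen V hα) Y₀
  refine ⟨continuous_iff_continuousAt.2 fun t => (h t).continuousAt, fun t x => ?_, fun t x => ?_⟩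
  · have := PhaseSpace.hasDerivAt_fst (h t) x
    rwa [phaseGen_fst hV] at this
  · have := PhaseSpace.hasDerivAt_snd (h t) x
    rwa [phaseGen_snd hV] at this

/-- A continuous function with values in `H_α` that solves the equation coordinate by coordinate
solves it in `H_α`: it differs from `Y(0) + ∫ A Y` by a function with constant coordinates. -/
theorem IsSolution.eq_exp (hV : ExpDecay V) {α : ℝ} (hα : α ≤ 0) {Y : ℝ → PhaseSpace d n α}
    (hY : IsSolution V Y) (t : ℝ) : Y t = NormedSpace.exp (t • phaseGen V hα) (Y 0) := by
  have hc : Continuous fun s => phaseGen V hα (Y s) := (phaseGen V hα).continuous.comp hY.continuous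
  set I : ℝ → PhaseSpace d n α := fun s => Y 0 + ∫ r in (0 : ℝ)..s, phaseGen V hα (Y r)
  have hI : ∀ s, HasDerivAt I (phaseGen V hα (Y s)) s := fun s =>
    (intervalIntegral.integral_hasDerivAt_right (hc.intervalIntegrable _ _)
      hc.aestronglyMeasurable.stronglyMeasurableAtFilter hc.continuousAt).const_add _
  have hYI : Y = I := by
    funext s
    ext x : 1
    have h0 : Y 0 x = I 0 x := by simp [I]
    refine WithLp.ofLp_injective 2 (Prod.ext ?_ ?_)
    · have hd : ∀ r, HasDerivAt (fun r => (Y r x).fst - (I r x).fst) 0 r := fun r => by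
        have h2 := (hY.deriv_fst r x).sub (PhaseSpace.hasDerivAt_fst (hI r) x)
        rw [phaseGen_fst hV, sub_self] at h2
        exact h2
      have := is_const_of_deriv_eq_zero (fun r => (hd r).differentiableAt)
        (fun r => (hd r).deriv) s 0
      simp only [h0, sub_self] at this
      exact sub_eq_zero.1 this
    · have hd : ∀ r, HasDerivAt (fun r => (Y r x).snd - (I r x).snd) 0 r := fun r => by
        have h2 := (hY.deriv_snd r x).sub (PhaseSpace.hasDerivAt_snd (hI r) x)
        rw [phaseGen_snd hV, sub_self] at h2
        exact h2
      have := is_const_of_deriv_eq_zero (fun r => (hd r).differentiableAt)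
        (fun r => (hd r).deriv) s 0
      simp only [h0, sub_self] at this
      exact sub_eq_zero.1 this
  refine eq_exp_smul_apply _ (fun s => ?_) t
  have := hI s
  rwa [← hYI] at this

/-- The solution is unique, hence the flow is the exponential of the generator. -/
theorem flow_eq_exp (hV : ExpDecay V) {α : ℝ} (hα : α ≤ 0) (t : ℝ) (Y₀ : PhaseSpace d n α) :
    flow V t Y₀ = NormedSpace.exp (t • phaseGen V hα) Y₀ := by
  have h : ∃ Y : ℝ → PhaseSpace d n α, IsSolution V Y ∧ Y 0 = Y₀ :=
    ⟨_, isSolution_exp hV hα Y₀, by simp⟩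
  rw [flow, dif_pos h, h.choose_spec.1.eq_exp hV hα t, h.choose_spec.2]

end Generator

end HarmonicCrystal

namespace HarmonicCrystal

open Filter Topology MeasureTheory ProbabilityTheory

/-! ### Gaussian measures with a given covariance -/

/-- A positive semidefinite symmetric form is the Gram form of a linear map into a Hilbert space. -/
theorem exists_hilbert_of_nonneg {X : Type} [AddCommGroup X] [Module ℝ X]
    (B : X →ₗ[ℝ] X →ₗ[ℝ] ℝ) (hsymm : ∀ x y, B x y = B y x) (hB : ∀ x, 0 ≤ B x x) :
    ∃ (K : Type) (_ : NormedAddCommGroup K) (_ : InnerProductSpace ℝ K) (_ : CompleteSpace K)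
      (j : X →ₗ[ℝ] K), ∀ x y, inner ℝ (j x) (j y) = B x y := by
  let core : PreInnerProductSpace.Core ℝ X :=
    { inner := fun x y => B x y
      conj_inner_symm := fun x y => hsymm y x
      re_inner_nonneg := hB
      add_left := fun x y z => by simp
      smul_left := fun x y r => by simp }
  let _ : SeminormedAddCommGroup X := InnerProductSpace.Core.toSeminormedAddCommGroup (c := core)
  let _ : InnerProductSpace ℝ X := InnerProductSpace.ofCore core
  exact ⟨UniformSpace.Completion X, inferInstance, inferInstance, inferInstance,
    (UniformSpace.Completion.toComplₗᵢ (𝕜 := ℝ) (E := X)).toLinearMap,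
    fun x y => UniformSpace.Completion.inner_coe x y⟩

theorem norm_exp_I_mul_sub_le (a b : ℝ) :
    ‖Complex.exp (Complex.I * a) - Complex.exp (Complex.I * b)‖ ≤ |a - b| := by
  have h : Complex.exp (Complex.I * a) - Complex.exp (Complex.I * b) =
      Complex.exp (b * Complex.I) * (Complex.exp (Complex.I * ((a - b : ℝ) : ℂ)) - 1) := by
    rw [mul_sub, ← Complex.exp_add, mul_one]
    push_cast
    ring_nf
  rw [h, norm_mul, Complex.norm_exp_ofReal_mul_I, one_mul]
  exact Real.norm_exp_I_mul_ofReal_sub_one_le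

theorem norm_exp_I_mul_ofReal (a : ℝ) : ‖Complex.exp (Complex.I * a)‖ = 1 := by
  rw [mul_comm, Complex.norm_exp_ofReal_mul_I]

theorem aestronglyMeasurable_exp_I {Ω : Type*} [MeasurableSpace Ω] {P : Measure Ω} {f : Ω → ℝ}
    (hf : AEStronglyMeasurable f P) :
    AEStronglyMeasurable (fun ω => Complex.exp (Complex.I * f ω)) P :=
  (by fun_prop : Continuous fun a : ℝ => Complex.exp (Complex.I * a)).comp_aestronglyMeasurable hf

theorem integrable_exp_I {Ω : Type*} [MeasurableSpace Ω] {P : Measure Ω} [IsFiniteMeasure P]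
    {f : Ω → ℝ} (hf : AEStronglyMeasurable f P) :
    Integrable (fun ω => Complex.exp (Complex.I * f ω)) P :=
  Integrable.of_bound (aestronglyMeasurable_exp_I hf) 1
    (Eventually.of_forall fun _ => (norm_exp_I_mul_ofReal _).le)

/-- On a probability space, `F ↦ E e^{iF}` is Lipschitz on `L²`. -/
theorem continuous_integral_exp_I {Ω : Type*} [MeasurableSpace Ω] (P : Measure Ω)
    [IsProbabilityMeasure P] :
    Continuous fun F : Lp ℝ 2 P => ∫ ω, Complex.exp (Complex.I * (F ω : ℂ)) ∂P := by
  refine LipschitzWith.continuous (K := 1) (LipschitzWith.of_dist_le_mul fun F G => ?_)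
  have hF := Lp.aestronglyMeasurable F
  have hG := Lp.aestronglyMeasurable G
  have hint : Integrable (F - G : Lp ℝ 2 P) P := (Lp.memLp (F - G)).integrable one_le_two
  rw [NNReal.coe_one, one_mul, dist_eq_norm, dist_eq_norm,
    ← integral_sub (integrable_exp_I hF) (integrable_exp_I hG)]
  calc ‖∫ ω, (Complex.exp (Complex.I * (F ω : ℂ)) - Complex.exp (Complex.I * (G ω : ℂ))) ∂P‖
      ≤ ∫ ω, ‖(F - G : Lp ℝ 2 P) ω‖ ∂P := by
        refine norm_integral_le_of_norm_le hint.norm ?_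
        filter_upwards [Lp.coeFn_sub F G] with ω hω
        rw [hω]
        exact norm_exp_I_mul_sub_le _ _
    _ = (eLpNorm (F - G : Lp ℝ 2 P) 1 P).toReal := by
        rw [integral_norm_eq_lintegral_enorm hint.1, eLpNorm_one_eq_lintegral_enorm]
    _ ≤ ‖F - G‖ := by
        rw [Lp.norm_def]
        exact ENNReal.toReal_mono (Lp.eLpNorm_ne_top _)
          (eLpNorm_le_eLpNorm_of_exponent_le one_le_two hint.1)

/-- An isonormal Gaussian process on a Hilbert space: expand in a Hilbert basis with independent
standard Gaussian coefficients. -/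
theorem exists_isonormal (K : Type) [NormedAddCommGroup K] [InnerProductSpace ℝ K]
    [CompleteSpace K] : ∃ (Ω : Type) (_ : MeasurableSpace Ω) (P : Measure Ω)
      (_ : IsProbabilityMeasure P) (G : K →ₗᵢ[ℝ] Lp ℝ 2 P), ∀ k : K,
      ∫ ω, Complex.exp (Complex.I * (G k ω : ℂ)) ∂P =
        Complex.exp (-(1 / 2 : ℂ) * ((‖k‖ ^ 2 : ℝ) : ℂ)) := by
  classical
  obtain ⟨w, b, -⟩ := exists_hilbertBasis ℝ K
  let P : Measure (w → ℝ) := Measure.infinitePi fun _ => gaussianReal 0 1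
  have hmp : ∀ i : w, MeasurePreserving (fun ω : w → ℝ => ω i) P (gaussianReal 0 1) := fun i =>
    measurePreserving_eval_infinitePi (fun _ : w => gaussianReal 0 1) i
  have hind : iIndepFun (fun (i : w) (ω : w → ℝ) => ω i) P :=
    iIndepFun_infinitePi (P := fun _ : w => gaussianReal 0 1) (X := fun _ x => x) (by fun_prop)
  have hmem : ∀ i : w, MemLp (fun ω : w → ℝ => ω i) 2 P := fun i =>
    (memLp_id_gaussianReal 2).comp_measurePreserving (hmp i)
  let ξ : w → Lp ℝ 2 P := fun i => (hmem i).toLp _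
  have hmean : ∀ i : w, ∫ ω, ω i ∂P = 0 := fun i => by
    have := integral_map (μ := P) (φ := fun ω : w → ℝ => ω i) (hmp i).measurable.aemeasurable
      (f := fun x : ℝ => x) (by fun_prop)
    rw [← this, (hmp i).map_eq, integral_id_gaussianReal]
  have hvar : ∀ i : w, ∫ ω, ω i * ω i ∂P = 1 := fun i => by
    have := integral_map (μ := P) (φ := fun ω : w → ℝ => ω i) (hmp i).measurable.aemeasurable
      (f := fun x : ℝ => x * x) (by fun_prop)
    rw [← this, (hmp i).map_eq]
    have h := variance_of_integral_eq_zero (μ := gaussianReal 0 1) (X := id) aemeasurable_id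
      (by simp)
    rw [variance_id_gaussianReal] at h
    simpa [pow_two] using h.symm
  have hξ : Orthonormal ℝ ξ := by
    rw [orthonormal_iff_ite]
    intro i j
    have h1 : inner ℝ (ξ i) (ξ j) = ∫ ω, ω j * ω i ∂P := by
      rw [L2.inner_def]
      refine integral_congr_ae ?_
      filter_upwards [(hmem i).coeFn_toLp, (hmem j).coeFn_toLp] with ω h1 h2
      simp only [ξ, h1, h2]
      rfl
    rw [h1]
    split_ifs with hij
    · subst hij
      exact hvar i
    · have := (hind.indepFun (Ne.symm hij)).integral_fun_mul_eq_mul_integral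
        (hmem j).1 (hmem i).1
      rw [this, hmean, zero_mul]
  let G : K →ₗᵢ[ℝ] Lp ℝ 2 P := hξ.orthogonalFamily.linearIsometry.comp b.repr.toLinearIsometry
  refine ⟨w → ℝ, inferInstance, P, inferInstance, G, fun k => ?_⟩
  have hG : HasSum (fun i => b.repr k i • ξ i) (G k) := by
    have := hξ.orthogonalFamily.hasSum_linearIsometry (b.repr k)
    simp only [LinearIsometry.toSpanSingleton_apply] at this
    exact this
  have hnorm : HasSum (fun i => (b.repr k i) ^ 2) (‖k‖ ^ 2) := by
    have h := b.hasSum_inner_mul_inner k k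
    rw [real_inner_self_eq_norm_sq] at h
    refine HasSum.congr_fun h fun i => ?_
    rw [b.repr_apply_apply, pow_two, real_inner_comm k]
  have hlim := ((continuous_integral_exp_I P).tendsto (G k)).comp hG
  refine tendsto_nhds_unique hlim ?_
  have hfin : ∀ s : Finset w, ∫ ω, Complex.exp (Complex.I * ((∑ i ∈ s, b.repr k i • ξ i :
      Lp ℝ 2 P) ω : ℂ)) ∂P = Complex.exp (-(1 / 2 : ℂ) * ((∑ i ∈ s, (b.repr k i) ^ 2 : ℝ) : ℂ)) := by
    intro s
    have hsum : ((∑ i ∈ s, b.repr k i • ξ i : Lp ℝ 2 P) : (w → ℝ) → ℝ) =ᵐ[P]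
        fun ω => ∑ i ∈ s, b.repr k i * ω i := by
      induction s using Finset.induction with
      | empty =>
        simp only [Finset.sum_empty]
        exact Lp.coeFn_zero _ _ _
      | insert i s hi ih =>
        simp only [Finset.sum_insert hi]
        filter_upwards [Lp.coeFn_add (b.repr k i • ξ i) (∑ i ∈ s, b.repr k i • ξ i), ih,
          Lp.coeFn_smul (b.repr k i) (ξ i), (hmem i).coeFn_toLp] with ω h1 h2 h3 h4
        rw [h1, Pi.add_apply, h2, h3, Pi.smul_apply, smul_eq_mul]
        simp only [ξ, h4]
    have h1 : ∫ ω, Complex.exp (Complex.I * ((∑ i ∈ s, b.repr k i • ξ i : Lp ℝ 2 P) ω : ℂ)) ∂P =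
        ∫ ω, ∏ i : s, Complex.exp (Complex.I * (b.repr k i * ω i : ℝ)) ∂P := by
      refine integral_congr_ae ?_
      filter_upwards [hsum] with ω hω
      rw [hω, ← Complex.exp_sum, ← Finset.mul_sum,
        Finset.sum_coe_sort s (fun i => ((b.repr k i * ω i : ℝ) : ℂ))]
      push_cast
      rfl
    have h2 := (hind.precomp (g := ((↑) : s → w)) Subtype.val_injective).integral_fun_prod_comp
      (f := fun (i : s) (x : ℝ) => Complex.exp (Complex.I * (b.repr k i * x : ℝ)))
      (fun i => (hmem i).1.aemeasurable)
      (fun i => (by fun_prop : Continuous fun x : ℝ =>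
        Complex.exp (Complex.I * (b.repr k i * x : ℝ))).aestronglyMeasurable)
    rw [h1, h2]
    have h3 : ∀ i : s, ∫ ω, Complex.exp (Complex.I * (b.repr k i * ω i : ℝ)) ∂P =
        Complex.exp (-(1 / 2 : ℂ) * (((b.repr k i) ^ 2 : ℝ) : ℂ)) := fun i => by
      have := integral_map (μ := P) (φ := fun ω : w → ℝ => ω i) (hmp i).measurable.aemeasurable
        (f := fun x : ℝ => Complex.exp (Complex.I * (b.repr k i * x : ℝ)))
        ((by fun_prop : Continuous fun x : ℝ =>
          Complex.exp (Complex.I * (b.repr k i * x : ℝ))).aestronglyMeasurable)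
      rw [← this, (hmp i).map_eq]
      have h4 := charFun_gaussianReal (μ := 0) (v := 1) (b.repr k i)
      rw [charFun_apply_real] at h4
      refine Eq.trans (integral_congr_ae (Eventually.of_forall fun x => ?_)) (h4.trans ?_)
      · simp only []
        congr 1
        push_cast
        ring
      · congr 1
        push_cast
        ring
    rw [Finset.prod_congr rfl fun i _ => h3 i, ← Complex.exp_sum, ← Finset.mul_sum,
      Finset.sum_coe_sort s (fun i => (((b.repr k i) ^ 2 : ℝ) : ℂ))]
    push_cast
    rfl
  simp only [Function.comp_def, hfin]
  have hc : Continuous fun a : ℝ => Complex.exp (-(1 / 2 : ℂ) * (a : ℂ)) := by fun_prop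
  exact (hc.tendsto _).comp hnorm

end HarmonicCrystal

namespace HarmonicCrystal

open Filter Topology MeasureTheory ProbabilityTheory

namespace PhaseSpace

variable {d n : ℕ} {α : ℝ}

open Classical in
/-- The field of `H_α` with the value `p` at `x` and `0` elsewhere. -/
noncomputable def singleL (d n : ℕ) (α : ℝ) (x : Lattice d) : PhaseVec n →L[ℝ] PhaseSpace d n α :=
  (isoL2 (α := α)).symm.toContinuousLinearEquiv.toContinuousLinearMap ∘L
    (⟨√(weight α x) • lp.lsingle (E := fun _ : Lattice d => PhaseVec n) 2 x,
      (lp.isometry_single (E := fun _ : Lattice d => PhaseVec n) (p := 2) x).continuous.const_smul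
        (√(weight α x))⟩ : PhaseVec n →L[ℝ] RSeq d n)

open Classical in
theorem isoL2_singleL (x : Lattice d) (p : PhaseVec n) :
    isoL2 (singleL d n α x p) = √(weight α x) • lp.single 2 x p :=
  (isoL2 (α := α)).apply_symm_apply _

open Classical in
theorem singleL_apply (x y : Lattice d) (p : PhaseVec n) :
    singleL d n α x p y = if y = x then p else 0 := by
  have h1 := (sqrt_weight_pos α y).ne'
  have h : √(weight α y) • singleL d n α x p y = √(weight α x) • (Pi.single x p : Lattice d → PhaseVec n) y := by
    rw [← isoL2_apply, isoL2_singleL]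
    rfl
  rw [← smul_right_injective _ h1 |>.eq_iff]
  refine h.trans ?_
  by_cases hyx : y = x
  · subst hyx
    simp
  · simp [hyx]

theorem hasSum_singleL (Y : PhaseSpace d n α) : HasSum (fun x => singleL d n α x (Y x)) Y := by
  classical
  have h := lp.hasSum_single (p := 2) (by norm_num) (isoL2 Y)
  have h2 := (isoL2 (α := α)).symm.toContinuousLinearEquiv.toContinuousLinearMap.hasSum h
  refine (HasSum.congr_fun h2 fun x => ?_).trans_eq (by simp)
  refine (isoL2 (α := α)).injective ?_
  rw [isoL2_singleL]
  simp [isoL2_apply]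

theorem summable_apply (Y : PhaseSpace d n α) : Summable fun x => weight α x * ‖Y x‖ ^ 2 := Y.2

/-- The squared norm as a series. -/
theorem norm_sq_eq_tsum_weight (Y : PhaseSpace d n α) : ‖Y‖ ^ 2 = ∑' x, weight α x * ‖Y x‖ ^ 2 := by
  rw [← (isoL2 (α := α)).norm_map, norm_sq_eq_tsum]
  refine tsum_congr fun x => ?_
  rw [isoL2_apply, norm_smul, mul_pow, Real.norm_eq_abs, sq_abs, Real.sq_sqrt (weight_pos α x).le]

end PhaseSpace

theorem coeFn_sum_smul {Ω ι : Type*} [MeasurableSpace Ω] {P : Measure Ω} (s : Finset ι) (c : ι → ℝ)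
    (F : ι → Lp ℝ 2 P) :
    ((∑ i ∈ s, c i • F i : Lp ℝ 2 P) : Ω → ℝ) =ᵐ[P] fun ω => ∑ i ∈ s, c i * F i ω := by
  classical
  induction s using Finset.induction with
  | empty =>
    simp only [Finset.sum_empty]
    exact Lp.coeFn_zero _ _ _
  | insert i s hi ih =>
    simp only [Finset.sum_insert hi]
    filter_upwards [Lp.coeFn_add (c i • F i) (∑ i ∈ s, c i • F i), ih,
      Lp.coeFn_smul (c i) (F i)] with ω h1 h2 h3
    rw [h1, Pi.add_apply, h2, h3, Pi.smul_apply, smul_eq_mul]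

/-- A positive semidefinite form on the test functions with bounded diagonal is the covariance of a
Gaussian probability measure on `H_α`, for `α < -d/2`. -/
theorem exists_gaussian {d n : ℕ} {α : ℝ} (hα : α < -(d : ℝ) / 2)
    (B : TestSpace d n →ₗ[ℝ] TestSpace d n →ₗ[ℝ] ℝ) (hsymm : ∀ x y, B x y = B y x)
    (hB : ∀ x, 0 ≤ B x x) (C : ℝ)
    (hC : ∀ x p, B (Finsupp.single x p) (Finsupp.single x p) ≤ C * ‖p‖ ^ 2) :
    ∃ μ : Measure (PhaseSpace d n α), IsProbabilityMeasure μ ∧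
      ∀ Ψ, charFunctional μ Ψ = Complex.exp (-(1 / 2 : ℂ) * (B Ψ Ψ : ℂ)) := by
  obtain ⟨K, _, _, _, j, hj⟩ := exists_hilbert_of_nonneg B hsymm hB
  obtain ⟨Ω, _, P, _, G, hG⟩ := exists_isonormal K
  let e := stdOrthonormalBasis ℝ (PhaseVec n)
  let Z : Lattice d → Ω → PhaseVec n := fun x ω => ∑ k, G (j (Finsupp.single x (e k))) ω • e k
  have hZm : ∀ x, Measurable (Z x) := fun x =>
    Finset.measurable_sum _ fun k _ => (Lp.stronglyMeasurable _).measurable.smul_const _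
  have hZsq : ∀ x ω, ‖Z x ω‖ ^ 2 = ∑ k, (G (j (Finsupp.single x (e k))) ω) ^ 2 := fun x ω => by
    rw [← e.sum_sq_norm_inner_right]
    refine Finset.sum_congr rfl fun k _ => ?_
    rw [e.orthonormal.inner_right_fintype, Real.norm_eq_abs, sq_abs]
  have hlint : ∀ x, ∫⁻ ω, ENNReal.ofReal (weight α x * ‖Z x ω‖ ^ 2) ∂P ≤
      ENNReal.ofReal (weight α x * (Module.finrank ℝ (PhaseVec n) * C)) := fun x => by
    have hint : ∀ k, Integrable (fun ω => (G (j (Finsupp.single x (e k))) ω) ^ 2) P := fun k =>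
      (Lp.memLp (G (j (Finsupp.single x (e k))))).integrable_sq
    rw [← ofReal_integral_eq_lintegral_ofReal]
    · refine ENNReal.ofReal_le_ofReal ?_
      rw [integral_const_mul]
      refine mul_le_mul_of_nonneg_left ?_ (weight_pos α x).le
      simp only [hZsq]
      rw [integral_finsetSum _ fun k _ => hint k]
      have : ∀ k, ∫ ω, (G (j (Finsupp.single x (e k))) ω) ^ 2 ∂P ≤ C := fun k => by
        have h1 : ∫ ω, (G (j (Finsupp.single x (e k))) ω) ^ 2 ∂P =
            ‖G (j (Finsupp.single x (e k)))‖ ^ 2 := by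
          rw [← real_inner_self_eq_norm_sq, L2.inner_def]
          refine integral_congr_ae (Eventually.of_forall fun ω => ?_)
          simp [pow_two]
        rw [h1, G.norm_map, ← real_inner_self_eq_norm_sq, hj]
        simpa using hC x (e k)
      refine (Finset.sum_le_sum fun k _ => this k).trans ?_
      simp
    · simp only [hZsq]
      exact (integrable_finsetSum _ fun k _ => hint k).const_mul _
    · exact Eventually.of_forall fun ω => mul_nonneg (weight_pos α x).le (sq_nonneg _)
  have hC0 : 0 ≤ Module.finrank ℝ (PhaseVec n) * C := by
    rcases Nat.eq_zero_or_pos (Module.finrank ℝ (PhaseVec n)) with h0 | h0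
    · simp [h0]
    · have := (hB _).trans (hC 0 (e ⟨0, h0⟩))
      simp at this
      positivity
  have hae : ∀ᵐ ω ∂P, Summable fun x => weight α x * ‖Z x ω‖ ^ 2 := by
    have hfin : ∫⁻ ω, ∑' x, ENNReal.ofReal (weight α x * ‖Z x ω‖ ^ 2) ∂P ≠ ∞ := by
      rw [lintegral_tsum fun x => by
        have := hZm x
        fun_prop]
      refine ne_top_of_le_ne_top ?_ (ENNReal.tsum_le_tsum hlint)
      exact ((summable_weight hα).mul_right _).tsum_ofReal_ne_top
    have := ae_lt_top' (AEMeasurable.tsum fun x => by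
      have := hZm x
      fun_prop) hfin
    filter_upwards [this] with ω hω
    refine (ENNReal.summable_toReal hω.ne).congr fun x => ?_
    exact ENNReal.toReal_ofReal (mul_nonneg (weight_pos α x).le (sq_nonneg _))
  classical
  let Φ : Ω → PhaseSpace d n α := fun ω =>
    if h : Summable fun x => weight α x * ‖Z x ω‖ ^ 2 then ⟨fun x => Z x ω, h⟩ else 0
  have hΦ : ∀ᵐ ω ∂P, ∀ x, Φ ω x = Z x ω := by
    filter_upwards [hae] with ω hω x
    have : Φ ω = ⟨fun x => Z x ω, hω⟩ := dif_pos hω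
    rw [this]
  have hΦm : AEMeasurable Φ P := by
    refine aemeasurable_of_tendsto_metrizable_ae (atTop : Filter (Finset (Lattice d)))
      (f := fun s ω => ∑ x ∈ s, PhaseSpace.singleL d n α x (Z x ω)) (fun s => ?_) ?_
    · refine (Finset.measurable_sum _ fun x _ => ?_).aemeasurable
      exact (PhaseSpace.singleL d n α x).continuous.measurable.comp (hZm x)
    · filter_upwards [hΦ] with ω hω
      have := PhaseSpace.hasSum_singleL (Φ ω)
      simp only [hω] at this
      exact this
  refine ⟨P.map Φ, Measure.isProbabilityMeasure_map hΦm, fun Ψ => ?_⟩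
  have hpm : Continuous fun Y : PhaseSpace d n α => pairing Y Ψ := by
    unfold pairing
    refine continuous_finsetSum _ fun x _ => ?_
    have := (PhaseSpace.evalL d n α x).continuous
    simp only [← PhaseSpace.evalL_apply]
    fun_prop
  rw [charFunctional, integral_map hΦm (aestronglyMeasurable_exp_I hpm.aestronglyMeasurable)]
  have hpair : ∀ᵐ ω ∂P, pairing (Φ ω) Ψ = G (j Ψ) ω := by
    have hΨ : G (j Ψ) = ∑ q ∈ Ψ.support ×ˢ Finset.univ,
        inner ℝ (e q.2) (Ψ q.1) • G (j (Finsupp.single q.1 (e q.2))) := by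
      have : Ψ = ∑ q ∈ Ψ.support ×ˢ Finset.univ,
          inner ℝ (e q.2) (Ψ q.1) • Finsupp.single q.1 (e q.2) := by
        conv_lhs => rw [← Finsupp.sum_single Ψ]
        rw [Finsupp.sum, Finset.sum_product]
        refine Finset.sum_congr rfl fun x _ => ?_
        conv_lhs => rw [← e.sum_repr (Ψ x)]
        rw [Finsupp.single_finsetSum]
        refine Finset.sum_congr rfl fun k _ => ?_
        rw [Finsupp.smul_single, e.repr_apply_apply]
      conv_lhs => rw [this]
      simp only [map_sum, map_smul]
    rw [hΨ]
    filter_upwards [hΦ, coeFn_sum_smul (Ψ.support ×ˢ Finset.univ)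
      (fun q => inner ℝ (e q.2) (Ψ q.1)) (fun q => G (j (Finsupp.single q.1 (e q.2))))] with ω h1 h2
    rw [h2, Finset.sum_product, pairing]
    refine Finset.sum_congr rfl fun x _ => ?_
    rw [h1 x, sum_inner]
    refine Finset.sum_congr rfl fun k _ => ?_
    rw [real_inner_smul_left, mul_comm]
  rw [integral_congr_ae (g := fun ω => Complex.exp (Complex.I * (G (j Ψ) ω : ℂ)))
    (hpair.mono fun ω hω => by simp only [hω]), hG, ← real_inner_self_eq_norm_sq, hj]

end HarmonicCrystal

namespace HarmonicCrystal

open Filter Topology MeasureTheory ProbabilityTheory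

/-! ### Weak convergence of Gaussian measures on the phase space -/

variable {d n : ℕ} {α : ℝ}

theorem pairing_eq_sum {s : Finset (Lattice d)} {Ψ : TestSpace d n} (h : Ψ.support ⊆ s)
    (Y : PhaseSpace d n α) : pairing Y Ψ = ∑ x ∈ s, inner ℝ (Y x) (Ψ x) := by
  refine Finset.sum_subset h fun x _ hx => ?_
  rw [Finsupp.notMem_support_iff.1 hx, inner_zero_right]

theorem pairing_smul (Y : PhaseSpace d n α) (r : ℝ) (Ψ : TestSpace d n) :
    pairing Y (r • Ψ) = r * pairing Y Ψ := by
  rw [pairing_eq_sum Finsupp.support_smul, pairing, Finset.mul_sum]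
  refine Finset.sum_congr rfl fun x _ => ?_
  rw [Finsupp.smul_apply, inner_smul_right]

theorem pairing_single (Y : PhaseSpace d n α) (x : Lattice d) (p : PhaseVec n) :
    pairing Y (Finsupp.single x p) = inner ℝ (Y x) p := by
  rw [pairing_eq_sum Finsupp.support_single_subset]
  simp

theorem continuous_apply (x : Lattice d) : Continuous fun Y : PhaseSpace d n α => Y x := by
  have := (PhaseSpace.evalL d n α x).continuous
  simpa only [← PhaseSpace.evalL_apply] using this

theorem continuous_pairing (Ψ : TestSpace d n) :
    Continuous fun Y : PhaseSpace d n α => pairing Y Ψ :=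
  continuous_finsetSum _ fun x _ => (continuous_apply x).inner continuous_const

/-- The second moments of a Gaussian measure are read off from its characteristic functional. -/
theorem lintegral_pairing_sq {μ : Measure (PhaseSpace d n α)} [IsProbabilityMeasure μ]
    {Ψ : TestSpace d n} {q : ℝ} (hq : 0 ≤ q)
    (h : ∀ r : ℝ, charFunctional μ (r • Ψ) = Complex.exp (-(1 / 2 : ℂ) * ((r ^ 2 * q : ℝ) : ℂ))) :
    ∫⁻ Y, ENNReal.ofReal ((pairing Y Ψ) ^ 2) ∂μ = ENNReal.ofReal q := by
  have hm : Measurable fun Y : PhaseSpace d n α => pairing Y Ψ := (continuous_pairing Ψ).measurable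
  have := Measure.isProbabilityMeasure_map (μ := μ) hm.aemeasurable
  have hlaw : μ.map (fun Y => pairing Y Ψ) = gaussianReal 0 q.toNNReal := by
    refine Measure.ext_of_charFun (funext fun r => ?_)
    rw [charFun_gaussianReal, charFun_apply_real, integral_map hm.aemeasurable
      (by fun_prop : Continuous fun x : ℝ => Complex.exp (r * x * Complex.I)).aestronglyMeasurable]
    refine (integral_congr_ae (Eventually.of_forall fun Y => ?_)).trans ((h r).trans ?_)
    · simp only [pairing_smul]
      push_cast
      ring_nf
    · congr 1
      simp only [Real.coe_toNNReal q hq]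
      push_cast
      ring
  have h1 : ∫⁻ Y, ENNReal.ofReal ((pairing Y Ψ) ^ 2) ∂μ =
      ∫⁻ x, ENNReal.ofReal (x ^ 2) ∂(gaussianReal 0 q.toNNReal) := by
    rw [← hlaw, lintegral_map (by fun_prop) hm]
  have h2 := variance_of_integral_eq_zero (μ := gaussianReal 0 q.toNNReal) (X := id) aemeasurable_id
    (by simp)
  rw [variance_id_gaussianReal] at h2
  have h3 : Integrable (fun x : ℝ => x ^ 2) (gaussianReal 0 q.toNNReal) :=
    (memLp_id_gaussianReal 2).integrable_sq
  rw [h1, ← ofReal_integral_eq_lintegral_ofReal h3 (Eventually.of_forall fun x => sq_nonneg _)]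
  rw [Real.coe_toNNReal q hq] at h2
  congr 1
  exact h2.symm

theorem lintegral_norm_sq_apply_le {μ : Measure (PhaseSpace d n α)} [IsProbabilityMeasure μ]
    {Q : TestSpace d n → ℝ} (hQ0 : ∀ Ψ, 0 ≤ Q Ψ) (hQs : ∀ (r : ℝ) Ψ, Q (r • Ψ) = r ^ 2 * Q Ψ)
    {C : ℝ} (hC : ∀ x p, Q (Finsupp.single x p) ≤ C * ‖p‖ ^ 2)
    (h : ∀ Ψ, charFunctional μ Ψ = Complex.exp (-(1 / 2 : ℂ) * (Q Ψ : ℂ))) (x : Lattice d) :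
    ∫⁻ Y, ENNReal.ofReal (‖Y x‖ ^ 2) ∂μ ≤
      ENNReal.ofReal (Module.finrank ℝ (PhaseVec n) * C) := by
  let e := stdOrthonormalBasis ℝ (PhaseVec n)
  have h1 : ∀ Y : PhaseSpace d n α, ENNReal.ofReal (‖Y x‖ ^ 2) =
      ∑ k, ENNReal.ofReal ((pairing Y (Finsupp.single x (e k))) ^ 2) := fun Y => by
    rw [← ENNReal.ofReal_sum_of_nonneg fun k _ => sq_nonneg _, ← e.sum_sq_norm_inner_left]
    simp only [pairing_single, Real.norm_eq_abs, sq_abs]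
  simp only [h1]
  rw [lintegral_finsetSum _ fun k _ => by
    have := (continuous_pairing (α := α) (Finsupp.single x (e k))).measurable
    fun_prop]
  have h2 : ∀ k, ∫⁻ Y : PhaseSpace d n α,
      ENNReal.ofReal ((pairing Y (Finsupp.single x (e k))) ^ 2) ∂μ ≤ ENNReal.ofReal C := fun k => by
    rw [lintegral_pairing_sq (hQ0 _) fun r => by rw [h, hQs]]
    refine ENNReal.ofReal_le_ofReal ?_
    simpa using hC x (e k)
  refine (Finset.sum_le_sum fun k _ => h2 k).trans ?_
  rw [ENNReal.ofReal_mul (by positivity)]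
  simp

/-- The restriction of a field to a finite set of lattice points, extended by zero. -/
noncomputable def truncate (s : Finset (Lattice d)) (Y : PhaseSpace d n α) : PhaseSpace d n α :=
  ∑ x ∈ s, PhaseSpace.singleL d n α x (Y x)

open Classical in
theorem truncate_apply (s : Finset (Lattice d)) (Y : PhaseSpace d n α) (y : Lattice d) :
    truncate s Y y = if y ∈ s then Y y else 0 := by
  rw [truncate, ← PhaseSpace.evalL_apply, map_sum]
  simp only [PhaseSpace.evalL_apply, PhaseSpace.singleL_apply]
  exact Finset.sum_ite_eq s y _

theorem continuous_truncate (s : Finset (Lattice d)) :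
    Continuous (truncate s : PhaseSpace d n α → PhaseSpace d n α) :=
  continuous_finsetSum _ fun x _ => (PhaseSpace.singleL d n α x).continuous.comp (continuous_apply x)

theorem norm_sub_truncate_sq (s : Finset (Lattice d)) (Y : PhaseSpace d n α) :
    ‖Y - truncate s Y‖ ^ 2 = ∑' x : {x // x ∉ s}, weight α x.1 * ‖Y x.1‖ ^ 2 := by
  classical
  have h := tsum_subtype {x | x ∉ s} fun x => weight α x * ‖Y x‖ ^ 2
  refine Eq.trans ?_ h.symm
  rw [PhaseSpace.norm_sq_eq_tsum_weight]
  refine tsum_congr fun x => ?_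
  have h1 : (Y - truncate s Y) x = if x ∈ s then 0 else Y x := by
    rw [PhaseSpace.sub_apply, truncate_apply]
    split_ifs
    · exact sub_self _
    · exact sub_zero _
  rw [h1]
  by_cases hx : x ∈ s
  · rw [if_pos hx, Set.indicator_of_notMem (by simpa using hx), norm_zero]
    simp
  · rw [if_neg hx, Set.indicator_of_mem (by simpa using hx)]

theorem lintegral_norm_sub_truncate_sq_le {μ : Measure (PhaseSpace d n α)} {D : ℝ}
    (hα : α < -(d : ℝ) / 2) (hD : 0 ≤ D)
    (h : ∀ x, ∫⁻ Y, ENNReal.ofReal (‖Y x‖ ^ 2) ∂μ ≤ ENNReal.ofReal D) (s : Finset (Lattice d)) :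
    ∫⁻ Y, ENNReal.ofReal (‖Y - truncate s Y‖ ^ 2) ∂μ ≤
      ENNReal.ofReal (D * ∑' x : {x // x ∉ s}, weight α x.1) := by
  have hm : ∀ x : Lattice d, Measurable fun Y : PhaseSpace d n α => ‖Y x‖ ^ 2 := fun x =>
    ((continuous_apply x).norm.pow 2).measurable
  have h1 : ∀ Y : PhaseSpace d n α, ENNReal.ofReal (‖Y - truncate s Y‖ ^ 2) =
      ∑' x : {x // x ∉ s}, ENNReal.ofReal (weight α x.1 * ‖Y x.1‖ ^ 2) := fun Y => by
    have hs : Summable fun x : {x // x ∉ s} => weight α x.1 * ‖Y x.1‖ ^ 2 :=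
      Y.summable_apply.subtype {x | x ∉ s}
    rw [norm_sub_truncate_sq, ENNReal.ofReal_tsum_of_nonneg
      (fun x => mul_nonneg (weight_pos α _).le (sq_nonneg _)) hs]
  have hw : Summable fun x : {x // x ∉ s} => weight α x.1 :=
    (summable_weight hα).subtype {x | x ∉ s}
  have h2 : ∫⁻ Y, ENNReal.ofReal (‖Y - truncate s Y‖ ^ 2) ∂μ =
      ∑' x : {x // x ∉ s}, ∫⁻ Y, ENNReal.ofReal (weight α x.1 * ‖Y x.1‖ ^ 2) ∂μ :=
    (lintegral_congr h1).trans (lintegral_tsum fun x =>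
      ((hm x.1).const_mul (weight α x.1)).ennreal_ofReal.aemeasurable)
  have h3 : D * ∑' x : {x // x ∉ s}, weight α x.1 = ∑' x : {x // x ∉ s}, weight α x.1 * D := by
    rw [tsum_mul_right, mul_comm]
  have h4 : ENNReal.ofReal (∑' x : {x // x ∉ s}, weight α x.1 * D) =
      ∑' x : {x // x ∉ s}, ENNReal.ofReal (weight α x.1 * D) :=
    ENNReal.ofReal_tsum_of_nonneg (fun x => mul_nonneg (weight_pos α _).le hD) (hw.mul_right D)
  rw [h2, h3, h4]
  refine ENNReal.tsum_le_tsum fun x => ?_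
  rw [ENNReal.ofReal_mul (weight_pos α x.1).le,
    lintegral_congr fun Y => ENNReal.ofReal_mul (weight_pos α x.1).le,
    lintegral_const_mul _ (hm x.1).ennreal_ofReal]
  gcongr
  exact h x.1

/-- Truncation changes the integral of a bounded Lipschitz function little, uniformly over measures
with a given bound on the second moments. -/
theorem norm_integral_sub_truncate_le {μ : Measure (PhaseSpace d n α)} [IsProbabilityMeasure μ]
    {f : PhaseSpace d n α → ℝ} {M : ℝ} (hM : ∀ x, |f x| ≤ M) {L : NNReal} (hL : LipschitzWith L f)
    (s : Finset (Lattice d)) {η : ℝ} (hη : 0 < η)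
    (h : ∫⁻ Y, ENNReal.ofReal (‖Y - truncate s Y‖ ^ 2) ∂μ ≤ ENNReal.ofReal (η ^ 2)) :
    |∫ Y, f Y ∂μ - ∫ Y, f (truncate s Y) ∂μ| ≤ 2 * L * η := by
  have hc : Continuous fun Y : PhaseSpace d n α => ‖Y - truncate s Y‖ ^ 2 :=
    (continuous_id.sub (continuous_truncate s)).norm.pow 2
  have hint : Integrable (fun Y : PhaseSpace d n α => ‖Y - truncate s Y‖ ^ 2) μ := by
    refine ⟨hc.aestronglyMeasurable, ?_⟩
    rw [hasFiniteIntegral_iff_ofReal (Eventually.of_forall fun _ => sq_nonneg _)]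
    exact h.trans_lt ENNReal.ofReal_lt_top
  have hI : ∫ Y, ‖Y - truncate s Y‖ ^ 2 ∂μ ≤ η ^ 2 := by
    rw [integral_eq_lintegral_of_nonneg_ae (Eventually.of_forall fun _ => sq_nonneg _)
      hc.aestronglyMeasurable]
    exact ENNReal.toReal_le_of_le_ofReal (sq_nonneg _) h
  have hf1 : Integrable f μ := Integrable.of_bound hL.continuous.aestronglyMeasurable M
    (Eventually.of_forall hM)
  have hf2 : Integrable (fun Y => f (truncate s Y)) μ := Integrable.of_bound
    (hL.continuous.comp (continuous_truncate s)).aestronglyMeasurable M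
    (Eventually.of_forall fun Y => hM _)
  rw [← integral_sub hf1 hf2, ← Real.norm_eq_abs]
  have hint2 : Integrable (fun Y : PhaseSpace d n α =>
      (L : ℝ) * (η + ‖Y - truncate s Y‖ ^ 2 / η)) μ :=
    ((integrable_const η).add (hint.div_const η)).const_mul _
  refine (norm_integral_le_of_norm_le hint2 (Eventually.of_forall fun Y => ?_)).trans ?_
  · have h1 := hL.dist_le_mul Y (truncate s Y)
    rw [dist_eq_norm, dist_eq_norm] at h1
    refine h1.trans (mul_le_mul_of_nonneg_left ?_ L.2)
    have h2 : 0 ≤ (‖Y - truncate s Y‖ - η) ^ 2 := sq_nonneg _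
    rw [← sub_le_iff_le_add', le_div_iff₀ hη]
    nlinarith [norm_nonneg (Y - truncate s Y)]
  · rw [integral_const_mul, integral_add (integrable_const η) (hint.div_const η), integral_div]
    simp only [integral_const, probReal_univ, smul_eq_mul, one_mul]
    have : (∫ Y, ‖Y - truncate s Y‖ ^ 2 ∂μ) / η ≤ η := by
      rw [div_le_iff₀ hη]
      nlinarith
    calc (L : ℝ) * (η + (∫ Y, ‖Y - truncate s Y‖ ^ 2 ∂μ) / η) ≤ L * (η + η) := by gcongr
      _ = _ := by ring

/-- Integrals of functions of finitely many coordinates converge when the characteristic functionals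
do, by Lévy's theorem. -/
theorem tendsto_integral_truncate {μ : ℕ → Measure (PhaseSpace d n α)}
    [∀ k, IsProbabilityMeasure (μ k)] {ν : Measure (PhaseSpace d n α)} [IsProbabilityMeasure ν]
    (h : ∀ Ψ, Tendsto (fun k => charFunctional (μ k) Ψ) atTop (𝓝 (charFunctional ν Ψ)))
    (f : PhaseSpace d n α →ᵇ ℝ) (s : Finset (Lattice d)) :
    Tendsto (fun k => ∫ Y, f (truncate s Y) ∂(μ k)) atTop (𝓝 (∫ Y, f (truncate s Y) ∂ν)) := by
  classical
  let E := PiLp 2 fun _ : s => PhaseVec n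
  let _ : MeasurableSpace E := borel E
  have : BorelSpace E := ⟨rfl⟩
  let res : PhaseSpace d n α → E := fun Y => WithLp.toLp 2 fun x => Y x
  let ext : E → PhaseSpace d n α := fun v => ∑ x : s, PhaseSpace.singleL d n α x (v x)
  have hres : Continuous res :=
    (PiLp.continuous_toLp 2 _).comp (continuous_pi fun x => continuous_apply _)
  have hext : Continuous ext := continuous_finsetSum _ fun x _ =>
    (PhaseSpace.singleL d n α x).continuous.comp (PiLp.continuous_apply 2 _ x)
  have hcomp : ∀ Y, ext (res Y) = truncate s Y := fun Y =>
    Finset.sum_coe_sort s fun x => PhaseSpace.singleL d n α x (Y x)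
  let Ψ : E → TestSpace d n := fun v =>
    Finsupp.onFinset s (fun x => if h : x ∈ s then v ⟨x, h⟩ else 0) fun x hx => by
      by_contra hxs
      simp [hxs] at hx
  have hinner : ∀ Y v, inner ℝ (res Y) v = pairing Y (Ψ v) := fun Y v => by
    rw [pairing_eq_sum Finsupp.support_onFinset_subset, PiLp.inner_apply,
      ← Finset.sum_coe_sort s]
    refine Finset.sum_congr rfl fun x _ => ?_
    simp [res]
  have hchar : ∀ (ρ : Measure (PhaseSpace d n α)) [IsProbabilityMeasure ρ] (v : E),
      charFun (ρ.map res) v = charFunctional ρ (Ψ v) := fun ρ _ v => by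
    rw [charFun_apply, integral_map hres.measurable.aemeasurable
      (by fun_prop : Continuous fun x : E =>
        Complex.exp (inner ℝ x v * Complex.I)).aestronglyMeasurable, charFunctional]
    refine integral_congr_ae (Eventually.of_forall fun Y => ?_)
    simp only [hinner]
    rw [mul_comm]
  let m : ℕ → ProbabilityMeasure E := fun k =>
    ⟨(μ k).map res, Measure.isProbabilityMeasure_map hres.measurable.aemeasurable⟩
  let m₀ : ProbabilityMeasure E :=
    ⟨ν.map res, Measure.isProbabilityMeasure_map hres.measurable.aemeasurable⟩
  have hm : Tendsto m atTop (𝓝 m₀) := by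
    refine ProbabilityMeasure.tendsto_of_tendsto_charFun fun v => ?_
    change Tendsto (fun k => charFun ((μ k).map res) v) atTop (𝓝 (charFun (ν.map res) v))
    simp only [hchar]
    exact h (Ψ v)
  have h2 := (ProbabilityMeasure.tendsto_iff_forall_integral_tendsto.1 hm)
    (f.compContinuous ⟨ext, hext⟩)
  have h3 : ∀ ρ : Measure (PhaseSpace d n α), ∫ v, f (ext v) ∂(ρ.map res) =
      ∫ Y, f (truncate s Y) ∂ρ := fun ρ => by
    refine (integral_map hres.measurable.aemeasurable
      (f.continuous.comp hext).aestronglyMeasurable).trans ?_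
    simp only [Function.comp_apply, hcomp]
  change Tendsto (fun k => ∫ v, f (ext v) ∂((μ k).map res)) atTop
    (𝓝 (∫ v, f (ext v) ∂(ν.map res))) at h2
  simpa only [h3] using h2

/-- Gaussian measures on `H_α` with pointwise convergent covariance forms that are bounded on the
diagonal converge weakly. -/
theorem tendsto_integral_of_tendsto_covariance (hα : α < -(d : ℝ) / 2)
    {μ : ℝ → Measure (PhaseSpace d n α)} (hμ : ∀ t, IsProbabilityMeasure (μ t))
    {ν : Measure (PhaseSpace d n α)} (hν : IsProbabilityMeasure ν)
    {Q : ℝ → TestSpace d n → ℝ} {Q₀ : TestSpace d n → ℝ}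
    (hQ0 : ∀ t Ψ, 0 ≤ Q t Ψ) (hQs : ∀ t (r : ℝ) Ψ, Q t (r • Ψ) = r ^ 2 * Q t Ψ)
    {C : ℝ} (hC : ∀ t x p, Q t (Finsupp.single x p) ≤ C * ‖p‖ ^ 2)
    (hQ : ∀ Ψ, Tendsto (fun t => Q t Ψ) atTop (𝓝 (Q₀ Ψ)))
    (hμc : ∀ t Ψ, charFunctional (μ t) Ψ = Complex.exp (-(1 / 2 : ℂ) * (Q t Ψ : ℂ)))
    (hνc : ∀ Ψ, charFunctional ν Ψ = Complex.exp (-(1 / 2 : ℂ) * (Q₀ Ψ : ℂ)))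
    (f : PhaseSpace d n α →ᵇ ℝ) :
    Tendsto (fun t => ∫ Y, f Y ∂(μ t)) atTop (𝓝 (∫ Y, f Y ∂ν)) := by
  classical
  have hQ00 : ∀ Ψ, 0 ≤ Q₀ Ψ := fun Ψ => ge_of_tendsto' (hQ Ψ) fun t => hQ0 t Ψ
  have hQ0s : ∀ (r : ℝ) Ψ, Q₀ (r • Ψ) = r ^ 2 * Q₀ Ψ := fun r Ψ =>
    tendsto_nhds_unique ((hQ (r • Ψ)).congr fun t => hQs t r Ψ) ((hQ Ψ).const_mul _)
  have hC0 : ∀ x p, Q₀ (Finsupp.single x p) ≤ C * ‖p‖ ^ 2 := fun x p =>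
    le_of_tendsto' (hQ _) fun t => hC t x p
  have hD : 0 ≤ Module.finrank ℝ (PhaseVec n) * C := by
    rcases Nat.eq_zero_or_pos (Module.finrank ℝ (PhaseVec n)) with h0 | h0
    · simp [h0]
    · have := (hQ00 _).trans (hC0 0 (stdOrthonormalBasis ℝ (PhaseVec n) ⟨0, h0⟩))
      simp at this
      positivity
  set D := Module.finrank ℝ (PhaseVec n) * C
  have hmomμ : ∀ t x, ∫⁻ Y, ENNReal.ofReal (‖Y x‖ ^ 2) ∂(μ t) ≤ ENNReal.ofReal D := fun t =>
    lintegral_norm_sq_apply_le (hQ0 t) (hQs t) (hC t) (hμc t)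
  have hmomν : ∀ x, ∫⁻ Y, ENNReal.ofReal (‖Y x‖ ^ 2) ∂ν ≤ ENNReal.ofReal D :=
    lintegral_norm_sq_apply_le hQ00 hQ0s hC0 hνc
  have htail : Tendsto (fun s : Finset (Lattice d) => D * ∑' x : {x // x ∉ s}, weight α x.1)
      atTop (𝓝 0) := by
    simpa using (tendsto_tsum_compl_atTop_zero fun x : Lattice d => weight α x).const_mul D
  let m : ℝ → ProbabilityMeasure (PhaseSpace d n α) := fun t => ⟨μ t, hμ t⟩
  let m₀ : ProbabilityMeasure (PhaseSpace d n α) := ⟨ν, hν⟩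
  suffices h : Tendsto m atTop (𝓝 m₀) from
    (ProbabilityMeasure.tendsto_iff_forall_integral_tendsto.1 h) f
  refine tendsto_of_seq_tendsto fun u hu => ?_
  rw [tendsto_iff_forall_lipschitz_integral_tendsto]
  rintro f ⟨M, hM⟩ ⟨L, hL⟩
  have hM' : ∀ x, |f x| ≤ |f 0| + M := fun x => by
    have := hM x 0
    rw [Real.dist_eq] at this
    linarith [abs_sub_abs_le_abs_sub (f x) (f 0)]
  rw [Metric.tendsto_atTop]
  intro ε hε
  obtain ⟨η, hη, hηε⟩ : ∃ η : ℝ, 0 < η ∧ 2 * L * η < ε / 3 := by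
    refine ⟨ε / (3 * (2 * L + 1)), by positivity, ?_⟩
    have hL0 : (0 : ℝ) ≤ L := L.2
    rw [mul_div_assoc', div_lt_div_iff₀ (by positivity) (by positivity)]
    nlinarith
  obtain ⟨s, hs⟩ := ((htail.eventually (gt_mem_nhds (by positivity : 0 < η ^ 2)))).exists
  have h1 : ∀ k, |∫ Y, f Y ∂(μ (u k)) - ∫ Y, f (truncate s Y) ∂(μ (u k))| ≤ 2 * L * η := fun k =>
    norm_integral_sub_truncate_le hM' hL s hη
      ((lintegral_norm_sub_truncate_sq_le hα hD (hmomμ (u k)) s).trans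
        (ENNReal.ofReal_le_ofReal hs.le))
  have h2 : |∫ Y, f Y ∂ν - ∫ Y, f (truncate s Y) ∂ν| ≤ 2 * L * η :=
    norm_integral_sub_truncate_le hM' hL s hη
      ((lintegral_norm_sub_truncate_sq_le hα hD hmomν s).trans (ENNReal.ofReal_le_ofReal hs.le))
  have h3 := tendsto_integral_truncate (μ := fun k => μ (u k)) (ν := ν) (fun Ψ => by
    simp only [hμc, hνc]
    have hc : Continuous fun a : ℝ => Complex.exp (-(1 / 2 : ℂ) * (a : ℂ)) := by fun_prop
    exact (hc.tendsto _).comp ((hQ Ψ).comp hu))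
    (BoundedContinuousFunction.ofNormedAddCommGroup f hL.continuous _ hM') s
  rw [Metric.tendsto_atTop] at h3
  obtain ⟨N, hN⟩ := h3 (ε / 3) (by positivity)
  refine ⟨N, fun k hk => ?_⟩
  have h4 := hN k hk
  simp only [BoundedContinuousFunction.coe_ofNormedAddCommGroup] at h4
  rw [Real.dist_eq] at h4 ⊢
  have h5 := h1 k
  change |∫ Y, f Y ∂(μ (u k)) - ∫ Y, f Y ∂ν| < ε
  rw [abs_lt] at h4 ⊢
  rw [abs_le] at h5 h2
  constructor <;> linarith [h4.1, h4.2, h5.1, h5.2, h2.1, h2.2]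

end HarmonicCrystal

namespace HarmonicCrystal

open Filter Topology MeasureTheory

/-! ### Real analyticity of the symbol -/

section Analytic

variable {E : Type*} [NormedAddCommGroup E] [NormedSpace ℝ E]

/-- A series of exponentials of linear forms that converges exponentially fast is real analytic:
its power series is the sum of the exponential series. -/
theorem analyticAt_tsum_mul_exp {ι : Type*} {a : ι → ℂ} {L : ι → E →L[ℝ] ℂ} {r : ℝ} (hr : 0 < r)
    (h : Summable fun i => ‖a i‖ * Real.exp (r * ‖L i‖)) :
    AnalyticAt ℝ (fun y => ∑' i, a i * Complex.exp (L i y)) 0 := by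
  obtain ⟨q, hq_apply, hq_norm⟩ : ∃ q : ι → (m : ℕ) →
      ContinuousMultilinearMap ℝ (fun _ : Fin m => E) ℂ,
      (∀ i m y, q i m (fun _ => y) = a i * ((L i y) ^ m / m.factorial)) ∧
      ∀ i m, ‖q i m‖ * r ^ m ≤ ‖a i‖ * ((r * ‖L i‖) ^ m / m.factorial) := by
    refine ⟨fun i m => (a i * ((m.factorial : ℂ))⁻¹) •
      (ContinuousMultilinearMap.mkPiAlgebraFin ℝ m ℂ).compContinuousLinearMap fun _ => L i,
      fun i m y => ?_, fun i m => ?_⟩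
    · simp only [smul_apply,
        ContinuousMultilinearMap.compContinuousLinearMap_apply,
        ContinuousMultilinearMap.mkPiAlgebraFin_apply, List.ofFn_const, List.prod_replicate,
        smul_eq_mul]
      field_simp
    · have h1 : ‖(ContinuousMultilinearMap.mkPiAlgebraFin ℝ m ℂ).compContinuousLinearMap
          fun _ => L i‖ ≤ ‖L i‖ ^ m := by
        refine (ContinuousMultilinearMap.norm_compContinuousLinearMap_le _ _).trans ?_
        simp
      rw [norm_smul, norm_mul, norm_inv, Complex.norm_natCast]
      calc ‖a i‖ * (m.factorial : ℝ)⁻¹ * _ * r ^ m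
          ≤ ‖a i‖ * (m.factorial : ℝ)⁻¹ * ‖L i‖ ^ m * r ^ m := by gcongr
        _ = _ := by rw [mul_pow]; ring
  have hq_exp : ∀ i m, ‖q i m‖ * r ^ m ≤ ‖a i‖ * Real.exp (r * ‖L i‖) := fun i m =>
    (hq_norm i m).trans (mul_le_mul_of_nonneg_left
      (Real.pow_div_factorial_le_exp _ (by positivity) _) (norm_nonneg _))
  have hq_le : ∀ i m, ‖q i m‖ ≤ ‖a i‖ * Real.exp (r * ‖L i‖) / r ^ m := fun i m =>
    (le_div_iff₀ (by positivity)).2 (hq_exp i m)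
  have hq_sum : ∀ m, Summable fun i => q i m := fun m =>
    Summable.of_norm_bounded (h.div_const _) fun i => hq_le i m
  have hsum : ∀ y : E, ‖y‖ ≤ r →
      Summable fun p : ι × ℕ => a p.1 * ((L p.1 y) ^ p.2 / p.2.factorial) := fun y hyr => by
    have hg : Summable fun p : ι × ℕ => ‖a p.1‖ * ((r * ‖L p.1‖) ^ p.2 / p.2.factorial) := by
      generalize hb : (fun (i : ι) (m : ℕ) => ‖a i‖ * ((r * ‖L i‖) ^ m / m.factorial)) = b
      have hb' : ∀ i m, b i m = ‖a i‖ * ((r * ‖L i‖) ^ m / m.factorial) := fun i m => by rw [← hb]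
      have h0 : ∀ i m, 0 ≤ b i m := fun i m => by
        rw [hb']
        exact mul_nonneg (norm_nonneg _) (div_nonneg (by positivity) (Nat.cast_nonneg _))
      have h1 : ∀ i, HasSum (b i) (‖a i‖ * Real.exp (r * ‖L i‖)) := fun i => by
        rw [Real.exp_eq_exp_ℝ]
        exact ((NormedSpace.expSeries_div_hasSum_exp (r * ‖L i‖)).mul_left ‖a i‖).congr_fun
          fun m => hb' i m
      have h2 : Summable fun p : ι × ℕ => b p.1 p.2 :=
        (summable_prod_of_nonneg (f := fun p : ι × ℕ => b p.1 p.2) fun p => h0 p.1 p.2).2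
          ⟨fun i => (h1 i).summable, h.congr fun i => ((h1 i).tsum_eq).symm⟩
      exact h2.congr fun p => hb' p.1 p.2
    refine Summable.of_norm_bounded hg fun p => ?_
    · rw [norm_mul, norm_div, norm_pow, Complex.norm_natCast]
      gcongr
      rw [mul_comm r]
      exact (L p.1).le_of_opNorm_le_of_le le_rfl hyr
  refine ⟨fun m => ∑' i, q i m, ENNReal.ofReal r, ?_, ENNReal.ofReal_pos.2 hr, ?_⟩
  · refine FormalMultilinearSeries.le_radius_of_bound _ (r := r.toNNReal)
      (∑' i, ‖a i‖ * Real.exp (r * ‖L i‖)) fun m => ?_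
    have h1 : ‖∑' i, q i m‖ ≤ (∑' i, ‖a i‖ * Real.exp (r * ‖L i‖)) / r ^ m :=
      tsum_of_norm_bounded (h.hasSum.div_const _) fun i => hq_le i m
    rw [Real.coe_toNNReal _ hr.le]
    exact (le_div_iff₀ (by positivity)).1 h1
  · intro y hy
    have hyr : ‖y‖ ≤ r := by
      have : ‖y‖ < r := by
        simpa [Metric.eball_ofReal] using hy
      exact this.le
    rw [zero_add]
    have h1 : HasSum (fun i => a i * Complex.exp (L i y))
        (∑' p : ι × ℕ, a p.1 * ((L p.1 y) ^ p.2 / p.2.factorial)) := by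
      refine (hsum y hyr).hasSum.prod_fiberwise fun i => ?_
      rw [Complex.exp_eq_exp_ℂ]
      exact (NormedSpace.expSeries_div_hasSum_exp (L i y)).mul_left (a i)
    rw [h1.tsum_eq]
    refine ((Equiv.prodComm ℕ ι).hasSum_iff.2 (hsum y hyr).hasSum).prod_fiberwise fun m => ?_
    refine (ContinuousMultilinearMap.hasSum_eval (hq_sum m).hasSum (fun _ => y)).congr_fun
      fun i => ?_
    exact (hq_apply i m y).symm

end Analytic

variable {d n : ℕ} {V : Lattice d → Matrix (Fin n) (Fin n) ℝ}

/-- The linear form `θ ↦ z · θ`. -/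
noncomputable def phaseL (z : Lattice d) : (Fin d → ℝ) →L[ℝ] ℝ :=
  ∑ i, (z i : ℝ) • ContinuousLinearMap.proj i

theorem phaseL_apply (z : Lattice d) (θ : Fin d → ℝ) : phaseL z θ = phase z θ := by
  simp [phaseL, phase]

theorem norm_phaseL_le (z : Lattice d) : ‖phaseL z‖ ≤ d * √(latticeSq z) := by
  refine ContinuousLinearMap.opNorm_le_bound _ (by positivity) fun θ => ?_
  rw [phaseL_apply, phase]
  refine (norm_sum_le _ _).trans ?_
  have h : ∀ i ∈ Finset.univ, ‖(z i : ℝ) * θ i‖ ≤ √(latticeSq z) * ‖θ‖ := fun i _ => by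
    rw [norm_mul]
    gcongr
    · refine Real.le_sqrt_of_sq_le ?_
      rw [Real.norm_eq_abs, sq_abs]
      exact Finset.single_le_sum (f := fun i => (z i : ℝ) ^ 2) (fun i _ => sq_nonneg _)
        (Finset.mem_univ i)
    · exact norm_le_pi_norm θ i
  refine (Finset.sum_le_sum h).trans ?_
  simp [mul_assoc]

@[fun_prop]
theorem continuous_phase (z : Lattice d) : Continuous (phase z) := by
  exact (phaseL z).continuous.congr fun θ => phaseL_apply z θ

theorem phase_add (z : Lattice d) (θ θ' : Fin d → ℝ) :
    phase z (θ + θ') = phase z θ + phase z θ' := by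
  simp only [← phaseL_apply, map_add]

theorem norm_exp_I_mul_phase (z : Lattice d) (θ : Fin d → ℝ) :
    ‖Complex.exp (Complex.I * (phase z θ : ℂ))‖ = 1 := by
  rw [mul_comm, Complex.norm_exp_ofReal_mul_I]

theorem ExpDecay.analyticAt_symbol (hV : ExpDecay V) (k l : Fin n) (θ₀ : Fin d → ℝ) :
    AnalyticAt ℝ (fun θ => symbol V θ k l) θ₀ := by
  obtain ⟨κ, hκ, h⟩ := hV.exists_summable_exp
  let a : Lattice d → ℂ := fun z => V z k l * Complex.exp (Complex.I * (phase z θ₀ : ℂ))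
  let L : Lattice d → (Fin d → ℝ) →L[ℝ] ℂ := fun z => (phaseL z).smulRight Complex.I
  have hL : ∀ z, ‖L z‖ = ‖phaseL z‖ := fun z => by simp [L]
  have hs : Summable fun z => ‖a z‖ * Real.exp (κ / (d + 1) * ‖L z‖) := by
    refine Summable.of_nonneg_of_le (fun z => by positivity) (fun z => ?_) (h k l)
    have h1 : κ / (d + 1) * ‖L z‖ ≤ κ * √(latticeSq z) := by
      rw [hL]
      calc κ / (d + 1) * ‖phaseL z‖ ≤ κ / (d + 1) * ((d + 1) * √(latticeSq z)) := by
            gcongr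
            exact (norm_phaseL_le z).trans (by gcongr; linarith)
        _ = _ := by field_simp
    rw [norm_mul, norm_exp_I_mul_phase, mul_one, Complex.norm_real, Real.norm_eq_abs]
    gcongr
  have h0 := analyticAt_tsum_mul_exp (E := Fin d → ℝ) (r := κ / (d + 1)) (by positivity) hs
  have h1 : AnalyticAt ℝ (fun θ : Fin d → ℝ => θ - θ₀) θ₀ := analyticAt_id.sub analyticAt_const
  have h2 := AnalyticAt.fun_comp (g := fun y => ∑' i, a i * Complex.exp (L i y))
    (f := fun θ : Fin d → ℝ => θ - θ₀) (x := θ₀) (by rwa [sub_self]) h1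
  refine h2.congr (Eventually.of_forall fun θ => ?_)
  simp only [symbol, Matrix.of_apply]
  refine tsum_congr fun z => ?_
  simp only [a, L, ContinuousLinearMap.smulRight_apply, phaseL_apply]
  have : phase z θ = phase z θ₀ + phase z (θ - θ₀) := by rw [← phase_add]; simp
  rw [this, mul_assoc, ← Complex.exp_add]
  congr 2
  simp only [Complex.real_smul]
  push_cast
  ring

theorem ExpDecay.continuous_symbol (hV : ExpDecay V) : Continuous (symbol V) :=
  continuous_matrix fun k l =>
    continuous_iff_continuousAt.2 fun θ => (hV.analyticAt_symbol k l θ).continuousAt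

/-! ### Zero sets of real analytic functions -/

section ZeroSet

variable {E : Type*} [NormedAddCommGroup E] [NormedSpace ℝ E] [FiniteDimensional ℝ E]
  [MeasurableSpace E] [BorelSpace E]

/-- A real analytic function on a connected open set vanishes almost nowhere or identically. On
every line through a point where it does not vanish its zeros are isolated. -/
theorem measure_zero_of_analytic (μ : Measure E) [μ.IsAddHaarMeasure] {F : Type*}
    [NormedAddCommGroup F] [NormedSpace ℝ F]
    {U : Set E} (hU : IsOpen U) (hUc : IsPreconnected U)
    {f : E → F} (hf : AnalyticOnNhd ℝ f U) {x₀ : E} (hx₀ : x₀ ∈ U) (hfx : f x₀ ≠ 0) :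
    μ {x | x ∈ U ∧ f x = 0} = 0 := by
  refine measure_null_of_locally_null _ fun x hx => ?_
  obtain ⟨ε, hε, hball⟩ := Metric.isOpen_iff.1 hU x hx.1
  -- the function does not vanish identically near `x`, by the identity theorem
  obtain ⟨y, hy, hfy⟩ : ∃ y ∈ Metric.ball x (ε / 2), f y ≠ 0 := by
    by_contra! hcon
    refine hfx (hf.eqOn_zero_of_preconnected_of_eventuallyEq_zero hUc hx.1 ?_ hx₀)
    filter_upwards [Metric.ball_mem_nhds x (half_pos hε)] with y hy using hcon y hy
  have hB : Metric.ball x (ε / 2) ⊆ U := (Metric.ball_subset_ball (by linarith)).trans hball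
  have hnear : ∀ᶠ y' in 𝓝 y, y' ∈ Metric.ball x (ε / 2) ∧ f y' ≠ 0 :=
    (Metric.isOpen_ball.eventually_mem hy).and ((hf y (hB hy)).continuousAt.eventually_ne hfy)
  obtain ⟨δ, hδ, hδy⟩ := Metric.nhds_basis_closedBall.eventually_iff.1 hnear
  set ρ := min δ (ε / 4)
  have hρ : 0 < ρ := lt_min hδ (by positivity)
  have hρB : Metric.closedBall x ρ ⊆ Metric.ball x (ε / 2) :=
    (Metric.closedBall_subset_closedBall (min_le_right _ _)).trans
      (Metric.closedBall_subset_ball (by linarith))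
  set Z := Metric.closedBall x ρ ∩ f ⁻¹' {0}
  have hZc : IsClosed Z := by
    refine ContinuousOn.preimage_isClosed_of_isClosed ?_ Metric.isClosed_closedBall
      isClosed_singleton
    exact hf.continuousOn.mono (hρB.trans hB)
  refine ⟨Z, ?_, ?_⟩
  · rw [mem_nhdsWithin_iff_exists_mem_nhds_inter]
    exact ⟨Metric.closedBall x ρ, Metric.closedBall_mem_nhds x hρ,
      fun z hz => ⟨hz.1, hz.2.2⟩⟩
  -- on the lines in the direction `y - x` the zeros near `x` are isolated
  set v := y - x
  have key : ∀ p : E, ∀ᵐ t : ℝ, p + (LinearMap.toSpanSingleton ℝ E v) t ∈ Zᶜ := fun p => by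
    by_cases hne : ∃ t₀ : ℝ, p + t₀ • v ∈ Z
    swap
    · refine Eventually.of_forall fun t ht => hne ⟨t, ?_⟩
      simpa using ht
    obtain ⟨t₀, ht₀⟩ := hne
    set ℓ : ℝ → E := fun t => p + t • v
    have hℓc : Continuous ℓ := by fun_prop
    set I := ℓ ⁻¹' Metric.ball x (ε / 2)
    have hIo : IsOpen I := Metric.isOpen_ball.preimage hℓc
    have hIconv : Convex ℝ I := by
      have h1 := (convex_ball x (ε / 2)).affine_preimage (AffineMap.lineMap p (p + v))
      have h2 : I = AffineMap.lineMap p (p + v) ⁻¹' Metric.ball x (ε / 2) := by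
        ext t
        simp [I, ℓ, AffineMap.lineMap_apply, add_comm]
      rw [h2]
      exact h1
    have h1 : t₀ + 1 ∈ I ∧ f (ℓ (t₀ + 1)) ≠ 0 := by
      refine hδy ?_
      have : ℓ (t₀ + 1) - y = p + t₀ • v - x := by simp only [ℓ, v]; module
      rw [mem_closedBall_iff_norm, this, ← mem_closedBall_iff_norm]
      exact Metric.closedBall_subset_closedBall (min_le_left _ _) ht₀.1
    have hg : AnalyticOnNhd ℝ (f ∘ ℓ) I := fun t ht => by
      have h2 : AnalyticAt ℝ ℓ t := by
        simp only [ℓ]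
        exact analyticAt_const.add (analyticAt_id.smul analyticAt_const)
      exact (hf _ (hB ht)).comp h2
    have h2 := hg.preimage_zero_mem_codiscreteWithin h1.2 h1.1
      ⟨⟨_, h1.1⟩, hIconv.isPreconnected⟩
    have h3 : ∀ᵐ t ∂(volume.restrict I), f (ℓ t) ≠ 0 := by
      have := ae_restrict_le_codiscreteWithin (μ := volume) hIo.measurableSet h2
      exact this
    rw [ae_restrict_iff' hIo.measurableSet] at h3
    filter_upwards [h3] with t ht htZ
    have htZ' : ℓ t ∈ Z := by simpa [ℓ] using htZ
    exact ht (hρB htZ'.1) htZ'.2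
  have h4 := ae_mem_of_ae_add_linearMap_mem (LinearMap.toSpanSingleton ℝ E v) volume μ
    hZc.measurableSet.compl key
  exact measure_eq_zero_iff_ae_notMem.2 h4

end ZeroSet

end HarmonicCrystal

namespace HarmonicCrystal

open Filter Topology MeasureTheory Polynomial

/-! ### Eigenvalue branches of analytic families of Hermitian matrices -/

section Moments

variable {n : ℕ} {A : Matrix (Fin n) (Fin n) ℂ}

theorem trace_pow_eq_sum (hA : A.IsHermitian) (k : ℕ) :
    (A ^ k).trace = ((∑ i, hA.eigenvalues i ^ k : ℝ) : ℂ) := by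
  conv_lhs => rw [hA.spectral_theorem]
  rw [← map_pow, Unitary.conjStarAlgAut_apply, Matrix.trace_mul_cycle]
  simp [Matrix.diagonal_pow, Matrix.trace_diagonal]

/-- The Gram matrix `(tr A^{i+j})_{i,j<m}` of the powers of a Hermitian matrix `A`. Its rank counts
the distinct eigenvalues. -/
noncomputable def momentMatrix (A : Matrix (Fin n) (Fin n) ℂ) (m : ℕ) :
    Matrix (Fin m) (Fin m) ℝ :=
  Matrix.of fun i j => (A ^ (i + j : ℕ)).trace.re

/-- The moment matrix, bordered by the row `(1, x, …, x^m)`. Its determinant is a multiple of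
`∏ (x - λ)` over the distinct eigenvalues `λ`, if there are `m` of them. -/
noncomputable def borderedMoment (A : Matrix (Fin n) (Fin n) ℂ) (m : ℕ) (x : ℝ) :
    Matrix (Fin (m + 1)) (Fin (m + 1)) ℝ :=
  Matrix.of fun i j => Fin.lastCases (motive := fun _ => ℝ) (x ^ (j : ℕ))
    (fun i : Fin m => (A ^ (i + j : ℕ)).trace.re) i

/-- The distinct eigenvalues of a Hermitian matrix. -/
noncomputable def eigs (hA : A.IsHermitian) : Finset ℝ := Finset.univ.image hA.eigenvalues

theorem mem_eigs (hA : A.IsHermitian) (x : ℝ) : x ∈ eigs hA ↔ x ∈ spectrum ℝ A := by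
  rw [hA.spectrum_real_eq_range_eigenvalues, eigs]
  simp

theorem sum_coeff_mul_trace (hA : A.IsHermitian) {m : ℕ} {q : ℝ[X]} (hq : q.natDegree < m)
    (i : ℕ) : ∑ j : Fin m, q.coeff j * (A ^ (i + j : ℕ)).trace.re =
      ∑ k, hA.eigenvalues k ^ i * q.eval (hA.eigenvalues k) := by
  simp only [trace_pow_eq_sum hA, Complex.ofReal_re, Finset.mul_sum]
  rw [Finset.sum_comm]
  refine Finset.sum_congr rfl fun k _ => ?_
  rw [eval_eq_sum_range' hq, ← Fin.sum_univ_eq_sum_range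
    (fun j => q.coeff j * hA.eigenvalues k ^ j), Finset.mul_sum]
  refine Finset.sum_congr rfl fun j _ => ?_
  ring

theorem eval_prod_eigs (hA : A.IsHermitian) (k : Fin n) :
    (∏ μ ∈ eigs hA, (X - C μ)).eval (hA.eigenvalues k) = 0 := by
  rw [eval_prod]
  refine Finset.prod_eq_zero (i := hA.eigenvalues k)
    (Finset.mem_image_of_mem _ (Finset.mem_univ _)) ?_
  simp

theorem natDegree_prod_eigs (hA : A.IsHermitian) :
    (∏ μ ∈ eigs hA, (X - C μ)).natDegree = (eigs hA).card := by
  simp [natDegree_finsetProd_X_sub_C_eq_card]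

theorem monic_prod_eigs (hA : A.IsHermitian) : (∏ μ ∈ eigs hA, (X - C μ)).Monic :=
  monic_prod_of_monic _ _ fun μ _ => monic_X_sub_C μ

/-- The moment matrix is the Gram matrix of the monomials of degree less than `m` on the eigenvalues, so
it is singular exactly when a nonzero polynomial of degree less than `m` vanishes there. -/
theorem det_momentMatrix_ne_zero_iff (hA : A.IsHermitian) (m : ℕ) :
    (momentMatrix A m).det ≠ 0 ↔ m ≤ (eigs hA).card := by
  rw [Ne, ← Matrix.exists_mulVec_eq_zero_iff, ← not_lt, not_iff_not]
  constructor
  · rintro ⟨v, hv, hGv⟩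
    by_contra hm
    refine hv ?_
    set p : ℝ[X] := ∑ i : Fin m, monomial i (v i) with hp
    have hcoeff : ∀ i : Fin m, p.coeff i = v i := fun i => by
      simp [hp, coeff_monomial, Fin.val_inj]
    have hdeg : p.degree < m := by
      refine (degree_sum_le _ _).trans_lt ?_
      rw [Finset.sup_lt_iff (by exact_mod_cast WithBot.bot_lt_coe m)]
      intro i _
      exact (degree_monomial_le _ _).trans_lt (by exact_mod_cast i.2)
    have hp0 : p = 0 := by
      by_cases hm0 : m = 0
      · subst hm0
        simp [hp]
      have hnd : p.natDegree < m := by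
        by_cases h0 : p = 0
        · simp [h0]; omega
        · exact (natDegree_lt_iff_degree_lt h0).2 hdeg
      -- `vᵀ G v` is the sum of the squares of the values of `p` at the eigenvalues
      have h1 : ∑ k, p.eval (hA.eigenvalues k) ^ 2 = 0 := by
        have h2 : ∀ i : Fin m, ∑ j : Fin m, p.coeff j * (A ^ (i + j : ℕ)).trace.re = 0 := fun i => by
          have := congrFun hGv i
          simp only [Matrix.mulVec, dotProduct, momentMatrix, Matrix.of_apply, Pi.zero_apply] at this
          rw [← this]
          exact Finset.sum_congr rfl fun j _ => by rw [hcoeff, mul_comm]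
        have h3 : ∑ i : Fin m, p.coeff i *
            ∑ k, hA.eigenvalues k ^ (i : ℕ) * p.eval (hA.eigenvalues k) = 0 :=
          Finset.sum_eq_zero fun i _ => by rw [← sum_coeff_mul_trace hA hnd, h2, mul_zero]
        rw [← h3]
        simp only [Finset.mul_sum]
        rw [Finset.sum_comm]
        refine Finset.sum_congr rfl fun k _ => ?_
        rw [sq]
        nth_rewrite 1 [eval_eq_sum_range' hnd]
        rw [← Fin.sum_univ_eq_sum_range (fun j => p.coeff j * hA.eigenvalues k ^ j),
          Finset.sum_mul]
        exact Finset.sum_congr rfl fun j _ => by ring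
      rw [Finset.sum_eq_zero_iff_of_nonneg fun k _ => sq_nonneg _] at h1
      refine eq_zero_of_degree_lt_of_eval_finset_eq_zero (eigs hA)
        (hdeg.trans_le (by exact_mod_cast not_lt.1 hm)) fun x hx => ?_
      obtain ⟨k, -, rfl⟩ := Finset.mem_image.1 hx
      exact pow_eq_zero_iff (two_ne_zero) |>.1 (h1 k (Finset.mem_univ k))
    funext i
    rw [← hcoeff, hp0, coeff_zero, Pi.zero_apply]
  · intro hm
    set q := ∏ μ ∈ eigs hA, (X - C μ)
    have hnd : q.natDegree = (eigs hA).card := natDegree_prod_eigs hA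
    refine ⟨fun j => q.coeff j, fun h0 => ?_, ?_⟩
    · have h1 := congrFun h0 ⟨(eigs hA).card, hm⟩
      simp only [Pi.zero_apply] at h1
      have h2 := (monic_prod_eigs hA).coeff_natDegree
      rw [hnd, h1] at h2
      exact zero_ne_one h2
    · funext i
      have h1 := sum_coeff_mul_trace hA (q := q) (m := m) (by rw [hnd]; exact hm) i
      simp only [Matrix.mulVec, dotProduct, momentMatrix, Matrix.of_apply, Pi.zero_apply]
      rw [Finset.sum_congr rfl fun j _ => mul_comm _ _, h1]
      exact Finset.sum_eq_zero fun k _ => by rw [eval_prod_eigs hA, mul_zero]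

/-- The bordered determinant is a polynomial in `x` with the eigenvalues as simple roots; column
operations with the coefficients of `∏ (X - μ)` clear the last column up to its last entry. -/
theorem det_borderedMoment (hA : A.IsHermitian) (x : ℝ) :
    (borderedMoment A (eigs hA).card x).det =
      (momentMatrix A (eigs hA).card).det * ∏ μ ∈ eigs hA, (x - μ) := by
  set m := (eigs hA).card
  set q := ∏ μ ∈ eigs hA, (X - C μ)
  have hnd : q.natDegree = m := natDegree_prod_eigs hA
  have hc : q.coeff m = 1 := by rw [← hnd]; exact (monic_prod_eigs hA).coeff_natDegree
  have h1 := Matrix.det_updateCol_sum (borderedMoment A m x) (Fin.last m) fun j => q.coeff j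
  simp only [Fin.val_last, hc, smul_eq_mul, one_mul] at h1
  have h2 : (fun k => ∑ j : Fin (m + 1), q.coeff j * borderedMoment A m x k j) =
      fun k => if k = Fin.last m then q.eval x else 0 := by
    funext k
    refine Fin.lastCases ?_ (fun i => ?_) k
    · simp only [borderedMoment, Matrix.of_apply, Fin.lastCases_last, if_true]
      rw [eval_eq_sum_range, hnd, ← Fin.sum_univ_eq_sum_range (fun j => q.coeff j * x ^ j)]
    · simp only [borderedMoment, Matrix.of_apply, Fin.lastCases_castSucc]
      rw [sum_coeff_mul_trace hA (q := q) (by rw [hnd]; omega), if_neg (Fin.castSucc_lt_last i).ne]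
      exact Finset.sum_eq_zero fun k _ => by rw [eval_prod_eigs hA, mul_zero]
  rw [← h1, h2, Matrix.det_succ_column _ (Fin.last m), Finset.sum_eq_single (Fin.last m)]
  · rw [Matrix.updateCol_self, if_pos rfl, ← two_mul, pow_mul]
    have h3 : ((borderedMoment A m x).updateCol (Fin.last m)
        fun k => if k = Fin.last m then q.eval x else 0).submatrix (Fin.last m).succAbove
        (Fin.last m).succAbove = momentMatrix A m := by
      ext i j
      simp [borderedMoment, momentMatrix]
    rw [h3, eval_prod]
    simp [mul_comm]
  · intro b _ hb
    simp [Matrix.updateCol_self, hb]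
  · simp

end Moments

section Branches

variable {E : Type*} [NormedAddCommGroup E] [NormedSpace ℝ E]

theorem analyticAt_det {ι : Type*} [Fintype ι] [DecidableEq ι] {M : E → Matrix ι ι ℝ} {x : E}
    (h : ∀ i j, AnalyticAt ℝ (fun y => M y i j) x) : AnalyticAt ℝ (fun y => (M y).det) x := by
  simp only [Matrix.det_apply']
  exact Finset.analyticAt_fun_sum _ fun σ _ =>
    analyticAt_const.mul (Finset.analyticAt_fun_prod _ fun i _ => h _ _)

theorem analyticAt_trace_pow {n : ℕ} {M : E → Matrix (Fin n) (Fin n) ℂ} {x : E}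
    (h : ∀ i j, AnalyticAt ℝ (fun y => M y i j) x) (k : ℕ) :
    AnalyticAt ℝ (fun y => (M y ^ k).trace.re) x := by
  have h1 : ∀ k, ∀ i j, AnalyticAt ℝ (fun y => (M y ^ k) i j) x := fun k => by
    induction k with
    | zero => exact fun i j => by simpa using analyticAt_const
    | succ k ih =>
      intro i j
      simp only [pow_succ, Matrix.mul_apply]
      exact Finset.analyticAt_fun_sum _ fun l _ => (ih i l).mul (h l j)
  have h2 : AnalyticAt ℝ (fun y => (M y ^ k).trace) x := by
    simp only [Matrix.trace, Matrix.diag_apply]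
    exact Finset.analyticAt_fun_sum _ fun l _ => h1 k l l
  exact (Complex.reCLM.analyticAt _).comp h2

theorem analyticAt_det_momentMatrix {n : ℕ} {M : E → Matrix (Fin n) (Fin n) ℂ} {x : E}
    (h : ∀ i j, AnalyticAt ℝ (fun y => M y i j) x) (m : ℕ) :
    AnalyticAt ℝ (fun y => (momentMatrix (M y) m).det) x :=
  analyticAt_det fun _ _ => analyticAt_trace_pow h _

theorem analyticAt_det_borderedMoment {n : ℕ} {M : E → Matrix (Fin n) (Fin n) ℂ} {p : E × ℝ}
    (h : ∀ i j, AnalyticAt ℝ (fun y => M y i j) p.1) (m : ℕ) :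
    AnalyticAt ℝ (fun y : E × ℝ => (borderedMoment (M y.1) m y.2).det) p := by
  refine analyticAt_det fun i j => ?_
  refine Fin.lastCases ?_ (fun i => ?_) i
  · simp only [borderedMoment, Matrix.of_apply, Fin.lastCases_last]
    exact analyticAt_snd.pow _
  · simp only [borderedMoment, Matrix.of_apply, Fin.lastCases_castSucc]
    exact (analyticAt_trace_pow h _).fun_comp analyticAt_fst

open scoped ContDiff in
/-- Near a point where the number of distinct eigenvalues is maximal, the distinct eigenvalues are
analytic functions, by the implicit function theorem. -/
theorem exists_analytic_eigenvalues [CompleteSpace E] {n : ℕ} {M : E → Matrix (Fin n) (Fin n) ℂ}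
    (hM : ∀ x, (M x).IsHermitian) (ha : ∀ x i j, AnalyticAt ℝ (fun y => M y i j) x) {x₀ : E}
    (hmax : ∀ x, (eigs (hM x)).card ≤ (eigs (hM x₀)).card) :
    ∃ ψ : eigs (hM x₀) → E → ℝ, ∃ ε > 0, (∀ k, AnalyticOnNhd ℝ (ψ k) (Metric.ball x₀ ε)) ∧
      ∀ x ∈ Metric.ball x₀ ε, Function.Injective (fun k => ψ k x) ∧
        ∀ y, y ∈ eigs (hM x) ↔ ∃ k, ψ k x = y := by
  set m := (eigs (hM x₀)).card with hm
  have hD : (momentMatrix (M x₀) m).det ≠ 0 := (det_momentMatrix_ne_zero_iff (hM x₀) m).2 le_rfl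
  have hDnear : ∀ᶠ x in 𝓝 x₀, (eigs (hM x)).card = m := by
    filter_upwards [(analyticAt_det_momentMatrix (ha x₀) m).continuousAt.eventually_ne hD] with x hx
    exact le_antisymm (hmax x) ((det_momentMatrix_ne_zero_iff (hM x) m).1 hx)
  set F : E × ℝ → ℝ := fun y => (borderedMoment (M y.1) m y.2).det with hF
  have hFeq : ∀ x, (eigs (hM x)).card = m → ∀ y, F (x, y) =
      (momentMatrix (M x) m).det * ∏ μ ∈ eigs (hM x), (y - μ) := fun x hx y => by
    simp only [hF]
    have := det_borderedMoment (hM x) y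
    rwa [hx] at this
  have hFan : ∀ p, AnalyticAt ℝ F p := fun p => analyticAt_det_borderedMoment (ha p.1) m
  have hbranch : ∀ k : eigs (hM x₀), ∃ ψ : E → ℝ, AnalyticAt ℝ ψ x₀ ∧ ψ x₀ = k ∧
      ∀ᶠ x in 𝓝 x₀, F (x, ψ x) = 0 := fun k => by
    have hcd : ContDiffAt ℝ ω F (x₀, (k : ℝ)) := (hFan _).contDiffAt
    have hF0 : F (x₀, (k : ℝ)) = 0 := by
      rw [hFeq x₀ rfl, Finset.prod_eq_zero k.2 (sub_self _), mul_zero]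
    have hder : fderiv ℝ F (x₀, (k : ℝ)) (0, 1) ≠ 0 := by
      have h1 : HasFDerivAt F (fderiv ℝ F (x₀, (k : ℝ))) (x₀, (k : ℝ)) :=
        (hFan _).differentiableAt.hasFDerivAt
      have h2 : HasDerivAt (fun y : ℝ => ((x₀, y) : E × ℝ)) (0, 1) (k : ℝ) :=
        (hasDerivAt_const _ _).prodMk (hasDerivAt_id _)
      have h3 := h1.comp_hasDerivAt (k : ℝ) h2
      set r : ℝ → ℝ := fun y => ∏ μ ∈ (eigs (hM x₀)).erase k, (y - μ)
      have h4 : F ∘ (fun y : ℝ => ((x₀, y) : E × ℝ)) =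
          fun y => (momentMatrix (M x₀) m).det * ((y - k) * r y) := by
        funext y
        rw [Function.comp_apply, hFeq x₀ rfl, ← Finset.mul_prod_erase _ _ k.2]
      have hr : DifferentiableAt ℝ r k := by fun_prop
      have h5 : HasDerivAt (fun y : ℝ => (momentMatrix (M x₀) m).det * ((y - k) * r y))
          ((momentMatrix (M x₀) m).det * (1 * r k + ((k : ℝ) - k) * deriv r k)) k :=
        (((hasDerivAt_id (k : ℝ)).sub_const _).mul hr.hasDerivAt).const_mul _
      rw [h4] at h3
      rw [h3.unique h5, sub_self, zero_mul, add_zero, one_mul]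
      refine mul_ne_zero hD (Finset.prod_ne_zero_iff.2 fun μ hμ => sub_ne_zero.2 ?_)
      exact (Finset.ne_of_mem_erase hμ).symm
    have hinv : (fderiv ℝ F (x₀, (k : ℝ)) ∘L .inr ℝ E ℝ).IsInvertible := by
      set c := fderiv ℝ F (x₀, (k : ℝ)) (0, 1)
      refine ⟨ContinuousLinearEquiv.smulLeft (Units.mk0 c hder), ?_⟩
      ext
      simp [c]
    refine ⟨hcd.implicitFunction (by simp) hinv, ?_, hcd.implicitFunction_apply_self _ hinv, ?_⟩
    · exact (hcd.contDiffAt_implicitFunction (by simp) hinv).analyticAt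
    · filter_upwards [hcd.eventually_apply_implicitFunction (by simp) hinv] with x hx
      rw [hx, hF0]
  choose ψ hψa hψ0 hψF using hbranch
  have hψan : ∀ᶠ x in 𝓝 x₀, ∀ k, AnalyticAt ℝ (ψ k) x :=
    eventually_all.2 fun k => (hψa k).eventually_analyticAt
  have hψinj : ∀ᶠ x in 𝓝 x₀, ∀ k l, k ≠ l → ψ k x ≠ ψ l x := by
    refine eventually_all.2 fun k => eventually_all.2 fun l => ?_
    by_cases hkl : k = l
    · exact Eventually.of_forall fun x h => absurd hkl h
    · have : ψ k x₀ ≠ ψ l x₀ := by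
        rw [hψ0, hψ0]
        exact fun h => hkl (Subtype.ext h)
      filter_upwards [((hψa k).continuousAt.sub (hψa l).continuousAt).eventually_ne
        (sub_ne_zero.2 this)] with x hx _ using sub_ne_zero.1 hx
  have hall := (hψan.and hψinj).and ((eventually_all.2 hψF).and
    (hDnear.and ((analyticAt_det_momentMatrix (ha x₀) m).continuousAt.eventually_ne hD)))
  obtain ⟨ε, hε, hball⟩ := Metric.eventually_nhds_iff_ball.1 hall
  refine ⟨ψ, ε, hε, fun k x hx => (hball x hx).1.1 k, fun x hx => ?_⟩
  obtain ⟨⟨-, hinj⟩, hzero, hcard, hDx⟩ := hball x hx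
  have hinj' : Function.Injective fun k => ψ k x := fun k l hkl => by
    by_contra h
    exact hinj k l h hkl
  refine ⟨hinj', ?_⟩
  have hmem : ∀ k, ψ k x ∈ eigs (hM x) := fun k => by
    have h1 := hzero k
    rw [hFeq x hcard, mul_eq_zero, or_iff_right hDx, Finset.prod_eq_zero_iff] at h1
    obtain ⟨μ, hμ, h2⟩ := h1
    rwa [sub_eq_zero.1 h2]
  have himg : Finset.univ.image (fun k => ψ k x) = eigs (hM x) := by
    refine Finset.eq_of_subset_of_card_le ?_ ?_
    · intro y hy
      obtain ⟨k, -, rfl⟩ := Finset.mem_image.1 hy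
      exact hmem k
    · rw [Finset.card_image_of_injective _ hinj', hcard]
      simp [hm]
  intro y
  rw [← himg]
  simp

end Branches

end HarmonicCrystal

namespace HarmonicCrystal

open Filter Topology MeasureTheory

/-! ### Group velocities do not vanish almost everywhere -/

variable {d n : ℕ} {V : Lattice d → Matrix (Fin n) (Fin n) ℝ}

/-- The index of the last coordinate. -/
def lastIdx (d : ℕ) [NeZero d] : Fin d := ⟨d - 1, Nat.sub_lt (NeZero.pos d) Nat.one_pos⟩

/-- The last unit vector. -/
def lastVec (d : ℕ) [NeZero d] : Fin d → ℝ := Pi.single (lastIdx d) 1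

/-- `θ₀` is a regular point of the dispersion relations: in a neighbourhood, the distinct
eigenvalues of the symbol are the squares of finitely many positive functions which are
differentiable at `θ₀`, take different values there and have a nonvanishing derivative in the
last direction. -/
def IsRegularPoint [NeZero d] (V : Lattice d → Matrix (Fin n) (Fin n) ℝ) (θ₀ : Fin d → ℝ) : Prop :=
  ∃ (ι : Type) (_ : Fintype ι) (ω : ι → (Fin d → ℝ) → ℝ),
    (∀ k, DifferentiableAt ℝ (ω k) θ₀) ∧ Function.Injective (fun k => ω k θ₀) ∧
    (∀ᶠ θ in 𝓝 θ₀, (∀ k, 0 < ω k θ) ∧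
      ∀ y, y ∈ spectrum ℝ (symbol V θ) ↔ ∃ k, ω k θ ^ 2 = y) ∧
    ∀ k, fderiv ℝ (ω k) θ₀ (lastVec d) ≠ 0

theorem spectrum_symbol_pos (hnonneg : NonnegDefinite V) (hdet : ∀ θ, (symbol V θ).det ≠ 0)
    {θ : Fin d → ℝ} {y : ℝ} (hy : y ∈ spectrum ℝ (symbol V θ)) : 0 < y := by
  have h1 : (symbol V θ).PosDef := (hnonneg θ).posDef_iff_det_ne_zero.2 (hdet θ)
  rw [h1.1.spectrum_real_eq_range_eigenvalues] at hy
  obtain ⟨i, rfl⟩ := hy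
  exact h1.eigenvalues_pos i

/-- Under the nondegeneracy of the Hessians almost every point is regular. -/
theorem ae_isRegularPoint [NeZero d] (hdecay : ExpDecay V) (hnonneg : NonnegDefinite V)
    (hhess : NondegenerateHessians V) (hdet : ∀ θ, (symbol V θ).det ≠ 0) :
    ∀ᵐ θ : Fin d → ℝ, IsRegularPoint V θ := by
  have hM : ∀ θ, (symbol V θ).IsHermitian := fun θ => (hnonneg θ).1
  have ha : ∀ θ k l, AnalyticAt ℝ (fun θ' => symbol V θ' k l) θ := fun θ k l =>
    hdecay.analyticAt_symbol k l θ
  obtain ⟨θ₁, hθ₁⟩ : ∃ θ₁, ∀ θ, (eigs (hM θ)).card ≤ (eigs (hM θ₁)).card := by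
    have hbdd : BddAbove (Set.range fun θ => (eigs (hM θ)).card) := by
      refine ⟨n, ?_⟩
      rintro _ ⟨θ, rfl⟩
      exact Finset.card_image_le.trans (by simp)
    obtain ⟨θ₁, h⟩ := Nat.sSup_mem (Set.range_nonempty _) hbdd
    exact ⟨θ₁, fun θ => by
      have := le_csSup hbdd (Set.mem_range_self θ)
      rwa [← h] at this⟩
  set m := (eigs (hM θ₁)).card
  set D : (Fin d → ℝ) → ℝ := fun θ => (momentMatrix (symbol V θ) m).det
  have hD : volume {θ | θ ∈ Set.univ ∧ D θ = 0} = 0 :=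
    measure_zero_of_analytic volume isOpen_univ isPreconnected_univ
      (fun θ _ => analyticAt_det_momentMatrix (ha θ) m) (Set.mem_univ θ₁)
      ((det_momentMatrix_ne_zero_iff (hM θ₁) m).2 le_rfl)
  have hloc : volume {θ | ¬ IsRegularPoint V θ ∧ D θ ≠ 0} = 0 := by
    refine measure_null_of_locally_null _ fun θ₀ hθ₀ => ?_
    have hmax : ∀ θ, (eigs (hM θ)).card ≤ (eigs (hM θ₀)).card := fun θ =>
      (hθ₁ θ).trans ((det_momentMatrix_ne_zero_iff (hM θ₀) m).1 hθ₀.2)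
    obtain ⟨ψ, ε, hε, hψ, hspec⟩ := exists_analytic_eigenvalues hM ha hmax
    set B := Metric.ball θ₀ ε
    have hBo : IsOpen B := Metric.isOpen_ball
    have hψspec : ∀ k, ∀ θ ∈ B, ψ k θ ∈ spectrum ℝ (symbol V θ) := fun k θ hθ => by
      rw [← mem_eigs (hM θ), (hspec θ hθ).2]
      exact ⟨k, rfl⟩
    have hψpos : ∀ k, ∀ θ ∈ B, 0 < ψ k θ := fun k θ hθ =>
      spectrum_symbol_pos hnonneg hdet (hψspec k θ hθ)
    set ω : eigs (hM θ₀) → (Fin d → ℝ) → ℝ := fun k θ => √(ψ k θ)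
    have hω : ∀ k, AnalyticOnNhd ℝ (ω k) B := fun k θ hθ =>
      (((hψ k θ hθ).contDiffAt (n := ⊤)).sqrt (hψpos k θ hθ).ne').analyticAt
    have hωsq : ∀ k, ∀ θ ∈ B, ω k θ ^ 2 = ψ k θ := fun k θ hθ => Real.sq_sqrt (hψpos k θ hθ).le
    have hbranch : ∀ k, IsDispersionBranch V B (ω k) := fun k =>
      { isOpen := hBo
        nonempty := ⟨θ₀, Metric.mem_ball_self hε⟩
        analytic := hω k
        nonneg := fun θ _ => Real.sqrt_nonneg _
        eigenvalue := fun θ hθ => by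
          rw [Module.End.hasEigenvalue_iff_mem_spectrum, Matrix.spectrum_toLin']
          have h1 : ((ω k θ : ℂ)) ^ 2 = algebraMap ℝ ℂ (ψ k θ) := by
            rw [← hωsq k θ hθ]
            simp
          rw [h1, spectrum.algebraMap_mem_iff]
          exact hψspec k θ hθ }
    have hdω : ∀ k, AnalyticOnNhd ℝ (fun θ => fderiv ℝ (ω k) θ (lastVec d)) B := fun k θ hθ =>
      ((ContinuousLinearMap.apply ℝ ℝ (lastVec d)).analyticAt _).comp ((hω k).fderiv θ hθ)
    have hnull : ∀ k, volume {θ | θ ∈ B ∧ fderiv ℝ (ω k) θ (lastVec d) = 0} = 0 := fun k => by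
      obtain ⟨θ₂, hθ₂, hne⟩ : ∃ θ₂ ∈ B, fderiv ℝ (ω k) θ₂ (lastVec d) ≠ 0 := by
        by_contra! hcon
        -- otherwise the last column of the Hessian vanishes on the ball
        obtain ⟨θ, hθ, hdetH⟩ := hhess B (ω k) (hbranch k)
        refine hdetH (Matrix.det_eq_zero_of_column_eq_zero (lastIdx d) fun i => ?_)
        have h1 : HasFDerivAt (fderiv ℝ (ω k)) (fderiv ℝ (fderiv ℝ (ω k)) θ) θ :=
          ((hω k).fderiv θ hθ).differentiableAt.hasFDerivAt
        have h2 : HasFDerivAt (fun θ' => fderiv ℝ (ω k) θ' (lastVec d))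
            ((fderiv ℝ (fderiv ℝ (ω k)) θ).flip (lastVec d)) θ := by
          have := h1.clm_apply (hasFDerivAt_const (lastVec d) θ)
          simpa using this
        have h3 : HasFDerivAt (fun θ' => fderiv ℝ (ω k) θ' (lastVec d))
            (0 : (Fin d → ℝ) →L[ℝ] ℝ) θ := by
          refine (hasFDerivAt_const (0 : ℝ) θ).congr_of_eventuallyEq ?_
          filter_upwards [hBo.mem_nhds hθ] with θ' hθ' using hcon θ' hθ'
        have h4 := congrArg (fun L : (Fin d → ℝ) →L[ℝ] ℝ => L (Pi.single i 1)) (h2.unique h3)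
        simpa [hessian, iteratedFDeriv_two_apply, lastVec] using h4
      exact measure_zero_of_analytic volume hBo (convex_ball θ₀ ε).isPreconnected (hdω k) hθ₂ hne
    refine ⟨B ∩ {θ | ¬ IsRegularPoint V θ ∧ D θ ≠ 0},
      inter_mem (mem_nhdsWithin_of_mem_nhds (hBo.mem_nhds (Metric.mem_ball_self hε)))
        self_mem_nhdsWithin, ?_⟩
    refine measure_mono_null (fun θ hθ => ?_) (measure_iUnion_null hnull)
    by_contra hcon
    simp only [Set.mem_iUnion, not_exists] at hcon
    refine hθ.2.1 ⟨eigs (hM θ₀), inferInstance, ω, fun k => (hω k θ hθ.1).differentiableAt,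
      fun k l hkl => (hspec θ hθ.1).1 ?_, ?_, fun k h0 => hcon k ⟨hθ.1, h0⟩⟩
    · change ψ k θ = ψ l θ
      rw [← hωsq k θ hθ.1, ← hωsq l θ hθ.1]
      exact congrArg (· ^ 2) hkl
    · filter_upwards [hBo.mem_nhds hθ.1] with θ' hθ'
      refine ⟨fun k => Real.sqrt_pos.2 (hψpos k θ' hθ'), fun y => ?_⟩
      rw [← mem_eigs (hM θ'), (hspec θ' hθ').2]
      exact exists_congr fun k => by rw [hωsq k θ' hθ']
  rw [ae_iff]
  refine measure_mono_null (t := {θ | θ ∈ Set.univ ∧ D θ = 0} ∪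
    {θ | ¬ IsRegularPoint V θ ∧ D θ ≠ 0}) (fun θ hθ => ?_) (measure_union_null hD hloc)
  by_cases h : D θ = 0
  · exact Or.inl ⟨Set.mem_univ _, h⟩
  · exact Or.inr ⟨hθ, h⟩

end HarmonicCrystal

namespace HarmonicCrystal

open Filter Topology MeasureTheory Polynomial

/-! ### Functions of self-adjoint operators -/

theorem inner_self_eq_ofReal {H : Type*} [NormedAddCommGroup H] [InnerProductSpace ℂ H] (w : H) :
    inner ℂ w w = ((‖w‖ ^ 2 : ℝ) : ℂ) :=
  (inner_self_eq_norm_sq_to_K w).trans (Complex.ofReal_pow _ _).symm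

section FunctionalCalculus

variable {H : Type*} [NormedAddCommGroup H] [InnerProductSpace ℂ H] [CompleteSpace H]
  {a : H →L[ℂ] H} {f g : ℝ → ℂ}

/-- The function `f` of a bounded self-adjoint operator, for a continuous function `f` on the real
line. -/
noncomputable def fc (f : ℝ → ℂ) (a : H →L[ℂ] H) : H →L[ℂ] H := cfc (fun z : ℂ => f z.re) a

theorem fc_mul (hf : Continuous f) (hg : Continuous g) (a : H →L[ℂ] H) :
    fc (fun x => f x * g x) a = fc f a * fc g a :=
  cfc_mul (fun z : ℂ => f z.re) (fun z : ℂ => g z.re) a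
    (hf.comp Complex.continuous_re).continuousOn (hg.comp Complex.continuous_re).continuousOn

theorem fc_mul_apply (hf : Continuous f) (hg : Continuous g) (a : H →L[ℂ] H) (w : H) :
    fc (fun x => f x * g x) a w = fc f a (fc g a w) := by
  rw [fc_mul hf hg]
  rfl

theorem fc_sum {ι : Type*} (s : Finset ι) {f : ι → ℝ → ℂ} (hf : ∀ i, Continuous (f i))
    (a : H →L[ℂ] H) : fc (fun x => ∑ i ∈ s, f i x) a = ∑ i ∈ s, fc (f i) a := by
  have := cfc_sum (fun i (z : ℂ) => f i z.re) a s
    fun i _ => ((hf i).comp Complex.continuous_re).continuousOn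
  rw [fc]
  simp only [fc, ← this]
  congr 1
  funext z
  simp

theorem fc_const_mul (c : ℂ) (hf : Continuous f) (a : H →L[ℂ] H) :
    fc (fun x => c * f x) a = c • fc f a :=
  cfc_const_mul c (fun z : ℂ => f z.re) a (hf.comp Complex.continuous_re).continuousOn

theorem fc_star (f : ℝ → ℂ) (a : H →L[ℂ] H) : fc (fun x => star (f x)) a = star (fc f a) :=
  cfc_star (fun z : ℂ => f z.re) a

theorem inner_fc_left (f : ℝ → ℂ) (a : H →L[ℂ] H) (v w : H) :
    inner ℂ (fc f a v) w = inner ℂ v (fc (fun x => star (f x)) a w) := by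
  rw [fc_star, ContinuousLinearMap.star_eq_adjoint, ContinuousLinearMap.adjoint_inner_right]

theorem mem_spectrum_re (ha : IsSelfAdjoint a) {z : ℂ} (hz : z ∈ spectrum ℂ a) :
    z.re ∈ spectrum ℝ a ∧ (z.re : ℂ) = z := by
  have h := ha.mem_spectrum_eq_re hz
  refine ⟨?_, h.symm⟩
  rw [← spectrum.algebraMap_mem_iff ℂ]
  rw [h] at hz
  exact hz

theorem fc_congr (ha : IsSelfAdjoint a) (h : ∀ x ∈ spectrum ℝ a, f x = g x) : fc f a = fc g a :=
  cfc_congr fun _ hz => h _ (mem_spectrum_re ha hz).1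

theorem fc_one (ha : IsSelfAdjoint a) : fc (fun _ => 1) a = 1 := by
  have := ha.isStarNormal
  exact cfc_const_one ℂ a

theorem norm_fc_le (ha : IsSelfAdjoint a) {c : ℝ} (hc : 0 ≤ c)
    (h : ∀ x ∈ spectrum ℝ a, ‖f x‖ ≤ c) : ‖fc f a‖ ≤ c :=
  norm_cfc_le hc fun _ hz => h _ (mem_spectrum_re ha hz).1

theorem fc_sub (hf : Continuous f) (hg : Continuous g) (a : H →L[ℂ] H) :
    fc (fun x => f x - g x) a = fc f a - fc g a :=
  cfc_sub (fun z : ℂ => f z.re) (fun z : ℂ => g z.re) a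
    (hf.comp Complex.continuous_re).continuousOn (hg.comp Complex.continuous_re).continuousOn

theorem fc_polynomial (ha : IsSelfAdjoint a) (P : ℂ[X]) :
    fc (fun x => P.eval (x : ℂ)) a = aeval a P := by
  have := ha.isStarNormal
  rw [← cfc_polynomial P a]
  refine cfc_congr fun z hz => ?_
  simp only
  rw [(mem_spectrum_re ha hz).2]

theorem fc_id (ha : IsSelfAdjoint a) : fc (fun x => (x : ℂ)) a = a := by
  have := fc_polynomial ha X
  simpa using this

/-- A function with values on the unit circle of a self-adjoint operator is an isometry. -/
theorem norm_fc_apply_of_norm_one (ha : IsSelfAdjoint a) (hf : Continuous f) (h : ∀ x, ‖f x‖ = 1)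
    (w : H) : ‖fc f a w‖ = ‖w‖ := by
  have h1 : inner ℂ (fc f a w) (fc f a w) = inner ℂ w w := by
    rw [inner_fc_left, ← fc_mul_apply hf.star hf]
    have : ∀ x, star (f x) * f x = 1 := fun x => by
      rw [Complex.star_def, Complex.conj_mul', h]
      norm_num
    simp only [this, fc_one ha, one_apply_eq_self]
  rw [inner_self_eq_ofReal, inner_self_eq_ofReal] at h1
  have h2 : ‖fc f a w‖ ^ 2 = ‖w‖ ^ 2 := Complex.ofReal_injective h1
  exact (sq_eq_sq₀ (norm_nonneg _) (norm_nonneg _)).1 h2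

/-- Weierstrass approximation of a complex valued function on an interval. -/
theorem exists_polynomial_seq (hf : Continuous f) (m M : ℝ) :
    ∃ P : ℕ → ℂ[X], ∀ j : ℕ, ∀ x ∈ Set.Icc m M, ‖(P j).eval (x : ℂ) - f x‖ ≤ 1 / ((j : ℝ) + 1) := by
  have key : ∀ j : ℕ, ∃ P : ℂ[X], ∀ x ∈ Set.Icc m M,
      ‖P.eval (x : ℂ) - f x‖ ≤ 1 / ((j : ℝ) + 1) := fun j => by
    have hj : (0 : ℝ) < 1 / ((j : ℝ) + 1) / 2 := by positivity
    obtain ⟨p, hp⟩ := exists_polynomial_near_of_continuousOn m M (fun x => (f x).re)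
      (Complex.continuous_re.comp hf).continuousOn _ hj
    obtain ⟨q, hq⟩ := exists_polynomial_near_of_continuousOn m M (fun x => (f x).im)
      (Complex.continuous_im.comp hf).continuousOn _ hj
    refine ⟨p.map Complex.ofRealHom + C Complex.I * q.map Complex.ofRealHom, fun x hx => ?_⟩
    have h1 : ∀ r : ℝ[X], (r.map Complex.ofRealHom).eval (x : ℂ) = ((r.eval x : ℝ) : ℂ) := fun r => by
      have := eval_map_apply (f := Complex.ofRealHom) (p := r) x
      simpa using this
    have h2 : (p.map Complex.ofRealHom + C Complex.I * q.map Complex.ofRealHom).eval (x : ℂ) - f x =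
        ((p.eval x - (f x).re : ℝ) : ℂ) + Complex.I * ((q.eval x - (f x).im : ℝ) : ℂ) := by
      conv_lhs => rw [← Complex.re_add_im (f x)]
      rw [eval_add, eval_mul, eval_C, h1, h1]
      push_cast
      ring
    rw [h2]
    refine (norm_add_le _ _).trans ?_
    rw [norm_mul, Complex.norm_I, one_mul, Complex.norm_real, Complex.norm_real, Real.norm_eq_abs,
      Real.norm_eq_abs]
    linarith [hp x hx, hq x hx]
  choose P hP using key
  exact ⟨P, hP⟩

theorem norm_aeval_sub_fc_le (ha : IsSelfAdjoint a) {m M ε : ℝ} (hs : spectrum ℝ a ⊆ Set.Icc m M)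
    (hf : Continuous f) {P : ℂ[X]} (hε : 0 ≤ ε)
    (hP : ∀ x ∈ Set.Icc m M, ‖P.eval (x : ℂ) - f x‖ ≤ ε) : ‖aeval a P - fc f a‖ ≤ ε := by
  rw [← fc_polynomial ha, ← fc_sub (by fun_prop) hf]
  exact norm_fc_le ha hε fun x hx => hP x (hs hx)

theorem continuous_fc_comp {X : Type*} [TopologicalSpace X] (hf : Continuous f) {A : X → H →L[ℂ] H}
    (hA : ∀ x, IsSelfAdjoint (A x)) {m M : ℝ} (hs : ∀ x, spectrum ℝ (A x) ⊆ Set.Icc m M)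
    (hc : Continuous A) : Continuous fun x => fc f (A x) := by
  refine Continuous.cfc' (s := Complex.ofReal '' Set.Icc m M)
    (isCompact_Icc.image Complex.continuous_ofReal) (fun z : ℂ => f z.re) hc (fun x z hz => ?_)
    (hf.comp Complex.continuous_re).continuousOn fun x => (hA x).isStarNormal
  have := mem_spectrum_re (hA x) hz
  exact ⟨z.re, hs x this.1, this.2⟩

/-- Bounds for the quadratic form of a self-adjoint operator are bounds for its spectrum. -/
theorem spectrum_subset_Icc_of_inner (ha : IsSelfAdjoint a) {m M : ℝ} (hM : ‖a‖ ≤ M)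
    (hm : ∀ w, m * ‖w‖ ^ 2 ≤ (inner ℂ (a w) w).re) : spectrum ℝ a ⊆ Set.Icc m M := by
  intro x hx
  constructor
  · have h1 : algebraMap ℝ (H →L[ℂ] H) m ≤ a := by
      rw [ContinuousLinearMap.le_def, ContinuousLinearMap.isPositive_def']
      refine ⟨ha.sub (IsSelfAdjoint.algebraMap _ (IsSelfAdjoint.all m)), fun w => ?_⟩
      have h2 : (algebraMap ℝ (H →L[ℂ] H) m) w = (m : ℂ) • w := by
        rw [Algebra.algebraMap_eq_smul_one]
        simp
      rw [ContinuousLinearMap.reApplyInnerSelf_apply, sub_apply, inner_sub_left, h2,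
        inner_smul_left, inner_self_eq_ofReal]
      have := hm w
      simp only [Complex.conj_ofReal, map_sub]
      have h3 : RCLike.re ((m : ℂ) * ((‖w‖ ^ 2 : ℝ) : ℂ)) = m * ‖w‖ ^ 2 := by
        rw [← Complex.ofReal_mul]
        exact Complex.ofReal_re _
      exact sub_nonneg.2 (h3.le.trans this)
    exact (algebraMap_le_iff_le_spectrum (r := m) (a := a) ha).1 h1 x hx
  · by_cases hH : Nontrivial H
    · exact (le_abs_self x).trans ((spectrum.norm_le_norm_of_mem hx).trans hM)
    · have := not_nontrivial_iff_subsingleton.1 hH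
      have : Subsingleton (H →L[ℂ] H) := inferInstance
      exact absurd hx (by rw [spectrum.of_subsingleton]; exact id)

end FunctionalCalculus

end HarmonicCrystal

namespace HarmonicCrystal

open Filter Topology MeasureTheory Polynomial

/-! ### The Fourier transform of absolutely summable lattice functions -/

/-- The complex values of the components of a complexified field. -/
abbrev CVec (n : ℕ) : Type := EuclideanSpace ℂ (Fin n)

/-- Square summable complex lattice functions. -/
abbrev CSeq (d n : ℕ) : Type := lp (fun _ : Lattice d => CVec n) 2

variable {d n : ℕ}

/-- The box `[-π, π]^d`, which represents the torus. -/
abbrev torusBox (d : ℕ) : Set (Fin d → ℝ) :=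
  Set.Icc (fun _ => -Real.pi) (fun _ => Real.pi)

theorem integral_exp_I_mul_int (k : ℤ) :
    ∫ x in Set.Icc (-Real.pi) Real.pi, Complex.exp (Complex.I * ((k : ℝ) * x : ℝ)) =
      if k = 0 then 2 * Real.pi else 0 := by
  rw [integral_Icc_eq_integral_Ioc, ← intervalIntegral.integral_of_le (by linarith [Real.pi_pos])]
  split_ifs with hk
  · simp [hk]
    ring
  · have hc : Complex.I * (k : ℂ) ≠ 0 := mul_ne_zero Complex.I_ne_zero (by exact_mod_cast hk)
    have h := integral_exp_mul_complex (a := -Real.pi) (b := Real.pi) hc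
    have h1 : ∀ x : ℝ, Complex.exp (Complex.I * ((k : ℝ) * x : ℝ)) =
        Complex.exp (Complex.I * (k : ℂ) * x) := fun x => by
      push_cast
      ring_nf
    simp only [h1, h]
    have h2 : Complex.exp (Complex.I * (k : ℂ) * (Real.pi : ℝ)) =
        Complex.exp (Complex.I * (k : ℂ) * ((-Real.pi : ℝ) : ℂ)) := by
      rw [Complex.exp_eq_exp_iff_exists_int]
      exact ⟨k, by push_cast; ring⟩
    rw [h2, sub_self, zero_div, Complex.ofReal_zero]

theorem integral_exp_I_mul_phase (z : Lattice d) :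
    ∫ θ in torusBox d, Complex.exp (Complex.I * (phase z θ : ℂ)) =
      if z = 0 then (((2 * Real.pi) ^ d : ℝ) : ℂ) else 0 := by
  have h1 : ∀ θ : Fin d → ℝ, Complex.exp (Complex.I * (phase z θ : ℂ)) =
      ∏ i, Complex.exp (Complex.I * ((z i : ℝ) * θ i : ℝ)) := fun θ => by
    rw [← Complex.exp_sum, ← Finset.mul_sum, phase]
    push_cast
    rfl
  have h2 : (volume : Measure (Fin d → ℝ)).restrict (torusBox d) =
      Measure.pi fun _ => volume.restrict (Set.Icc (-Real.pi) Real.pi) := by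
    rw [torusBox, ← Set.pi_univ_Icc, volume_pi, Measure.restrict_pi_pi]
  simp only [h1]
  rw [h2, integral_fintype_prod_eq_prod (𝕜 := ℂ)
    (f := fun i (x : ℝ) => Complex.exp (Complex.I * ((z i : ℝ) * x : ℝ)))]
  simp only [integral_exp_I_mul_int]
  split_ifs with hz
  · simp [hz]
  · obtain ⟨i, hi⟩ : ∃ i, z i ≠ 0 := by
      by_contra! h
      exact hz (funext h)
    exact Finset.prod_eq_zero (Finset.mem_univ i) (by rw [if_neg hi, Complex.ofReal_zero])

/-- `h` is the Fourier transform of the absolutely summable `w`. -/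
def IsFourier (w : CSeq d n) (h : (Fin d → ℝ) → CVec n) : Prop :=
  (Summable fun x => ‖w x‖) ∧
    ∀ θ, HasSum (fun x => Complex.exp (Complex.I * (phase x θ : ℂ)) • w x) (h θ)

theorem norm_exp_phase_smul (x : Lattice d) (θ : Fin d → ℝ) (v : CVec n) :
    ‖Complex.exp (Complex.I * (phase x θ : ℂ)) • v‖ = ‖v‖ := by
  rw [norm_smul, norm_exp_I_mul_phase, one_mul]

theorem exists_isFourier {w : CSeq d n} (hw : Summable fun x => ‖w x‖) :
    ∃ h, IsFourier w h :=
  ⟨fun θ => ∑' x, Complex.exp (Complex.I * (phase x θ : ℂ)) • w x, hw, fun θ =>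
    (Summable.of_norm (by simpa only [norm_exp_phase_smul] using hw)).hasSum⟩

namespace IsFourier

variable {w w' : CSeq d n} {h h' : (Fin d → ℝ) → CVec n}

theorem continuous (H : IsFourier w h) : Continuous h := by
  have h1 : h = fun θ => ∑' x, Complex.exp (Complex.I * (phase x θ : ℂ)) • w x :=
    funext fun θ => ((H.2 θ).tsum_eq).symm
  rw [h1]
  refine continuous_tsum (fun x => by fun_prop) H.1 fun x θ => ?_
  rw [norm_exp_phase_smul]

theorem norm_le (H : IsFourier w h) (θ : Fin d → ℝ) : ‖h θ‖ ≤ ∑' x, ‖w x‖ := by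
  rw [← (H.2 θ).tsum_eq]
  exact tsum_of_norm_bounded H.1.hasSum fun x => (norm_exp_phase_smul x θ _).le

theorem add (H : IsFourier w h) (H' : IsFourier w' h') : IsFourier (w + w') fun θ => h θ + h' θ := by
  refine ⟨Summable.of_nonneg_of_le (fun _ => norm_nonneg _) (fun x => norm_add_le _ _)
    (H.1.add H'.1), fun θ => ?_⟩
  refine ((H.2 θ).add (H'.2 θ)).congr_fun fun x => ?_
  rw [← smul_add]
  rfl

theorem smul (H : IsFourier w h) (c : ℂ) : IsFourier (c • w) fun θ => c • h θ := by
  refine ⟨?_, fun θ => ?_⟩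
  · refine (H.1.mul_left ‖c‖).congr fun x => ?_
    rw [← norm_smul]
    rfl
  · refine ((H.2 θ).const_smul c).congr_fun fun x => ?_
    rw [smul_comm]
    rfl

/-- Parseval's identity. -/
theorem inner_eq (H : IsFourier w h) (H' : IsFourier w' h') :
    ∫ θ in torusBox d, inner ℂ (h θ) (h' θ) = (((2 * Real.pi) ^ d : ℝ) : ℂ) * inner ℂ w w' := by
  have hconst : ∀ c : ℝ, IntegrableOn (fun _ => c) (torusBox d) := fun c =>
    continuousOn_const.integrableOn_compact isCompact_Icc
  -- the Fourier coefficients of `h`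
  have h1 : ∀ y (v : CVec n), ∫ θ in torusBox d,
      Complex.exp (Complex.I * (phase y θ : ℂ)) * inner ℂ (h θ) v =
        (((2 * Real.pi) ^ d : ℝ) : ℂ) * inner ℂ (w y) v := fun y v => by
    have hs : ∀ θ, HasSum (fun x => Complex.exp (Complex.I * (phase (y - x) θ : ℂ)) *
        inner ℂ (w x) v) (Complex.exp (Complex.I * (phase y θ : ℂ)) * inner ℂ (h θ) v) := fun θ => by
      have h2 : HasSum (fun x => inner ℂ (Complex.exp (Complex.I * (phase x θ : ℂ)) • w x) v)
          (inner ℂ (h θ) v) := by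
        have := ((innerSL ℂ v).hasSum (H.2 θ)).star
        simpa [Function.comp_def, innerSL_apply_apply, inner_smul_left, mul_comm] using this
      refine (h2.mul_left _).congr_fun fun x => ?_
      rw [inner_smul_left, ← mul_assoc, ← Complex.exp_conj, ← Complex.exp_add]
      congr 2
      have : phase (y - x) θ = phase y θ - phase x θ := by
        simp [phase, sub_mul, Finset.sum_sub_distrib]
      rw [this]
      simp
      ring
    have hb : ∀ x θ, ‖Complex.exp (Complex.I * (phase (y - x) θ : ℂ)) * inner ℂ (w x) v‖ ≤
        ‖w x‖ * ‖v‖ := fun x θ => by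
      rw [norm_mul, norm_exp_I_mul_phase, one_mul]
      exact norm_inner_le_norm _ _
    have h3 := hasSum_integral_of_dominated_convergence (μ := volume.restrict (torusBox d))
      (fun x _ => ‖w x‖ * ‖v‖)
      (fun x => (Continuous.aestronglyMeasurable (by fun_prop)))
      (fun x => Eventually.of_forall (hb x))
      (Eventually.of_forall fun _ => H.1.mul_right _)
      (hconst _) (Eventually.of_forall hs)
    rw [← h3.tsum_eq, tsum_eq_single y]
    · rw [integral_mul_const, integral_exp_I_mul_phase, sub_self, if_pos rfl]
    · intro x hx
      rw [integral_mul_const, integral_exp_I_mul_phase, if_neg (sub_ne_zero.2 hx.symm), zero_mul]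
  have hs' : ∀ θ, HasSum (fun y => Complex.exp (Complex.I * (phase y θ : ℂ)) *
      inner ℂ (h θ) (w' y)) (inner ℂ (h θ) (h' θ)) := fun θ => by
    refine ((innerSL ℂ (h θ)).hasSum (H'.2 θ)).congr_fun fun y => ?_
    simp
  have hc := H.continuous
  have hb' : ∀ y θ, ‖Complex.exp (Complex.I * (phase y θ : ℂ)) * inner ℂ (h θ) (w' y)‖ ≤
      (∑' x, ‖w x‖) * ‖w' y‖ := fun y θ => by
    rw [norm_mul, norm_exp_I_mul_phase, one_mul]
    exact (norm_inner_le_norm _ _).trans (by gcongr; exact H.norm_le θ)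
  have h4 := hasSum_integral_of_dominated_convergence (μ := volume.restrict (torusBox d))
      (fun y _ => (∑' x, ‖w x‖) * ‖w' y‖)
      (fun y => (Continuous.aestronglyMeasurable (by fun_prop)))
      (fun y => Eventually.of_forall (hb' y))
      (Eventually.of_forall fun _ => H'.1.mul_left _)
      (hconst _) (Eventually.of_forall hs')
  simp only [h1] at h4
  have h5 := (lp.hasSum_inner w w').mul_left ((((2 * Real.pi) ^ d : ℝ) : ℂ))
  exact h4.unique h5

end IsFourier

/-- Absolutely summable functions are dense among the square summable ones. -/
theorem dense_summable_norm : Dense {w : CSeq d n | Summable fun x => ‖w x‖} := by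
  classical
  intro w
  refine mem_closure_of_tendsto (lp.hasSum_single (by norm_num) w) (Eventually.of_forall fun s => ?_)
  refine summable_of_ne_finset_zero (s := s) fun x hx => ?_
  rw [norm_eq_zero, lp.coeFn_sum, Finset.sum_apply]
  refine Finset.sum_eq_zero fun y hy => ?_
  rw [lp.single_apply]
  exact dif_neg fun hxy => hx (by rw [hxy]; exact hy)

end HarmonicCrystal

namespace HarmonicCrystal

open Filter Topology MeasureTheory Polynomial

/-! ### The interaction operator and its symbol -/

variable {d n : ℕ}

/-- A real matrix as an operator on complex vectors. -/
noncomputable def cmat (M : Matrix (Fin n) (Fin n) ℝ) : CVec n →L[ℂ] CVec n :=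
  Matrix.toEuclideanCLM (𝕜 := ℂ) (M.map Complex.ofReal)

/-- The symbol as an operator. -/
noncomputable def symbolOp (V : Lattice d → Matrix (Fin n) (Fin n) ℝ) (θ : Fin d → ℝ) :
    CVec n →L[ℂ] CVec n :=
  Matrix.toEuclideanCLM (𝕜 := ℂ) (symbol V θ)

theorem norm_one_le_one (x : Lattice d) : ‖(fun _ : Lattice d => (1 : ℂ)) x‖ ≤ 1 := norm_one.le

/-- The operator `(𝒱 w)(x) = ∑_y V(x - y) w(y)` on complex `ℓ²`. -/
noncomputable def interactionOp (V : Lattice d → Matrix (Fin n) (Fin n) ℝ) :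
    CSeq d n →L[ℂ] CSeq d n :=
  ∑' z, wshift (fun _ => (1 : ℂ)) 1 norm_one_le_one z (cmat (V z))

variable {V : Lattice d → Matrix (Fin n) (Fin n) ℝ}

theorem norm_cmat_le (M : Matrix (Fin n) (Fin n) ℝ) : ‖cmat M‖ ≤ ∑ k, ∑ l, |M k l| := by
  refine ContinuousLinearMap.opNorm_le_bound _
    (Finset.sum_nonneg fun _ _ => Finset.sum_nonneg fun _ _ => abs_nonneg _) fun u => ?_
  refine (norm_toEuclideanLin_le (M.map Complex.ofReal) u).trans (le_of_eq ?_)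
  simp

theorem ExpDecay.summable_norm_cmat (hV : ExpDecay V) : Summable fun z => ‖cmat (V z)‖ :=
  Summable.of_nonneg_of_le (fun _ => norm_nonneg _) (fun z => norm_cmat_le (V z))
    (summable_sum fun k _ => summable_sum fun l _ => hV.summable_abs k l)

theorem ExpDecay.summable_interactionOp (hV : ExpDecay V) :
    Summable fun z => wshift (fun _ => (1 : ℂ)) 1 norm_one_le_one z (cmat (V z)) :=
  Summable.of_norm_bounded hV.summable_norm_cmat fun _ =>
    (norm_wshift_le _ _ _ _ _).trans (one_mul _).le

theorem ExpDecay.hasSum_interactionOp (hV : ExpDecay V) (w : CSeq d n) (x : Lattice d) :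
    HasSum (fun z => cmat (V z) (w (x - z))) (interactionOp V w x) := by
  refine (tsum_apply_apply hV.summable_interactionOp w x).congr_fun fun z => ?_
  rw [wshift_apply, one_smul]

theorem ExpDecay.hasSum_symbolOp (hV : ExpDecay V) (θ : Fin d → ℝ) :
    HasSum (fun z => Complex.exp (Complex.I * (phase z θ : ℂ)) • cmat (V z)) (symbolOp V θ) := by
  have h1 : HasSum (fun z => Complex.exp (Complex.I * (phase z θ : ℂ)) • (V z).map Complex.ofReal)
      (symbol V θ) := by
    refine Pi.hasSum.2 fun k => Pi.hasSum.2 fun l => ?_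
    have hs : Summable fun z => (V z k l : ℂ) * Complex.exp (Complex.I * (phase z θ : ℂ)) := by
      refine Summable.of_norm_bounded (hV.summable_abs k l) fun z => ?_
      rw [norm_mul, norm_exp_I_mul_phase, mul_one, Complex.norm_real, Real.norm_eq_abs]
    refine hs.hasSum.congr_fun fun z => ?_
    simp [mul_comm]
  let L : Matrix (Fin n) (Fin n) ℂ →ₗ[ℂ] (CVec n →L[ℂ] CVec n) :=
    (Matrix.toEuclideanCLM (n := Fin n) (𝕜 := ℂ)).toAlgEquiv.toLinearMap
  have h2 := h1.map L L.continuous_of_finiteDimensional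
  refine h2.congr_fun fun z => ?_
  rw [Function.comp_apply, map_smul]
  rfl

theorem ExpDecay.continuous_symbolOp (hV : ExpDecay V) : Continuous (symbolOp V) := by
  let L : Matrix (Fin n) (Fin n) ℂ →ₗ[ℂ] (CVec n →L[ℂ] CVec n) :=
    (Matrix.toEuclideanCLM (n := Fin n) (𝕜 := ℂ)).toAlgEquiv.toLinearMap
  exact L.continuous_of_finiteDimensional.comp hV.continuous_symbol

theorem isSelfAdjoint_symbolOp (hnonneg : NonnegDefinite V) (θ : Fin d → ℝ) :
    IsSelfAdjoint (symbolOp V θ) := by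
  have h : IsSelfAdjoint (symbol V θ) := (hnonneg θ).1
  exact h.map (Matrix.toEuclideanCLM (n := Fin n) (𝕜 := ℂ))

theorem spectrum_symbolOp (θ : Fin d → ℝ) : spectrum ℝ (symbolOp V θ) = spectrum ℝ (symbol V θ) :=
  AlgEquiv.spectrum_eq ((Matrix.toEuclideanCLM (n := Fin n) (𝕜 := ℂ)).toAlgEquiv.restrictScalars ℝ)
    (symbol V θ)

/-- Multiplication of a lattice function by a bounded function. -/
noncomputable def mulOp (c : Lattice d → ℂ) (B : ℝ) (hB : ∀ x, ‖c x‖ ≤ B) :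
    CSeq d n →L[ℂ] CSeq d n :=
  wshift c B hB 0 (ContinuousLinearMap.id ℂ _)

@[simp]
theorem mulOp_apply (c : Lattice d → ℂ) (B : ℝ) (hB : ∀ x, ‖c x‖ ≤ B) (w : CSeq d n)
    (x : Lattice d) : mulOp c B hB w x = c x • w x := by
  rw [mulOp, wshift_apply, sub_zero, ContinuousLinearMap.id_apply]

section LastCoordinate

variable [NeZero d]

theorem norm_modulation_le (a : ℝ) (x : Lattice d) :
    ‖Complex.exp (Complex.I * (a * (lastCoord x : ℝ) : ℝ))‖ ≤ 1 :=
  (norm_exp_I_mul_ofReal _).le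

/-- Multiplication by `e^{i a x_d}`. In Fourier space it is the translation by `a` in the last
direction. -/
noncomputable def modulation (a : ℝ) : CSeq d n →L[ℂ] CSeq d n :=
  mulOp (fun x => Complex.exp (Complex.I * (a * (lastCoord x : ℝ) : ℝ))) 1 (norm_modulation_le a)

theorem phase_smul_lastVec (a : ℝ) (x : Lattice d) : phase x (a • lastVec d) = a * lastCoord x := by
  simp only [phase, lastVec, Pi.smul_apply, Pi.single_apply, smul_eq_mul, lastCoord]
  rw [Finset.sum_eq_single (lastIdx d)]
  · simp [lastIdx, mul_comm]
  · intro i _ hi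
    simp [hi]
  · simp

end LastCoordinate

namespace IsFourier

variable {w : CSeq d n} {h : (Fin d → ℝ) → CVec n}

theorem modulation [NeZero d] (H : IsFourier w h) (a : ℝ) :
    IsFourier (modulation a w) fun θ => h (θ + a • lastVec d) := by
  refine ⟨?_, fun θ => ?_⟩
  · refine H.1.congr fun x => ?_
    rw [HarmonicCrystal.modulation, mulOp_apply, norm_smul, norm_exp_I_mul_ofReal, one_mul]
  · refine (H.2 _).congr_fun fun x => ?_
    rw [HarmonicCrystal.modulation, mulOp_apply, smul_smul, ← Complex.exp_add, phase_add,
      phase_smul_lastVec]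
    congr 2
    push_cast
    ring

/-- The interaction operator is the multiplication by the symbol in Fourier space. -/
theorem interactionOp (hV : ExpDecay V) (H : IsFourier w h) :
    IsFourier (interactionOp V w) fun θ => symbolOp V θ (h θ) := by
  -- the double family indexed by `(z, x)` that is summed in two orders
  have hs : Summable fun p : Lattice d × Lattice d => ‖cmat (V p.1)‖ * ‖w p.2‖ :=
    hV.summable_norm_cmat.mul_of_nonneg H.1 (fun _ => norm_nonneg _) fun _ => norm_nonneg _
  let e : Lattice d × Lattice d ≃ Lattice d × Lattice d :=
    { toFun := fun p => (p.2, p.1 - p.2)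
      invFun := fun q => (q.1 + q.2, q.1)
      left_inv := fun p => by simp
      right_inv := fun q => by simp }
  have hs' : Summable fun p : Lattice d × Lattice d => ‖cmat (V p.2)‖ * ‖w (p.1 - p.2)‖ :=
    (e.summable_iff (f := fun p : Lattice d × Lattice d => ‖cmat (V p.1)‖ * ‖w p.2‖)).2 hs
  refine ⟨?_, fun θ => ?_⟩
  · refine Summable.of_nonneg_of_le (fun _ => norm_nonneg _) (fun x => ?_) hs'.prod
    rw [← (hV.hasSum_interactionOp w x).tsum_eq]
    exact tsum_of_norm_bounded (hs'.prod_factor x).hasSum fun z =>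
      ContinuousLinearMap.le_opNorm _ _
  · set G : Lattice d × Lattice d → CVec n := fun q =>
      Complex.exp (Complex.I * (phase (q.1 + q.2) θ : ℂ)) • cmat (V q.1) (w q.2)
    have hG : Summable G := by
      refine Summable.of_norm_bounded hs fun q => ?_
      rw [norm_exp_phase_smul]
      exact ContinuousLinearMap.le_opNorm _ _
    have h1 : HasSum (fun z => (Complex.exp (Complex.I * (phase z θ : ℂ)) • cmat (V z)) (h θ))
        (∑' q, G q) := by
      refine hG.hasSum.prod_fiberwise fun z => ?_
      refine ((Complex.exp (Complex.I * (phase z θ : ℂ)) • cmat (V z)).hasSum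
        (H.2 θ)).congr_fun fun y => ?_
      have : phase (z + y) θ = phase z θ + phase y θ := by
        simp [phase, add_mul, Finset.sum_add_distrib]
      simp only [G, this]
      rw [map_smul, smul_apply, smul_smul, ← Complex.exp_add]
      congr 2
      push_cast
      ring
    have h2 : HasSum (fun x => Complex.exp (Complex.I * (phase x θ : ℂ)) •
        HarmonicCrystal.interactionOp V w x) (∑' q, G q) := by
      refine (e.hasSum_iff.2 hG.hasSum).prod_fiberwise fun x => ?_
      refine ((hV.hasSum_interactionOp w x).const_smul _).congr_fun fun z => ?_
      simp [G, e]
    have h3 := (ContinuousLinearMap.apply ℂ (CVec n) (h θ)).hasSum (hV.hasSum_symbolOp θ)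
    have h4 : symbolOp V θ (h θ) = ∑' q, G q := h3.unique h1
    change HasSum _ (symbolOp V θ (h θ))
    rw [h4]
    exact h2

theorem aeval (hV : ExpDecay V) (H : IsFourier w h) (P : ℂ[X]) :
    IsFourier (aeval (HarmonicCrystal.interactionOp V) P w)
      fun θ => aeval (symbolOp V θ) P (h θ) := by
  induction P using Polynomial.induction_on' with
  | add p q hp hq => simpa using hp.add hq
  | monomial k c =>
    have h1 : ∀ k, IsFourier ((HarmonicCrystal.interactionOp V ^ k) w)
        fun θ => (symbolOp V θ ^ k) (h θ) := fun k => by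
      induction k with
      | zero => simpa using H
      | succ k ih =>
        simp only [pow_succ']
        exact ih.interactionOp hV
    have h2 : ∀ (k : ℕ) (H : Type) [NormedAddCommGroup H] [InnerProductSpace ℂ H]
        (T : H →L[ℂ] H) (v : H), Polynomial.aeval T (monomial k c) v = c • (T ^ k) v := by
      intro k H _ _ T v
      rw [aeval_monomial, Algebra.algebraMap_eq_smul_one, smul_mul_assoc, one_mul]
      rfl
    simp only [h2]
    exact (h1 k).smul c

end IsFourier

/-! ### Spectral bounds -/

theorem ExpDecay.exists_norm_symbolOp_le (hV : ExpDecay V) : ∃ M, ∀ θ, ‖symbolOp V θ‖ ≤ M := by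
  refine ⟨∑' z, ‖cmat (V z)‖, fun θ => ?_⟩
  rw [← (hV.hasSum_symbolOp θ).tsum_eq]
  refine tsum_of_norm_bounded hV.summable_norm_cmat.hasSum fun z => ?_
  rw [norm_smul, norm_exp_I_mul_phase, one_mul]

theorem symbol_periodic (V : Lattice d → Matrix (Fin n) (Fin n) ℝ) (θ : Fin d → ℝ)
    (k : Fin d → ℤ) : symbol V (fun i => θ i + k i * (2 * Real.pi)) = symbol V θ := by
  ext i j
  simp only [symbol, Matrix.of_apply]
  refine tsum_congr fun z => ?_
  congr 1
  rw [Complex.exp_eq_exp_iff_exists_int]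
  refine ⟨∑ i, z i * k i, ?_⟩
  simp only [phase]
  push_cast
  rw [Finset.mul_sum, Finset.mul_sum, Finset.sum_mul, ← Finset.sum_add_distrib]
  exact Finset.sum_congr rfl fun i _ => by ring

theorem exists_mem_torusBox (θ : Fin d → ℝ) :
    ∃ k : Fin d → ℤ, (fun i => θ i + k i * (2 * Real.pi)) ∈ torusBox d := by
  have h2 : (0 : ℝ) < 2 * Real.pi := by positivity
  refine ⟨fun i => -toIcoDiv h2 (-Real.pi) (θ i), ?_⟩
  have h : ∀ i, θ i + ((-toIcoDiv h2 (-Real.pi) (θ i) : ℤ) : ℝ) * (2 * Real.pi) ∈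
      Set.Ico (-Real.pi) (-Real.pi + 2 * Real.pi) := fun i => by
    have := sub_toIcoDiv_zsmul_mem_Ico h2 (-Real.pi) (θ i)
    rw [zsmul_eq_mul] at this
    push_cast
    rwa [neg_mul, ← sub_eq_add_neg]
  exact ⟨fun i => (h i).1, fun i => by linarith [(h i).2]⟩

/-- The symbol is bounded below by a positive constant, as it is periodic, continuous and positive
definite at each point. -/
theorem exists_symbolOp_ge [NeZero n] (hV : ExpDecay V) (hnonneg : NonnegDefinite V)
    (hdet : ∀ θ, (symbol V θ).det ≠ 0) :
    ∃ m, 0 < m ∧ ∀ θ (v : CVec n), m * ‖v‖ ^ 2 ≤ (inner ℂ (symbolOp V θ v) v).re := by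
  have hpos : ∀ θ (v : CVec n), v ≠ 0 → 0 < (inner ℂ (symbolOp V θ v) v).re := fun θ v hv => by
    have h1 : (symbol V θ).PosDef := (hnonneg θ).posDef_iff_det_ne_zero.2 (hdet θ)
    have hv' : v.ofLp ≠ 0 := fun h => hv (by ext i; exact congrFun h i)
    have h2 := h1.dotProduct_mulVec_pos hv'
    have h3 : inner ℂ (symbolOp V θ v) v = 
        star (dotProduct (star v.ofLp) ((symbol V θ).mulVec v.ofLp)) := by
      rw [← inner_conj_symm]
      rw [EuclideanSpace.inner_eq_star_dotProduct, dotProduct_comm]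
      rfl
    rw [h3]
    exact (Complex.pos_iff.1 h2).1
  have hK : IsCompact (torusBox d ×ˢ Metric.sphere (0 : CVec n) 1) :=
    isCompact_Icc.prod (isCompact_sphere _ _)
  have hne : (torusBox d ×ˢ Metric.sphere (0 : CVec n) 1).Nonempty := by
    refine Set.Nonempty.prod ⟨0, ?_⟩ (NormedSpace.sphere_nonempty.2 zero_le_one)
    exact ⟨fun i => by simp [Real.pi_pos.le], fun i => by simp [Real.pi_pos.le]⟩
  have hcont : Continuous fun p : (Fin d → ℝ) × CVec n =>
      (inner ℂ (symbolOp V p.1 p.2) p.2).re := by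
    have := hV.continuous_symbolOp
    exact Complex.continuous_re.comp
      (((this.comp continuous_fst).clm_apply continuous_snd).inner continuous_snd)
  obtain ⟨p, hp, hmin⟩ := hK.exists_isMinOn hne hcont.continuousOn
  have hp2 : p.2 ≠ 0 := by
    intro h
    have := hp.2
    simp [h] at this
  refine ⟨_, hpos p.1 p.2 hp2, fun θ v => ?_⟩
  by_cases hv : v = 0
  · simp [hv]
  obtain ⟨k, hk⟩ := exists_mem_torusBox θ
  set v' : CVec n := ((‖v‖ : ℂ))⁻¹ • v
  have hvn : ‖v‖ ≠ 0 := norm_ne_zero_iff.2 hv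
  have hv' : ‖v'‖ = 1 := by
    rw [norm_smul, norm_inv, Complex.norm_real, norm_norm, inv_mul_cancel₀ hvn]
  have h1 := hmin (a := (_, v')) ⟨hk, by simp [hv']⟩
  have h2 : symbolOp V (fun i => θ i + k i * (2 * Real.pi)) = symbolOp V θ := by
    rw [symbolOp, symbol_periodic, symbolOp]
  have h3 : inner ℂ (symbolOp V θ v') v' = ((‖v‖ ^ 2 : ℝ) : ℂ)⁻¹ * inner ℂ (symbolOp V θ v) v := by
    simp only [v', map_smul, inner_smul_left, inner_smul_right, map_inv₀, Complex.conj_ofReal]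
    push_cast
    field_simp
  simp only [Set.mem_ofPred_eq, h2, h3] at h1
  rw [← Complex.ofReal_inv, Complex.re_ofReal_mul] at h1
  have h4 : 0 < ‖v‖ ^ 2 := by positivity
  rwa [inv_mul_eq_div, le_div_iff₀ h4] at h1

theorem isSelfAdjoint_interactionOp (hV : ExpDecay V) (hnonneg : NonnegDefinite V) :
    IsSelfAdjoint (interactionOp V) := by
  rw [ContinuousLinearMap.isSelfAdjoint_iff_isSymmetric]
  have h1 : ∀ w ∈ {w : CSeq d n | Summable fun x => ‖w x‖},
      ∀ w' ∈ {w : CSeq d n | Summable fun x => ‖w x‖},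
      inner ℂ (interactionOp V w) w' = inner ℂ w (interactionOp V w') := fun w hw w' hw' => by
    obtain ⟨h, H⟩ := exists_isFourier hw
    obtain ⟨h', H'⟩ := exists_isFourier hw'
    have h2 := (H.interactionOp hV).inner_eq H'
    have h3 := H.inner_eq (H'.interactionOp hV)
    have h4 : ∀ θ, inner ℂ (symbolOp V θ (h θ)) (h' θ) = inner ℂ (h θ) (symbolOp V θ (h' θ)) :=
      fun θ => (isSelfAdjoint_symbolOp hnonneg θ).isSymmetric _ _
    simp only [h4] at h2
    rw [h2] at h3
    exact mul_left_cancel₀ (by norm_cast; positivity) h3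
  intro w w'
  refine dense_summable_norm.induction (P := fun w => inner ℂ (interactionOp V w) w' =
    inner ℂ w (interactionOp V w')) (fun w hw => ?_) (isClosed_eq (by fun_prop) (by fun_prop)) w
  exact dense_summable_norm.induction (P := fun w' => inner ℂ (interactionOp V w) w' =
    inner ℂ w (interactionOp V w')) (fun w' hw' => h1 w hw w' hw')
    (isClosed_eq (by fun_prop) (by fun_prop)) w'

/-- The interaction operator and all values of the symbol have their spectra in a common compact
interval of positive numbers. -/
theorem exists_spectral_bounds [NeZero n] (hV : ExpDecay V) (hnonneg : NonnegDefinite V)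
    (hdet : ∀ θ, (symbol V θ).det ≠ 0) :
    ∃ m M : ℝ, 0 < m ∧ spectrum ℝ (interactionOp V) ⊆ Set.Icc m M ∧
      ∀ θ, spectrum ℝ (symbolOp V θ) ⊆ Set.Icc m M := by
  obtain ⟨m, hm, hle⟩ := exists_symbolOp_ge hV hnonneg hdet
  obtain ⟨M, hM⟩ := hV.exists_norm_symbolOp_le
  refine ⟨m, max M ‖interactionOp V‖, hm, ?_, fun θ => ?_⟩
  · refine spectrum_subset_Icc_of_inner (isSelfAdjoint_interactionOp hV hnonneg)
      (le_max_right _ _) fun w => ?_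
    refine dense_summable_norm.induction (P := fun w : CSeq d n => m * ‖w‖ ^ 2 ≤
      (inner ℂ (interactionOp V w) w).re) (fun w hw => ?_)
      (isClosed_le (by fun_prop) (Complex.continuous_re.comp (by fun_prop))) w
    obtain ⟨h, H⟩ := exists_isFourier hw
    have h2 := (H.interactionOp hV).inner_eq H
    have h3 := H.inner_eq H
    have hc := H.continuous
    have hcA := hV.continuous_symbolOp
    have hpi : 0 < (2 * Real.pi) ^ d := by positivity
    have hi : ∀ f : (Fin d → ℝ) → ℂ, Continuous f → IntegrableOn f (torusBox d) := fun f hf =>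
      hf.continuousOn.integrableOn_compact isCompact_Icc
    have hc1 : Continuous fun θ => inner ℂ (h θ) (h θ) := hc.inner hc
    have hc2 : Continuous fun θ => inner ℂ (symbolOp V θ (h θ)) (h θ) :=
      (hcA.clm_apply hc).inner hc
    have h5 : m * ∫ θ in torusBox d, (inner ℂ (h θ) (h θ)).re ≤
        ∫ θ in torusBox d, (inner ℂ (symbolOp V θ (h θ)) (h θ)).re := by
      rw [← integral_const_mul]
      refine integral_mono ((hi _ hc1).re.const_mul _) (hi _ hc2).re fun θ => ?_
      have h6 : (inner ℂ (h θ) (h θ)).re = ‖h θ‖ ^ 2 := by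
        rw [inner_self_eq_ofReal, Complex.ofReal_re]
      simp only [h6]
      exact hle θ (h θ)
    have e1 : ∫ θ in torusBox d, (inner ℂ (h θ) (h θ)).re = (2 * Real.pi) ^ d * ‖w‖ ^ 2 := by
      refine (integral_re (hi _ hc1)).trans ?_
      rw [h3, inner_self_eq_ofReal, ← Complex.ofReal_mul]
      exact Complex.ofReal_re _
    have e2 : ∫ θ in torusBox d, (inner ℂ (symbolOp V θ (h θ)) (h θ)).re =
        (2 * Real.pi) ^ d * (inner ℂ (interactionOp V w) w).re := by
      refine (integral_re (hi _ hc2)).trans ?_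
      rw [h2]
      exact Complex.re_ofReal_mul _ _
    rw [e1, e2] at h5
    refine le_of_mul_le_mul_left (le_trans (le_of_eq ?_) h5) hpi
    ring
  · exact spectrum_subset_Icc_of_inner (isSelfAdjoint_symbolOp hnonneg θ)
      ((hM θ).trans (le_max_left _ _)) (hle θ)

end HarmonicCrystal

namespace HarmonicCrystal

open Filter Topology MeasureTheory Polynomial

/-! ### Limits of the position correlations -/

variable {d n : ℕ} {V : Lattice d → Matrix (Fin n) (Fin n) ℝ}

/-- The function `x ↦ e^{iτ√x}`, which takes `V̂` to the propagator `e^{iτ V̂^{1/2}}`. -/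
noncomputable def propFn (τ x : ℝ) : ℂ := Complex.exp (Complex.I * (τ * √x : ℝ))

@[fun_prop]
theorem continuous_propFn (τ : ℝ) : Continuous (propFn τ) := by
  unfold propFn
  fun_prop

theorem norm_propFn (τ x : ℝ) : ‖propFn τ x‖ = 1 := norm_exp_I_mul_ofReal _

/-- Position correlations of `f(𝒱) w` as integrals over the torus. -/
theorem inner_fc_modulation [NeZero d] (hV : ExpDecay V) (hnonneg : NonnegDefinite V)
    {m M : ℝ} (hs : spectrum ℝ (interactionOp V) ⊆ Set.Icc m M)
    (hsA : ∀ θ, spectrum ℝ (symbolOp V θ) ⊆ Set.Icc m M)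
    {w : CSeq d n} {h : (Fin d → ℝ) → CVec n} (H : IsFourier w h) {f : ℝ → ℂ} (hf : Continuous f)
    (hf1 : ∀ x, ‖f x‖ ≤ 1) (a : ℝ) :
    ∫ θ in torusBox d, inner ℂ (fc f (symbolOp V θ) (h θ))
        (fc f (symbolOp V (θ + a • lastVec d)) (h (θ + a • lastVec d))) =
      (((2 * Real.pi) ^ d : ℝ) : ℂ) * inner ℂ (fc f (interactionOp V) w)
        (modulation a (fc f (interactionOp V) w)) := by
  obtain ⟨P, hP⟩ := exists_polynomial_seq hf m M
  have hsaA := isSelfAdjoint_symbolOp hnonneg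
  have hsa := isSelfAdjoint_interactionOp hV hnonneg
  have hlim : Tendsto (fun j : ℕ => 1 / ((j : ℝ) + 1)) atTop (𝓝 0) :=
    tendsto_one_div_add_atTop_nhds_zero_nat
  have hj : ∀ j : ℕ, (0 : ℝ) ≤ 1 / ((j : ℝ) + 1) := fun j => by positivity
  have hop : Tendsto (fun j => Polynomial.aeval (interactionOp V) (P j)) atTop
      (𝓝 (fc f (interactionOp V))) := by
    rw [tendsto_iff_norm_sub_tendsto_zero]
    exact squeeze_zero (fun _ => norm_nonneg _)
      (fun j => norm_aeval_sub_fc_le hsa hs hf (hj j) (hP j)) hlim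
  have hopA : ∀ θ, Tendsto (fun j => Polynomial.aeval (symbolOp V θ) (P j)) atTop
      (𝓝 (fc f (symbolOp V θ))) := fun θ => by
    rw [tendsto_iff_norm_sub_tendsto_zero]
    exact squeeze_zero (fun _ => norm_nonneg _)
      (fun j => norm_aeval_sub_fc_le (hsaA θ) (hsA θ) hf (hj j) (hP j)) hlim
  have hbd : ∀ j θ, ‖Polynomial.aeval (symbolOp V θ) (P j)‖ ≤ 2 := fun j θ => by
    have h1 := norm_aeval_sub_fc_le (hsaA θ) (hsA θ) hf (hj j) (hP j)
    have h2 : ‖fc f (symbolOp V θ)‖ ≤ 1 := norm_fc_le (hsaA θ) zero_le_one fun x _ => hf1 x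
    have h3 : 1 / ((j : ℝ) + 1) ≤ 1 := by
      rw [div_le_one (by positivity)]
      linarith [(Nat.cast_nonneg j : (0 : ℝ) ≤ j)]
    have h4 := norm_le_norm_add_norm_sub' (Polynomial.aeval (symbolOp V θ) (P j))
      (fc f (symbolOp V θ))
    linarith
  set S := ∑' x, ‖w x‖
  have hbd' : ∀ j θ, ‖Polynomial.aeval (symbolOp V θ) (P j) (h θ)‖ ≤ 2 * S := fun j θ =>
    ContinuousLinearMap.le_of_opNorm_le_of_le _ (hbd j θ) (H.norm_le θ)
  have hFj := fun j => H.aeval hV (P j)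
  have hlhs : Tendsto (fun j => ∫ θ in torusBox d,
      inner ℂ (Polynomial.aeval (symbolOp V θ) (P j) (h θ))
        (Polynomial.aeval (symbolOp V (θ + a • lastVec d)) (P j) (h (θ + a • lastVec d)))) atTop
      (𝓝 (∫ θ in torusBox d, inner ℂ (fc f (symbolOp V θ) (h θ))
        (fc f (symbolOp V (θ + a • lastVec d)) (h (θ + a • lastVec d))))) := by
    refine tendsto_integral_of_dominated_convergence (fun _ => (2 * S) * (2 * S)) (fun j => ?_)
      (continuousOn_const.integrableOn_compact isCompact_Icc) (fun j => ?_) ?_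
    · have h1 := (hFj j).continuous
      have h2 := ((hFj j).modulation a).continuous
      exact (h1.inner h2).aestronglyMeasurable
    · refine Eventually.of_forall fun θ => (norm_inner_le_norm _ _).trans ?_
      exact mul_le_mul (hbd' j _) (hbd' j _) (norm_nonneg _) ((norm_nonneg _).trans (hbd' j θ))
    · refine Eventually.of_forall fun θ => ?_
      have happ : ∀ θ, Tendsto (fun j => Polynomial.aeval (symbolOp V θ) (P j) (h θ)) atTop
          (𝓝 (fc f (symbolOp V θ) (h θ))) := fun θ =>
        ((ContinuousLinearMap.apply ℂ (CVec n) (h θ)).continuous.tendsto _).comp (hopA θ)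
      exact (happ θ).inner (happ _)
  have hrhs : Tendsto (fun j => (((2 * Real.pi) ^ d : ℝ) : ℂ) *
      inner ℂ (Polynomial.aeval (interactionOp V) (P j) w)
        (modulation a (Polynomial.aeval (interactionOp V) (P j) w)))
      atTop (𝓝 ((((2 * Real.pi) ^ d : ℝ) : ℂ) * inner ℂ (fc f (interactionOp V) w)
        (modulation a (fc f (interactionOp V) w)))) := by
    have h1 : Tendsto (fun j => Polynomial.aeval (interactionOp V) (P j) w) atTop
        (𝓝 (fc f (interactionOp V) w)) :=
      ((ContinuousLinearMap.apply ℂ (CSeq d n) w).continuous.tendsto _).comp hop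
    exact (h1.inner (((modulation a).continuous.tendsto _).comp h1)).const_mul _
  refine tendsto_nhds_unique hlhs (hrhs.congr fun j => ?_)
  exact ((hFj j).inner_eq ((hFj j).modulation a)).symm

/-- Continuous functions that separate finitely many points. -/
theorem exists_separating_functions {ι : Type} [Fintype ι] [DecidableEq ι] {y : ι → ℝ}
    (hy : Function.Injective y) :
    ∃ g : ι → ℝ → ℝ, (∀ k, Continuous (g k)) ∧
      ∀ k l, ∀ᶠ x in 𝓝 (y l), g k x = if k = l then 1 else 0 := by
  obtain ⟨r, hr, h⟩ : ∃ r : ℝ, 0 < r ∧ ∀ k l, k ≠ l → 3 * r < |y l - y k| := by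
    have h1 : ∀ᶠ r in 𝓝[>] (0 : ℝ), ∀ k l, k ≠ l → 3 * r < |y l - y k| := by
      refine eventually_all.2 fun k => eventually_all.2 fun l => ?_
      by_cases hkl : k = l
      · exact Eventually.of_forall fun r h => absurd hkl h
      · have h2 : 0 < |y l - y k| := abs_pos.2 (sub_ne_zero.2 fun h => hkl (hy h.symm))
        have h3 : Tendsto (fun r : ℝ => 3 * r) (𝓝[>] 0) (𝓝 (3 * 0)) :=
          (Continuous.tendsto (by fun_prop) 0).mono_left nhdsWithin_le_nhds
        filter_upwards [h3.eventually_lt_const (by rwa [mul_zero])] with r hr _ using hr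
    obtain ⟨r, hr1, hr2⟩ := (h1.and self_mem_nhdsWithin).exists
    exact ⟨r, hr2, hr1⟩
  refine ⟨fun k x => max 0 (min 1 (2 - |x - y k| / r)), fun k => by fun_prop, fun k l => ?_⟩
  filter_upwards [Metric.ball_mem_nhds (y l) hr] with x hx
  rw [Metric.mem_ball, Real.dist_eq] at hx
  split_ifs with hkl
  · subst hkl
    have h1 : |x - y k| / r ≤ 1 := (div_le_one hr).2 hx.le
    rw [min_eq_left (by linarith), max_eq_right zero_le_one]
  · have h1 := h k l hkl
    have h2 : |y l - y k| ≤ |x - y l| + |x - y k| := by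
      rw [abs_sub_comm x (y l)]
      exact abs_sub_le _ _ _
    have h3 : 2 ≤ |x - y k| / r := (le_div_iff₀ hr).2 (by linarith)
    exact max_eq_left ((min_le_right _ _).trans (by linarith))

/-- At a regular point the correlations of the propagators at the momenta `θ₀` and
`θ₀ + (s/t) e_d` converge: the branches decouple, and each one contributes its group velocity. -/
theorem IsRegularPoint.tendsto_inner [NeZero d] (hV : ExpDecay V) (hnonneg : NonnegDefinite V)
    {m M : ℝ} (hsA : ∀ θ, spectrum ℝ (symbolOp V θ) ⊆ Set.Icc m M)
    {θ₀ : Fin d → ℝ} (hreg : IsRegularPoint V θ₀) {h : (Fin d → ℝ) → CVec n}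
    (hc : Continuous h) (σ : ℝ) :
    ∃ (ι : Type) (_ : Fintype ι) (c b : ι → ℝ), (∀ k, 0 ≤ c k) ∧ (∑ k, c k = ‖h θ₀‖ ^ 2) ∧
      (∀ k, b k ≠ 0) ∧ ∀ s : ℝ, Tendsto (fun t : ℝ =>
        inner ℂ (fc (propFn (σ * t)) (symbolOp V θ₀) (h θ₀))
          (fc (propFn (σ * t)) (symbolOp V (θ₀ + (s / t) • lastVec d))
            (h (θ₀ + (s / t) • lastVec d)))) atTop
        (𝓝 (∑ k, (c k : ℂ) * Complex.exp (Complex.I * (σ * s * b k : ℝ)))) := by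
  classical
  obtain ⟨ι, _, ω, hωd, hωinj, hωspec, hωne⟩ := hreg
  have hsa := isSelfAdjoint_symbolOp hnonneg
  have hpos := hωspec.self_of_nhds.1
  have hinj : Function.Injective fun k => ω k θ₀ ^ 2 := fun k l hkl =>
    hωinj ((sq_eq_sq₀ (hpos k).le (hpos l).le).1 hkl)
  obtain ⟨g, hg, hgy⟩ := exists_separating_functions hinj
  have hgc : ∀ k, Continuous fun x => (g k x : ℂ) := fun k =>
    Complex.continuous_ofReal.comp (hg k)
  -- the eigenprojections near `θ₀`
  set P : ι → (Fin d → ℝ) → CVec n →L[ℂ] CVec n := fun k θ =>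
    fc (fun x => (g k x : ℂ)) (symbolOp V θ)
  have hPc : ∀ k, Continuous (P k) := fun k =>
    continuous_fc_comp (hgc k) hsa hsA hV.continuous_symbolOp
  have hnear : ∀ᶠ θ in 𝓝 θ₀, (∀ y, y ∈ spectrum ℝ (symbolOp V θ) → ∃ l, 0 < ω l θ ∧ ω l θ ^ 2 = y ∧
      ∀ k, g k y = if k = l then 1 else 0) := by
    have h1 : ∀ᶠ θ in 𝓝 θ₀, ∀ k l, g k (ω l θ ^ 2) = if k = l then 1 else 0 :=
      eventually_all.2 fun k => eventually_all.2 fun l =>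
        ((hωd l).continuousAt.pow 2).eventually (hgy k l)
    filter_upwards [h1, hωspec] with θ h2 h3 y hy
    rw [spectrum_symbolOp, h3.2] at hy
    obtain ⟨l, rfl⟩ := hy
    exact ⟨l, h3.1 l, rfl, fun k => h2 k l⟩
  have hdec : ∀ᶠ θ in 𝓝 θ₀, ∀ τ (v : CVec n), fc (propFn τ) (symbolOp V θ) v =
      ∑ k, Complex.exp (Complex.I * (τ * ω k θ : ℝ)) • P k θ v := by
    filter_upwards [hnear] with θ hθ τ v
    have h1 : fc (propFn τ) (symbolOp V θ) =
        ∑ k, fc (fun x => Complex.exp (Complex.I * (τ * ω k θ : ℝ)) * (g k x : ℂ))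
          (symbolOp V θ) := by
      rw [← fc_sum (f := fun k x => Complex.exp (Complex.I * (τ * ω k θ : ℝ)) * (g k x : ℂ)) _
        fun k => continuous_const.mul (hgc k)]
      refine fc_congr (hsa θ) fun y hy => ?_
      obtain ⟨l, hl, rfl, hl2⟩ := hθ y hy
      rw [Finset.sum_eq_single l]
      · rw [hl2, if_pos rfl, propFn, Real.sqrt_sq hl.le, Complex.ofReal_one, mul_one]
      · intro k _ hkl
        rw [hl2, if_neg hkl, Complex.ofReal_zero, mul_zero]
      · simp
    rw [h1, sum_apply]
    refine Finset.sum_congr rfl fun k _ => ?_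
    rw [fc_const_mul _ (hgc k), smul_apply]
  have hPinner : ∀ k l, inner ℂ (P k θ₀ (h θ₀)) (P l θ₀ (h θ₀)) =
      if k = l then ((‖P k θ₀ (h θ₀)‖ ^ 2 : ℝ) : ℂ) else 0 := fun k l => by
    split_ifs with hkl
    · rw [hkl, inner_self_eq_ofReal]
    · simp only [P]
      rw [inner_fc_left, ← fc_mul_apply (hgc k).star (hgc l)]
      have h1 : fc (fun x => star (g k x : ℂ) * (g l x : ℂ)) (symbolOp V θ₀) =
          fc (fun _ => 0 * (1 : ℂ)) (symbolOp V θ₀) := by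
        refine fc_congr (hsa θ₀) fun y hy => ?_
        obtain ⟨j, -, -, hj⟩ := hnear.self_of_nhds y hy
        rw [hj, hj]
        by_cases hkj : k = j
        · have hlj : l ≠ j := fun h => hkl (hkj.trans h.symm)
          simp [hlj]
        · simp [hkj]
      rw [h1, fc_const_mul 0 continuous_const, zero_smul, zero_apply, inner_zero_right]
  have hPsum : ∑ k, P k θ₀ (h θ₀) = h θ₀ := by
    have h1 := hdec.self_of_nhds 0 (h θ₀)
    have h2 : fc (propFn 0) (symbolOp V θ₀) = 1 := by
      rw [← fc_one (hsa θ₀)]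
      exact fc_congr (hsa θ₀) fun y _ => by simp [propFn]
    rw [h2, one_apply_eq_self] at h1
    simpa using h1.symm
  refine ⟨ι, inferInstance, fun k => ‖P k θ₀ (h θ₀)‖ ^ 2,
    fun k => fderiv ℝ (ω k) θ₀ (lastVec d), fun k => sq_nonneg _, ?_, hωne, fun s => ?_⟩
  · have h1 : (((∑ k, ‖P k θ₀ (h θ₀)‖ ^ 2 : ℝ)) : ℂ) = ((‖h θ₀‖ ^ 2 : ℝ) : ℂ) := by
      rw [← inner_self_eq_ofReal (h θ₀)]
      conv_rhs => rw [← hPsum]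
      rw [sum_inner]
      simp only [inner_sum, hPinner]
      simp
    exact Complex.ofReal_injective h1
  · set θt : ℝ → Fin d → ℝ := fun t => θ₀ + (s / t) • lastVec d
    have hθt : Tendsto θt atTop (𝓝 θ₀) := by
      have h1 : Tendsto (fun t : ℝ => s / t) atTop (𝓝 0) := tendsto_id.const_div_atTop s
      have h2 := (h1.smul_const (lastVec d)).const_add θ₀
      rwa [zero_smul, add_zero] at h2
    have hterm : ∀ k l, Tendsto (fun t => Complex.exp (Complex.I * (σ * t * (ω l (θt t) - ω k θ₀) : ℝ)) *
        inner ℂ (P k θ₀ (h θ₀)) (P l (θt t) (h (θt t)))) atTop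
        (𝓝 (if k = l then ((‖P k θ₀ (h θ₀)‖ ^ 2 : ℝ) : ℂ) *
          Complex.exp (Complex.I * (σ * s * fderiv ℝ (ω k) θ₀ (lastVec d) : ℝ)) else 0)) := by
      intro k l
      have h1 : Tendsto (fun t => inner ℂ (P k θ₀ (h θ₀)) (P l (θt t) (h (θt t)))) atTop
          (𝓝 (inner ℂ (P k θ₀ (h θ₀)) (P l θ₀ (h θ₀)))) := by
        have h2 : Continuous fun θ => inner ℂ (P k θ₀ (h θ₀)) (P l θ (h θ)) :=
          continuous_const.inner ((hPc l).clm_apply hc)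
        exact (h2.tendsto θ₀).comp hθt
      rw [hPinner] at h1
      split_ifs with hkl
      · subst hkl
        rw [if_pos rfl] at h1
        rw [mul_comm]
        refine Tendsto.mul ?_ h1
        have h3 : Tendsto (fun t : ℝ => t • (ω k (θ₀ + t⁻¹ • (s • lastVec d)) - ω k θ₀)) atTop
            (𝓝 (fderiv ℝ (ω k) θ₀ (s • lastVec d))) :=
          (hωd k).hasFDerivAt.lim _ tendsto_norm_atTop_atTop
        have h4 : Continuous fun r : ℝ => Complex.exp (Complex.I * (σ * r : ℝ)) := by fun_prop
        have h5 := (h4.tendsto _).comp h3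
        rw [map_smul, smul_eq_mul, ← mul_assoc] at h5
        refine h5.congr fun t => ?_
        simp only [Function.comp_apply, θt, smul_smul, smul_eq_mul, div_eq_inv_mul, mul_assoc]
      · rw [if_neg hkl] at h1
        rw [tendsto_zero_iff_norm_tendsto_zero] at h1 ⊢
        refine h1.congr fun t => ?_
        rw [norm_mul, norm_exp_I_mul_ofReal, one_mul]
    have hsum := tendsto_finsetSum Finset.univ fun k _ =>
      tendsto_finsetSum Finset.univ fun l _ => hterm k l
    have hlim : ∑ k, ∑ l, (if k = l then ((‖P k θ₀ (h θ₀)‖ ^ 2 : ℝ) : ℂ) *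
          Complex.exp (Complex.I * (σ * s * fderiv ℝ (ω k) θ₀ (lastVec d) : ℝ)) else 0) =
        ∑ k, ((‖P k θ₀ (h θ₀)‖ ^ 2 : ℝ) : ℂ) *
          Complex.exp (Complex.I * (σ * s * fderiv ℝ (ω k) θ₀ (lastVec d) : ℝ)) := by
      simp
    rw [hlim] at hsum
    refine hsum.congr' ?_
    filter_upwards [hθt.eventually hdec] with t ht
    rw [hdec.self_of_nhds, ht, sum_inner]
    refine Finset.sum_congr rfl fun k _ => ?_
    rw [inner_sum]
    refine Finset.sum_congr rfl fun l _ => ?_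
    rw [inner_smul_left, inner_smul_right, ← mul_assoc, ← Complex.exp_conj, ← Complex.exp_add]
    congr 2
    simp only [map_mul, Complex.conj_I, Complex.conj_ofReal]
    push_cast
    ring

end HarmonicCrystal

namespace HarmonicCrystal

open Filter Topology MeasureTheory ProbabilityTheory

/-! ### Asymptotic distribution of the velocity -/

section Levy

/-- **Lévy's continuity theorem**, with the existence of the limit law. -/
theorem exists_tendsto_of_charFun (m : ℝ → ProbabilityMeasure ℝ) {φ : ℝ → ℂ}
    (hφ : ContinuousAt φ 0)
    (h : ∀ s, Tendsto (fun t => charFun (m t : Measure ℝ) s) atTop (𝓝 (φ s))) :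
    ∃ ν : ProbabilityMeasure ℝ, Tendsto m atTop (𝓝 ν) ∧ ∀ s, charFun (ν : Measure ℝ) s = φ s := by
  have hN : ∀ s, Tendsto (fun k : ℕ => charFun (m k : Measure ℝ) s) atTop (𝓝 (φ s)) := fun s =>
    (h s).comp tendsto_natCast_atTop_atTop
  have htight := isTightMeasureSet_of_tendsto_charFun (μ := fun k : ℕ => (m k : Measure ℝ)) hφ hN
  have hcomp : IsCompact (closure (Set.range fun k : ℕ => m k)) := by
    refine isCompact_closure_of_isTightMeasureSet ?_
    convert htight using 1
    ext μ
    simp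
  obtain ⟨ν, -, ψ, hψ, hν⟩ := hcomp.tendsto_subseq
    fun k : ℕ => subset_closure (Set.mem_range_self (f := fun k : ℕ => m k) k)
  have hφν : ∀ s, charFun (ν : Measure ℝ) s = φ s := fun s =>
    tendsto_nhds_unique (ProbabilityMeasure.tendsto_iff_tendsto_charFun.1 hν s)
      ((hN s).comp hψ.tendsto_atTop)
  refine ⟨ν, tendsto_of_seq_tendsto fun u hu => ?_, hφν⟩
  refine ProbabilityMeasure.tendsto_of_tendsto_charFun fun s => ?_
  rw [hφν]
  exact (h s).comp hu

/-- The mass of a law at the origin is bounded by Gaussian averages of its characteristic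
function. -/
theorem measureReal_singleton_le_integral_charFun (ν : Measure ℝ) [IsProbabilityMeasure ν] (T : ℝ) :
    ν.real {0} ≤ (∫ s, charFun ν (T * s) ∂(gaussianReal 0 1)).re := by
  have h1 : ∫ s, charFun ν (T * s) ∂(gaussianReal 0 1) =
      ∫ x, ((Real.exp (-(T * x) ^ 2 / 2) : ℝ) : ℂ) ∂ν := by
    simp only [charFun_apply_real]
    rw [integral_integral_swap]
    · refine integral_congr_ae (Eventually.of_forall fun x => ?_)
      have h2 := charFun_gaussianReal (μ := 0) (v := 1) (T * x)
      rw [charFun_apply_real] at h2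
      simp only
      have h3 : ∀ s : ℝ, Complex.exp (((T * s : ℝ) : ℂ) * x * Complex.I) =
          Complex.exp (((T * x : ℝ) : ℂ) * s * Complex.I) := fun s => by
        congr 1
        push_cast
        ring
      simp only [h3, h2]
      push_cast
      congr 1
      simp
      ring
    · refine Integrable.of_bound (C := 1) (Continuous.aestronglyMeasurable ?_)
        (Eventually.of_forall fun p => ?_)
      · simp only [Function.uncurry_def]
        fun_prop
      · have : ((T * p.1 : ℝ) : ℂ) * p.2 * Complex.I = ((T * p.1 * p.2 : ℝ) : ℂ) * Complex.I := by
          push_cast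
          ring
        rw [Function.uncurry_def]
        simp only
        rw [this, Complex.norm_exp_ofReal_mul_I]
  rw [h1, integral_complex_ofReal, Complex.ofReal_re]
  have hint : Integrable (fun x => Real.exp (-(T * x) ^ 2 / 2)) ν := by
    refine Integrable.of_bound (C := 1) (Continuous.aestronglyMeasurable (by fun_prop))
      (Eventually.of_forall fun x => ?_)
    rw [Real.norm_eq_abs, Real.abs_exp]
    exact Real.exp_le_one_iff.2 (by nlinarith [sq_nonneg (T * x)])
  calc ν.real {0} = ∫ x in {(0 : ℝ)}, Real.exp (-(T * x) ^ 2 / 2) ∂ν := by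
        rw [integral_singleton]
        simp
    _ ≤ _ := setIntegral_le_integral hint (Eventually.of_forall fun x => (Real.exp_pos _).le)

end Levy

section Velocity

variable {d n : ℕ} [NeZero d]

/-- The law of `x_d / t`, if `x` is distributed with the weights `|w(x)|²`. -/
noncomputable def posLaw (w : CSeq d n) (t : ℝ) : Measure ℝ :=
  Measure.sum fun x : Lattice d => ENNReal.ofReal (‖w x‖ ^ 2) •
    Measure.dirac ((lastCoord x : ℝ) / t)

theorem posLaw_apply (w : CSeq d n) (t : ℝ) {S : Set ℝ} (hS : MeasurableSet S) :
    posLaw w t S = ∑' x, ENNReal.ofReal (‖w x‖ ^ 2) * S.indicator 1 ((lastCoord x : ℝ) / t) := by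
  rw [posLaw, Measure.sum_apply _ hS]
  refine tsum_congr fun x => ?_
  rw [Measure.smul_apply, Measure.dirac_apply' _ hS, smul_eq_mul]

theorem posLaw_univ (w : CSeq d n) (t : ℝ) : posLaw w t Set.univ = ENNReal.ofReal (‖w‖ ^ 2) := by
  rw [posLaw_apply w t MeasurableSet.univ, norm_sq_eq_tsum,
    ENNReal.ofReal_tsum_of_nonneg (fun x => sq_nonneg _) (summable_norm_sq w)]
  simp

theorem posLaw_real_apply (w : CSeq d n) (t : ℝ) {S : Set ℝ} (hS : MeasurableSet S) :
    (posLaw w t).real S = ∑' x, ‖w x‖ ^ 2 * S.indicator 1 ((lastCoord x : ℝ) / t) := by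
  rw [Measure.real, posLaw_apply w t hS, ENNReal.tsum_toReal_eq]
  · refine tsum_congr fun x => ?_
    rw [ENNReal.toReal_mul, ENNReal.toReal_ofReal (sq_nonneg _)]
    congr 1
    by_cases h : (lastCoord x : ℝ) / t ∈ S <;> simp [h]
  · intro x
    by_cases h : (lastCoord x : ℝ) / t ∈ S <;> simp [h]

theorem charFun_posLaw (w : CSeq d n) (t s : ℝ) :
    charFun (posLaw w t) s = inner ℂ w (modulation (s / t) w) := by
  have hfin : IsFiniteMeasure (posLaw w t) := ⟨by rw [posLaw_univ]; exact ENNReal.ofReal_lt_top⟩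
  rw [charFun_apply_real]
  have hint : Integrable (fun x : ℝ => Complex.exp (s * x * Complex.I)) (posLaw w t) := by
    refine Integrable.of_bound (C := 1) (Continuous.aestronglyMeasurable (by fun_prop))
      (Eventually.of_forall fun x => ?_)
    rw [← Complex.ofReal_mul, Complex.norm_exp_ofReal_mul_I]
  have h1 := hasSum_integral_measure (f := fun x : ℝ => Complex.exp (s * x * Complex.I)) hint
  refine h1.unique ((lp.hasSum_inner w (modulation (s / t) w)).congr_fun fun x => ?_)
  rw [integral_smul_measure, integral_dirac, modulation, mulOp_apply, inner_smul_right,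
    inner_self_eq_ofReal, ENNReal.toReal_ofReal (sq_nonneg _), Complex.real_smul, mul_comm]
  congr 2
  push_cast
  ring

end Velocity

end HarmonicCrystal

namespace HarmonicCrystal

open Filter Topology MeasureTheory ProbabilityTheory

/-! ### Existence of the asymptotic velocity and absence of atoms at zero -/

variable {d n : ℕ} {V : Lattice d → Matrix (Fin n) (Fin n) ℝ}

/-- The propagator `e^{iτ 𝒱^{1/2}}`. -/
noncomputable def evol (V : Lattice d → Matrix (Fin n) (Fin n) ℝ) (τ : ℝ) :
    CSeq d n →L[ℂ] CSeq d n := fc (propFn τ) (interactionOp V)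

theorem norm_evol (hV : ExpDecay V) (hnonneg : NonnegDefinite V) (τ : ℝ) (w : CSeq d n) :
    ‖evol V τ w‖ = ‖w‖ :=
  norm_fc_apply_of_norm_one (isSelfAdjoint_interactionOp hV hnonneg) (continuous_propFn τ)
    (norm_propFn τ) w

/-- The limit of the correlations at a regular point, as a function of the dual variable `s` of the
velocity. It is the characteristic function of a measure without atom at zero. -/
theorem IsRegularPoint.exists_limit [NeZero d] (hV : ExpDecay V) (hnonneg : NonnegDefinite V)
    {m M : ℝ} (hsA : ∀ θ, spectrum ℝ (symbolOp V θ) ⊆ Set.Icc m M)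
    {θ₀ : Fin d → ℝ} (hreg : IsRegularPoint V θ₀) {h : (Fin d → ℝ) → CVec n}
    (hc : Continuous h) {σ : ℝ} (hσ : σ ≠ 0) :
    ∃ L : ℝ → ℂ, Continuous L ∧ (∀ s, ‖L s‖ ≤ ‖h θ₀‖ ^ 2) ∧
      Tendsto (fun k : ℕ => ∫ s, L (k * s) ∂(gaussianReal 0 1)) atTop (𝓝 0) ∧
      ∀ s : ℝ, Tendsto (fun t : ℝ =>
        inner ℂ (fc (propFn (σ * t)) (symbolOp V θ₀) (h θ₀))
          (fc (propFn (σ * t)) (symbolOp V (θ₀ + (s / t) • lastVec d))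
            (h (θ₀ + (s / t) • lastVec d)))) atTop (𝓝 (L s)) := by
  obtain ⟨ι, _, c, b, hc0, hcsum, hb, hlim⟩ := hreg.tendsto_inner hV hnonneg hsA hc σ
  refine ⟨_, by fun_prop, fun s => ?_, ?_, hlim⟩
  · rw [← hcsum]
    refine (norm_sum_le _ _).trans (Finset.sum_le_sum fun k _ => ?_)
    rw [norm_mul, norm_exp_I_mul_ofReal, mul_one, Complex.norm_real, Real.norm_of_nonneg (hc0 k)]
  · have h1 : ∀ k : ℕ, ∫ s : ℝ, ∑ i, (c i : ℂ) *
        Complex.exp (Complex.I * (σ * (k * s) * b i : ℝ)) ∂(gaussianReal 0 1) =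
        ∑ i, (c i : ℂ) * ((Real.exp (-(σ * b i * k) ^ 2 / 2) : ℝ) : ℂ) := fun k => by
      rw [integral_finsetSum _ fun i _ => Integrable.const_mul
        (Integrable.of_bound (C := 1) (Continuous.aestronglyMeasurable (by fun_prop))
          (Eventually.of_forall fun s => (norm_exp_I_mul_ofReal _).le)) _]
      refine Finset.sum_congr rfl fun i _ => ?_
      rw [integral_const_mul]
      congr 1
      have h2 := charFun_gaussianReal (μ := 0) (v := 1) (σ * b i * k)
      rw [charFun_apply_real] at h2
      have h3 : ∀ s : ℝ, Complex.exp (Complex.I * (σ * (k * s) * b i : ℝ)) =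
          Complex.exp (((σ * b i * k : ℝ) : ℂ) * s * Complex.I) := fun s => by
        congr 1
        push_cast
        ring
      simp only [h3, h2]
      push_cast
      congr 1
      simp
      ring
    simp only [h1]
    have h4 : ∀ i ∈ Finset.univ, Tendsto (fun k : ℕ => (c i : ℂ) *
        ((Real.exp (-(σ * b i * k) ^ 2 / 2) : ℝ) : ℂ)) atTop (𝓝 ((c i : ℂ) * ((0 : ℝ) : ℂ))) := by
      intro i _
      refine Tendsto.const_mul _ ((Complex.continuous_ofReal.tendsto 0).comp ?_)
      refine Real.tendsto_exp_atBot.comp ?_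
      have h5 : 0 < (σ * b i) ^ 2 / 2 := by
        have := mul_ne_zero hσ (hb i)
        positivity
      have h6 : Tendsto (fun k : ℕ => ((k : ℝ)) ^ 2) atTop atTop :=
        (tendsto_pow_atTop two_ne_zero).comp tendsto_natCast_atTop_atTop
      have h7 := (h6.const_mul_atTop h5)
      refine (tendsto_neg_atTop_atBot.comp h7).congr fun k => ?_
      simp only [Function.comp_apply]
      ring
    simpa using tendsto_finsetSum Finset.univ h4

/-- For absolutely summable initial data the law of `x_d / t` converges to a law without atom at
zero. -/
theorem exists_velocity_law [NeZero d] (hV : ExpDecay V) (hnonneg : NonnegDefinite V)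
    (hreg : ∀ᵐ θ : Fin d → ℝ, IsRegularPoint V θ)
    {m M : ℝ} (hs : spectrum ℝ (interactionOp V) ⊆ Set.Icc m M)
    (hsA : ∀ θ, spectrum ℝ (symbolOp V θ) ⊆ Set.Icc m M)
    {w : CSeq d n} (hw : Summable fun x => ‖w x‖) (hw1 : ‖w‖ = 1) {σ : ℝ} (hσ : σ ≠ 0) :
    ∃ (μ : ℝ → ProbabilityMeasure ℝ) (ν : ProbabilityMeasure ℝ),
      (∀ t, (μ t : Measure ℝ) = posLaw (evol V (σ * t) w) t) ∧ Tendsto μ atTop (𝓝 ν) ∧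
      (ν : Measure ℝ) {0} = 0 := by
  classical
  obtain ⟨h, H⟩ := exists_isFourier hw
  have hc := H.continuous
  have hcA := hV.continuous_symbolOp
  have hsaA := isSelfAdjoint_symbolOp hnonneg
  set S := ∑' x, ‖w x‖
  -- the correlations in Fourier space, and their limits
  set G : ℝ → (Fin d → ℝ) → ℝ → ℂ := fun t θ s =>
    inner ℂ (fc (propFn (σ * t)) (symbolOp V θ) (h θ))
      (fc (propFn (σ * t)) (symbolOp V (θ + (s / t) • lastVec d)) (h (θ + (s / t) • lastVec d)))
  have hGc : ∀ t, Continuous fun p : (Fin d → ℝ) × ℝ => G t p.1 p.2 := fun t => by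
    have h1 : Continuous fun θ => fc (propFn (σ * t)) (symbolOp V θ) (h θ) :=
      (continuous_fc_comp (continuous_propFn _) hsaA hsA hcA).clm_apply hc
    exact (h1.comp continuous_fst).inner (h1.comp (by fun_prop))
  have hnorm : ∀ t θ, ‖fc (propFn (σ * t)) (symbolOp V θ) (h θ)‖ = ‖h θ‖ := fun t θ =>
    norm_fc_apply_of_norm_one (hsaA θ) (continuous_propFn _) (norm_propFn _) _
  have hGb : ∀ t θ s, ‖G t θ s‖ ≤ S * S := fun t θ s => by
    refine (norm_inner_le_norm _ _).trans ?_
    rw [hnorm, hnorm]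
    exact mul_le_mul (H.norm_le _) (H.norm_le _) (norm_nonneg _)
      ((norm_nonneg _).trans (H.norm_le θ))
  have hL : ∀ θ, ∃ L : ℝ → ℂ, Continuous L ∧ (∀ s, ‖L s‖ ≤ ‖h θ‖ ^ 2) ∧
      Tendsto (fun k : ℕ => ∫ s, L (k * s) ∂(gaussianReal 0 1)) atTop (𝓝 0) ∧
      (IsRegularPoint V θ → ∀ s : ℝ, Tendsto (fun t : ℝ => G t θ s) atTop (𝓝 (L s))) := fun θ => by
    by_cases hθ : IsRegularPoint V θ
    · obtain ⟨L, h1, h2, h3, h4⟩ := hθ.exists_limit hV hnonneg hsA hc hσ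
      exact ⟨L, h1, h2, h3, fun _ => h4⟩
    · exact ⟨fun _ => 0, continuous_const, fun s => by rw [norm_zero]; positivity, by simp,
        fun h => absurd h hθ⟩
  choose L hLc hLb hLg hLlim using hL
  have hLb' : ∀ θ s, ‖L θ s‖ ≤ S * S := fun θ s => by
    refine (hLb θ s).trans ?_
    rw [sq]
    exact mul_le_mul (H.norm_le θ) (H.norm_le θ) (norm_nonneg _)
      ((norm_nonneg _).trans (H.norm_le θ))
  have hbox : IsFiniteMeasure (volume.restrict (torusBox d)) :=
    ⟨by rw [Measure.restrict_apply_univ]; exact isCompact_Icc.measure_lt_top⟩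
  set κ : ℂ := (((2 * Real.pi) ^ d : ℝ) : ℂ)
  have hκ : κ ≠ 0 := by
    simp only [κ]
    norm_cast
    positivity
  set φ : ℝ → ℂ := fun s => κ⁻¹ * ∫ θ in torusBox d, L θ s
  have hreg' : ∀ᵐ θ ∂(volume.restrict (torusBox d)), IsRegularPoint V θ := ae_restrict_of_ae hreg
  have hLm : ∀ s, AEStronglyMeasurable (fun θ => L θ s) (volume.restrict (torusBox d)) := fun s => by
    refine aestronglyMeasurable_of_tendsto_ae atTop
      (f := fun (k : ℕ) θ => G k θ s) (fun k => ?_) ?_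
    · exact ((hGc k).comp (by fun_prop : Continuous fun θ : Fin d → ℝ => (θ, s))).aestronglyMeasurable
    · filter_upwards [hreg'] with θ hθ
      exact (hLlim θ hθ s).comp tendsto_natCast_atTop_atTop
  have hchar : ∀ t s, charFun (posLaw (evol V (σ * t) w) t) s =
      κ⁻¹ * ∫ θ in torusBox d, G t θ s := fun t s => by
    rw [charFun_posLaw, evol, inner_fc_modulation hV hnonneg hs hsA H (continuous_propFn _)
      (fun x => (norm_propFn _ x).le), ← mul_assoc, inv_mul_cancel₀ hκ, one_mul]
  have hlim : ∀ s, Tendsto (fun t => charFun (posLaw (evol V (σ * t) w) t) s) atTop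
      (𝓝 (φ s)) := fun s => by
    simp only [hchar]
    refine Tendsto.const_mul _ ?_
    refine tendsto_integral_filter_of_dominated_convergence (fun _ => S * S)
      (Eventually.of_forall fun t => ?_)
      (Eventually.of_forall fun t => Eventually.of_forall fun θ => hGb t θ s)
      (integrable_const _) ?_
    · exact ((hGc t).comp (by fun_prop : Continuous fun θ : Fin d → ℝ => (θ, s))).aestronglyMeasurable
    · filter_upwards [hreg'] with θ hθ using hLlim θ hθ s
  have hφ : Continuous φ := by
    refine continuous_const.mul ?_
    refine continuous_of_dominated (bound := fun _ => S * S) hLm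
      (fun s => Eventually.of_forall fun θ => hLb' θ s) (integrable_const _)
      (Eventually.of_forall hLc)
  have hprob : ∀ t, IsProbabilityMeasure (posLaw (evol V (σ * t) w) t) := fun t =>
    ⟨by rw [posLaw_univ, norm_evol hV hnonneg, hw1]; simp⟩
  let μ : ℝ → ProbabilityMeasure ℝ := fun t => ⟨posLaw (evol V (σ * t) w) t, hprob t⟩
  obtain ⟨ν, hν, hνφ⟩ := exists_tendsto_of_charFun μ hφ.continuousAt hlim
  refine ⟨μ, ν, fun t => rfl, hν, ?_⟩
  -- the Gaussian averages of the characteristic function tend to zero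
  have hswap : ∀ k : ℕ, ∫ s, charFun (ν : Measure ℝ) (k * s) ∂(gaussianReal 0 1) =
      κ⁻¹ * ∫ θ in torusBox d, ∫ s, L θ (k * s) ∂(gaussianReal 0 1) := fun k => by
    simp only [hνφ, φ]
    rw [integral_const_mul, integral_integral_swap]
    refine Integrable.of_bound (C := S * S) ?_ (Eventually.of_forall fun p => hLb' _ _)
    refine aestronglyMeasurable_of_tendsto_ae atTop
      (f := fun (j : ℕ) (p : ℝ × (Fin d → ℝ)) => G j p.2 (k * p.1)) (fun j => ?_) ?_
    · exact ((hGc j).comp (by fun_prop :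
        Continuous fun p : ℝ × (Fin d → ℝ) => (p.2, k * p.1))).aestronglyMeasurable
    · have h1 : ∀ᵐ p : ℝ × (Fin d → ℝ) ∂((gaussianReal 0 1).prod (volume.restrict (torusBox d))),
          IsRegularPoint V p.2 := Measure.quasiMeasurePreserving_snd.ae hreg'
      filter_upwards [h1] with p hp
      exact (hLlim p.2 hp _).comp tendsto_natCast_atTop_atTop
  have hzero : Tendsto (fun k : ℕ => (∫ s, charFun (ν : Measure ℝ) (k * s) ∂(gaussianReal 0 1)).re)
      atTop (𝓝 0) := by
    have h1 : Tendsto (fun k : ℕ => κ⁻¹ * ∫ θ in torusBox d, ∫ s, L θ (k * s) ∂(gaussianReal 0 1))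
        atTop (𝓝 (κ⁻¹ * ∫ θ in torusBox d, (0 : ℂ))) := by
      refine Tendsto.const_mul _ ?_
      refine tendsto_integral_of_dominated_convergence (fun _ => S * S) (fun k => ?_)
        (integrable_const _) (fun k => Eventually.of_forall fun θ => ?_)
        (Eventually.of_forall fun θ => hLg θ)
      · have h2 : AEStronglyMeasurable (fun p : (Fin d → ℝ) × ℝ => L p.1 (k * p.2))
            ((volume.restrict (torusBox d)).prod (gaussianReal 0 1)) := by
          refine aestronglyMeasurable_of_tendsto_ae atTop
            (f := fun (j : ℕ) (p : (Fin d → ℝ) × ℝ) => G j p.1 (k * p.2)) (fun j => ?_) ?_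
          · exact ((hGc j).comp (by fun_prop :
              Continuous fun p : (Fin d → ℝ) × ℝ => (p.1, k * p.2))).aestronglyMeasurable
          · have h1 : ∀ᵐ p : (Fin d → ℝ) × ℝ
                ∂((volume.restrict (torusBox d)).prod (gaussianReal 0 1)),
                IsRegularPoint V p.1 := Measure.quasiMeasurePreserving_fst.ae hreg'
            filter_upwards [h1] with p hp
            exact (hLlim p.1 hp _).comp tendsto_natCast_atTop_atTop
        exact h2.integral_prod_right'
      · refine (norm_integral_le_of_norm_le_const (C := S * S)
          (Eventually.of_forall fun s => hLb' θ _)).trans ?_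
        simp
    simp only [hswap]
    rw [integral_zero, mul_zero] at h1
    exact (Complex.continuous_re.tendsto 0).comp h1
  have hle := ge_of_tendsto' hzero fun k : ℕ => measureReal_singleton_le_integral_charFun ν k
  have h0 : (ν : Measure ℝ).real {0} = 0 := le_antisymm hle measureReal_nonneg
  exact (measureReal_eq_zero_iff).1 h0

end HarmonicCrystal

namespace HarmonicCrystal

open Filter Topology MeasureTheory ProbabilityTheory

/-! ### Escape from slabs and convergence of half-space masses -/

variable {d n : ℕ} [NeZero d] {V : Lattice d → Matrix (Fin n) (Fin n) ℝ}

/-- The multiplication by a bounded function of the last coordinate. -/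
noncomputable def cutOp (g : ℤ → ℝ) (hg : ∃ C : ℝ, ∀ s, |g s| ≤ C) : CSeq d n →L[ℂ] CSeq d n :=
  mulOp (fun x => (g (lastCoord x) : ℂ)) hg.choose fun x => by
    rw [Complex.norm_real]
    exact hg.choose_spec _

theorem cutOp_apply {g : ℤ → ℝ} (hg : ∃ C : ℝ, ∀ s, |g s| ≤ C) (w : CSeq d n) (x : Lattice d) :
    cutOp g hg w x = (g (lastCoord x) : ℂ) • w x :=
  mulOp_apply _ _ _ w x

/-- The mass `∑ₓ r(x_d) |w(x)|²`. -/
noncomputable def mass (r : ℤ → ℝ) (w : CSeq d n) : ℝ := ∑' x, r (lastCoord x) * ‖w x‖ ^ 2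

theorem norm_cutOp_sq {g : ℤ → ℝ} (hg : ∃ C : ℝ, ∀ s, |g s| ≤ C) (w : CSeq d n) :
    ‖cutOp g hg w‖ ^ 2 = mass (fun s => g s ^ 2) w := by
  rw [norm_sq_eq_tsum, mass]
  refine tsum_congr fun x => ?_
  rw [cutOp_apply, norm_smul, Complex.norm_real, mul_pow, Real.norm_eq_abs, sq_abs]

theorem summable_mass {r : ℤ → ℝ} {C : ℝ} (hr : ∀ s, |r s| ≤ C) (w : CSeq d n) :
    Summable fun x => r (lastCoord x) * ‖w x‖ ^ 2 := by
  refine Summable.of_norm_bounded ((summable_norm_sq w).mul_left C) fun x => ?_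
  rw [norm_mul, Real.norm_eq_abs, Real.norm_of_nonneg (sq_nonneg _)]
  exact mul_le_mul_of_nonneg_right (hr _) (sq_nonneg _)

theorem abs_mass_le {r r' : ℤ → ℝ} {C : ℝ} (hr : ∀ s, |r s| ≤ r' s) (hC : ∀ s, r' s ≤ C)
    (w : CSeq d n) : |mass r w| ≤ mass r' w := by
  have h : ∀ s, |r' s| ≤ C := fun s => by
    rw [abs_of_nonneg ((abs_nonneg _).trans (hr s))]
    exact hC s
  refine tsum_of_norm_bounded (f := fun x => r (lastCoord x) * ‖w x‖ ^ 2)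
    (summable_mass h w).hasSum fun x => ?_
  rw [norm_mul, Real.norm_eq_abs, Real.norm_of_nonneg (sq_nonneg _)]
  exact mul_le_mul_of_nonneg_right (hr _) (sq_nonneg _)

theorem mass_const_mul (c : ℝ) (r : ℤ → ℝ) (w : CSeq d n) :
    mass (fun s => c * r s) w = c * mass r w := by
  simp only [mass, ← tsum_mul_left, mul_assoc]

theorem mass_add {r r' : ℤ → ℝ} {C C' : ℝ} (hr : ∀ s, |r s| ≤ C) (hr' : ∀ s, |r' s| ≤ C')
    (w : CSeq d n) : mass (fun s => r s + r' s) w = mass r w + mass r' w := by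
  simp only [mass, add_mul]
  exact (summable_mass hr w).tsum_add (summable_mass hr' w)

theorem mass_sub {r r' : ℤ → ℝ} {C C' : ℝ} (hr : ∀ s, |r s| ≤ C) (hr' : ∀ s, |r' s| ≤ C')
    (w : CSeq d n) : mass (fun s => r s - r' s) w = mass r w - mass r' w := by
  simp only [mass, sub_mul]
  exact (summable_mass hr w).tsum_sub (summable_mass hr' w)

theorem posLaw_real_eq_mass (w : CSeq d n) (t : ℝ) {S : Set ℝ} (hS : MeasurableSet S) :
    (posLaw w t).real S = mass (fun s => S.indicator 1 ((s : ℝ) / t)) w := by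
  rw [posLaw_real_apply w t hS, mass]
  exact tsum_congr fun x => mul_comm _ _

/-- A law without atom at zero is approached by laws which charge small neighbourhoods of zero
little. -/
theorem exists_Icc_eventually_lt {μ : ℝ → ProbabilityMeasure ℝ} {ν : ProbabilityMeasure ℝ}
    (h : Tendsto μ atTop (𝓝 ν)) (h0 : (ν : Measure ℝ) {0} = 0) {ε : ℝ} (hε : 0 < ε) :
    ∃ δ > 0, ∀ᶠ t in atTop, (μ t : Measure ℝ).real (Set.Icc (-δ) δ) < ε := by
  have h1 := tendsto_measure_cthickening (μ := (ν : Measure ℝ)) (s := {0})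
    ⟨1, one_pos, measure_ne_top _ _⟩
  rw [isClosed_singleton.closure_eq, h0] at h1
  have h2 := h1.eventually_lt_const (ENNReal.ofReal_pos.2 hε)
  obtain ⟨δ, hδ, h3⟩ := Metric.eventually_nhds_iff.1 h2
  refine ⟨δ / 2, by positivity, ?_⟩
  have h4 := h3 (y := δ / 2) (by rw [dist_zero_right, Real.norm_of_nonneg] <;> linarith)
  rw [Metric.cthickening_singleton _ (by positivity), Real.closedBall_eq_Icc, zero_sub,
    zero_add] at h4
  have h5 := (ProbabilityMeasure.limsup_measure_closed_le_of_tendsto h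
    (isClosed_Icc (a := -(δ / 2)) (b := δ / 2))).trans_lt h4
  filter_upwards [eventually_lt_of_limsup_lt h5] with t ht
  exact (ENNReal.lt_ofReal_iff_toReal_lt (measure_ne_top _ _)).1 ht

/-- The norm convergence of bounded operators along a bounded family of vectors extends from a dense
set of initial data. -/
theorem exists_tendsto_norm_of_dense {E F : Type*} [NormedAddCommGroup E] [NormedSpace ℂ E]
    [NormedAddCommGroup F] [NormedSpace ℂ F] {U : ℝ → E →L[ℂ] F} {C : ℝ} (hU : ∀ t w, ‖U t w‖ ≤ C * ‖w‖)
    {D : Set E} (hD : Dense D)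
    (h : ∀ w ∈ D, ∃ L, Tendsto (fun t => ‖U t w‖) atTop (𝓝 L)) (w : E) :
    ∃ L, Tendsto (fun t => ‖U t w‖) atTop (𝓝 L) := by
  have hC : 0 < |C| + 1 := by positivity
  refine cauchySeq_tendsto_of_complete (Metric.cauchySeq_iff'.2 fun ε hε => ?_)
  obtain ⟨w', hw', hd⟩ := Metric.mem_closure_iff.1 (hD w) (ε / 4 / (|C| + 1)) (by positivity)
  obtain ⟨L, hL⟩ := h w' hw'
  obtain ⟨N, hN⟩ := Metric.cauchySeq_iff'.1 hL.cauchySeq (ε / 4) (by positivity)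
  have hnear : ∀ t, dist ‖U t w‖ ‖U t w'‖ < ε / 4 := fun t => by
    refine (abs_norm_sub_norm_le _ _).trans_lt ?_
    rw [← map_sub]
    refine (hU _ _).trans_lt ?_
    rw [dist_eq_norm, lt_div_iff₀ hC] at hd
    nlinarith [norm_nonneg (w - w'), le_abs_self C]
  refine ⟨N, fun t ht => ?_⟩
  have h1 := dist_triangle4 ‖U t w‖ ‖U t w'‖ ‖U N w'‖ ‖U N w‖
  have h2 := hnear N
  rw [dist_comm] at h2
  linarith [hnear t, hN t ht]

theorem tendsto_zero_of_dense {E F : Type*} [NormedAddCommGroup E] [NormedSpace ℂ E]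
    [NormedAddCommGroup F] [NormedSpace ℂ F] {U : ℝ → E →L[ℂ] F} {C : ℝ} (hU : ∀ t w, ‖U t w‖ ≤ C * ‖w‖)
    {D : Set E} (hD : Dense D) (h : ∀ w ∈ D, Tendsto (fun t => U t w) atTop (𝓝 0)) (w : E) :
    Tendsto (fun t => U t w) atTop (𝓝 0) := by
  have hC : 0 < |C| + 1 := by positivity
  refine Metric.tendsto_nhds.2 fun ε hε => ?_
  obtain ⟨w', hw', hd⟩ := Metric.mem_closure_iff.1 (hD w) (ε / 2 / (|C| + 1)) (by positivity)
  filter_upwards [Metric.tendsto_nhds.1 (h w' hw') (ε / 2) (by positivity)] with t ht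
  rw [dist_zero_right] at ht ⊢
  have h1 : ‖U t w - U t w'‖ < ε / 2 := by
    rw [← map_sub]
    refine (hU _ _).trans_lt ?_
    rw [dist_eq_norm, lt_div_iff₀ hC] at hd
    nlinarith [norm_nonneg (w - w'), le_abs_self C]
  have h2 := norm_le_norm_add_norm_sub' (U t w) (U t w')
  linarith

/-- The indicator function of the slab `|s| ≤ R`. -/
noncomputable def slabInd (R : ℝ) (s : ℤ) : ℝ := (Set.Icc (-R) R).indicator 1 (s : ℝ)

theorem indicator_one_nonneg (S : Set ℝ) (a : ℝ) : 0 ≤ S.indicator (1 : ℝ → ℝ) a :=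
  Set.indicator_nonneg (fun _ _ => zero_le_one) a

theorem abs_indicator_one_le (S : Set ℝ) (a : ℝ) : |S.indicator (1 : ℝ → ℝ) a| ≤ 1 := by
  by_cases ha : a ∈ S <;> simp [ha]

theorem slabInd_of_le {R : ℝ} {s : ℤ} (h : |(s : ℝ)| ≤ R) : slabInd R s = 1 :=
  Set.indicator_of_mem (Set.mem_Icc.2 (abs_le.1 h)) _

theorem slabInd_of_lt {R : ℝ} {s : ℤ} (h : R < |(s : ℝ)|) : slabInd R s = 0 :=
  Set.indicator_of_notMem (fun h' => h.not_ge (abs_le.2 (Set.mem_Icc.1 h'))) _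

theorem tendsto_mass_slabInd {w : ℝ → CSeq d n} {μ : ℝ → ProbabilityMeasure ℝ}
    {ν : ProbabilityMeasure ℝ} (hμ : ∀ t, (μ t : Measure ℝ) = posLaw (w t) t)
    (hν : Tendsto μ atTop (𝓝 ν)) (h0 : (ν : Measure ℝ) {0} = 0) (R : ℝ) :
    Tendsto (fun t => mass (slabInd R) (w t)) atTop (𝓝 0) := by
  refine Metric.tendsto_nhds.2 fun ε hε => ?_
  obtain ⟨δ, hδ, hev⟩ := exists_Icc_eventually_lt hν h0 hε
  filter_upwards [hev, eventually_ge_atTop (R / δ), eventually_gt_atTop 0] with t ht htR ht0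
  rw [dist_zero_right, Real.norm_eq_abs]
  refine lt_of_le_of_lt ?_ ht
  rw [hμ, posLaw_real_eq_mass _ _ measurableSet_Icc]
  refine abs_mass_le (C := 1) (fun s => ?_) (fun s => (abs_le.1 (abs_indicator_one_le _ _)).2) _
  rw [slabInd, abs_of_nonneg (indicator_one_nonneg _ _)]
  by_cases hs : (s : ℝ) ∈ Set.Icc (-R) R
  swap
  · rw [Set.indicator_of_notMem hs]
    exact indicator_one_nonneg _ _
  rw [Set.indicator_of_mem hs, Set.indicator_of_mem, Pi.one_apply, Pi.one_apply]
  rw [div_le_iff₀ hδ] at htR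
  rw [Set.mem_Icc, ← abs_le, abs_div, abs_of_pos ht0, div_le_iff₀ ht0]
  linarith [abs_le.2 hs]

/-- If the mass in every slab tends to zero, then so do all cutoffs supported in slabs. -/
theorem tendsto_cutOp_of_mass {w : ℝ → CSeq d n}
    (h : ∀ R, Tendsto (fun t => mass (slabInd R) (w t)) atTop (𝓝 0)) {g : ℤ → ℝ}
    (hg : ∃ C : ℝ, ∀ s, |g s| ≤ C) {R : ℝ} (hR : ∀ s : ℤ, R < |(s : ℝ)| → g s = 0) :
    Tendsto (fun t => cutOp g hg (w t)) atTop (𝓝 0) := by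
  rw [tendsto_zero_iff_norm_tendsto_zero]
  have h2 := hg
  obtain ⟨C, hC⟩ := h2
  have h1 : Tendsto (fun t => ‖cutOp g hg (w t)‖ ^ 2) atTop (𝓝 0) := by
    refine squeeze_zero (fun t => sq_nonneg _) (fun t => ?_)
      (by simpa using (h R).const_mul (C ^ 2))
    rw [norm_cutOp_sq, ← mass_const_mul]
    refine (le_abs_self _).trans (abs_mass_le (C := C ^ 2) (fun s => ?_) (fun s => ?_) _)
    · rw [abs_of_nonneg (sq_nonneg _)]
      rcases le_or_gt |(s : ℝ)| R with hs | hs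
      · rw [slabInd_of_le hs, mul_one]
        exact sq_le_sq' (abs_le.1 (hC s)).1 (abs_le.1 (hC s)).2
      · rw [slabInd_of_lt hs, hR s hs, mul_zero]
        norm_num
    · exact mul_le_of_le_one_right (sq_nonneg C) (abs_le.1 (abs_indicator_one_le _ _)).2
  simpa using h1.sqrt

/-- Convergence of the velocities implies that the masses with weights which are constant near
`±∞` converge. -/
theorem tendsto_mass_of_velocity_law {w : ℝ → CSeq d n} {μ : ℝ → ProbabilityMeasure ℝ}
    {ν : ProbabilityMeasure ℝ} (hμ : ∀ t, (μ t : Measure ℝ) = posLaw (w t) t)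
    (hν : Tendsto μ atTop (𝓝 ν)) (h0 : (ν : Measure ℝ) {0} = 0) {r : ℤ → ℝ} {C : ℝ}
    (hr : ∀ s, |r s| ≤ C) {R p q : ℝ} (hR : 0 ≤ R) (hp : ∀ s : ℤ, R < (s : ℝ) → r s = p)
    (hq : ∀ s : ℤ, (s : ℝ) < -R → r s = q) :
    Tendsto (fun t => mass r (w t)) atTop
      (𝓝 (p * (ν : Measure ℝ).real (Set.Ioi 0) + q * (ν : Measure ℝ).real (Set.Iio 0))) := by
  have hlim : ∀ S : Set ℝ, MeasurableSet S → (ν : Measure ℝ) (frontier S) = 0 →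
      Tendsto (fun t => mass (fun s => S.indicator 1 ((s : ℝ) / t)) (w t)) atTop
        (𝓝 ((ν : Measure ℝ).real S)) := fun S hS hf => by
    have h1 := ProbabilityMeasure.tendsto_measure_of_null_frontier_of_tendsto' hν hf
    have h2 := (ENNReal.tendsto_toReal (measure_ne_top (ν : Measure ℝ) S)).comp h1
    refine h2.congr fun t => ?_
    rw [← posLaw_real_eq_mass _ _ hS, ← hμ]
    rfl
  have h1 := hlim (Set.Ioi 0) measurableSet_Ioi (by rwa [frontier_Ioi])
  have h2 := hlim (Set.Iio 0) measurableSet_Iio (by rwa [frontier_Iio])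
  have h3 := (h1.const_mul p).add (h2.const_mul q)
  -- the weights at infinity are attained
  obtain ⟨k, hk⟩ := exists_nat_gt R
  have hpC : |p| ≤ C := by
    rw [← hp k (by exact_mod_cast hk)]
    exact hr _
  have hqC : |q| ≤ C := by
    rw [← hq (-k) (by push_cast; linarith)]
    exact hr _
  have hC : 0 ≤ C := (abs_nonneg _).trans hpC
  refine (tendsto_iff_of_dist ?_).2 h3
  refine squeeze_zero' (Eventually.of_forall fun t => dist_nonneg) ?_
    (by simpa using (tendsto_mass_slabInd hμ hν h0 R).const_mul (2 * C))
  filter_upwards [eventually_gt_atTop 0] with t ht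
  have hind : ∀ (c : ℝ) (S : Set ℝ) (s : ℤ), |c * S.indicator (1 : ℝ → ℝ) ((s : ℝ) / t)| ≤ |c| :=
    fun c S s => by
      rw [abs_mul]
      exact mul_le_of_le_one_right (abs_nonneg c) (abs_indicator_one_le _ _)
  rw [dist_eq_norm, Real.norm_eq_abs, ← mass_const_mul, ← mass_const_mul, ← mass_const_mul,
    ← mass_add (hind p _) (hind q _),
    ← mass_sub hr fun s => (abs_add_le _ _).trans (add_le_add (hind p _ s) (hind q _ s))]
  refine abs_mass_le (C := 2 * C) (fun s => ?_) (fun s => ?_) _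
  · have hdp : (s : ℝ) / t ∈ Set.Ioi (0 : ℝ) ↔ (0 : ℝ) < s := by
      rw [Set.mem_Ioi, lt_div_iff₀ ht, zero_mul]
    have hdm : (s : ℝ) / t ∈ Set.Iio (0 : ℝ) ↔ (s : ℝ) < 0 := by
      rw [Set.mem_Iio, div_lt_iff₀ ht, zero_mul]
    simp only [Set.indicator_apply, hdp, hdm, Pi.one_apply]
    have h4 := abs_le.1 (hr s)
    have h5 := abs_le.1 hpC
    have h6 := abs_le.1 hqC
    rcases le_or_gt |(s : ℝ)| R with hs | hs
    · rw [slabInd_of_le hs, abs_le]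
      rcases lt_trichotomy (s : ℝ) 0 with h7 | h7 | h7
      · rw [if_neg h7.not_gt, if_pos h7]
        constructor <;> linarith
      · rw [if_neg h7.not_gt, if_neg h7.not_lt]
        constructor <;> linarith
      · rw [if_pos h7, if_neg h7.not_gt]
        constructor <;> linarith
    · rw [slabInd_of_lt hs, mul_zero]
      rcases lt_abs.1 hs with h7 | h7
      · rw [hp _ h7, if_pos (by linarith), if_neg (by linarith)]
        simp
      · rw [hq _ (by linarith), if_neg (by linarith), if_pos (by linarith)]
        simp
  · exact mul_le_of_le_one_right (by positivity) (abs_le.1 (abs_indicator_one_le _ _)).2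

/-- Under the family `U` of operators every wave packet leaves the slabs `|x_d| ≤ R`, and its
mass in half spaces converges. -/
structure Escapes (U : ℝ → CSeq d n →L[ℂ] CSeq d n) : Prop where
  slab : ∀ (w : CSeq d n) (g : ℤ → ℝ) (hg : ∃ C : ℝ, ∀ s, |g s| ≤ C) (R : ℝ),
    (∀ s : ℤ, R < |(s : ℝ)| → g s = 0) → Tendsto (fun t => cutOp g hg (U t w)) atTop (𝓝 0)
  halfSpace : ∀ (w : CSeq d n) (g : ℤ → ℝ) (hg : ∃ C : ℝ, ∀ s, |g s| ≤ C) (R p q : ℝ), 0 ≤ R →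
    (∀ s : ℤ, R < (s : ℝ) → g s = p) → (∀ s : ℤ, (s : ℝ) < -R → g s = q) →
    ∃ L, Tendsto (fun t => ‖cutOp g hg (U t w)‖) atTop (𝓝 L)

/-- Normalized, absolutely summable wave packets have an asymptotic velocity law without atom at
zero, which gives both properties for them; the operators are isometries, so density suffices. -/
theorem escapes_evol (hV : ExpDecay V) (hnonneg : NonnegDefinite V)
    (hreg : ∀ᵐ θ : Fin d → ℝ, IsRegularPoint V θ)
    {m M : ℝ} (hs : spectrum ℝ (interactionOp V) ⊆ Set.Icc m M)
    (hsA : ∀ θ, spectrum ℝ (symbolOp V θ) ⊆ Set.Icc m M) {σ : ℝ} (hσ : σ ≠ 0) :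
    Escapes fun t => evol V (σ * t) := by
  have hbound : ∀ (g : ℤ → ℝ) (hg : ∃ C : ℝ, ∀ s, |g s| ≤ C) (t : ℝ) (w : CSeq d n),
      ‖(cutOp g hg ∘L evol V (σ * t)) w‖ ≤ ‖(cutOp g hg : CSeq d n →L[ℂ] CSeq d n)‖ * ‖w‖ :=
    fun g hg t w => by
      rw [← norm_evol hV hnonneg (σ * t) w]
      exact (cutOp g hg).le_opNorm _
  -- reduction to summable initial data of norm one
  have hscale : ∀ (w : CSeq d n), (Summable fun x => ‖w x‖) → w ≠ 0 → ∃ (c : ℂ) (w' : CSeq d n),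
      w = c • w' ∧ ‖w'‖ = 1 ∧ Summable fun x => ‖w' x‖ := fun w hw h0 => by
    have hn : ((‖w‖ : ℝ) : ℂ) ≠ 0 := by
      exact_mod_cast norm_ne_zero_iff.2 h0
    refine ⟨(‖w‖ : ℝ), ((‖w‖ : ℝ) : ℂ)⁻¹ • w, ?_, ?_, ?_⟩
    · rw [smul_smul, mul_inv_cancel₀ hn, one_smul]
    · rw [norm_smul, norm_inv, Complex.norm_real, norm_norm,
        inv_mul_cancel₀ (norm_ne_zero_iff.2 h0)]
    · refine (hw.mul_left ‖((‖w‖ : ℝ) : ℂ)⁻¹‖).congr fun x => ?_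
      rw [lp.coeFn_smul, Pi.smul_apply, norm_smul]
  refine ⟨fun w g hg R hR => ?_, fun w g hg R p q hR hp hq => ?_⟩
  · refine tendsto_zero_of_dense (U := fun t => cutOp g hg ∘L evol V (σ * t)) (hbound g hg)
      dense_summable_norm (fun w hw => ?_) w
    rcases eq_or_ne w 0 with rfl | h0
    · simp
    obtain ⟨c, w', rfl, h1, hw'⟩ := hscale w hw h0
    obtain ⟨μ, ν, hμ, hν, hν0⟩ := exists_velocity_law hV hnonneg hreg hs hsA hw' h1 hσ
    have h2 := tendsto_cutOp_of_mass (tendsto_mass_slabInd hμ hν hν0) hg hR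
    simpa using h2.const_smul c
  · refine exists_tendsto_norm_of_dense (U := fun t => cutOp g hg ∘L evol V (σ * t)) (hbound g hg)
      dense_summable_norm (fun w hw => ?_) w
    rcases eq_or_ne w 0 with rfl | h0
    · exact ⟨0, by simp⟩
    obtain ⟨c, w', rfl, h1, hw'⟩ := hscale w hw h0
    obtain ⟨μ, ν, hμ, hν, hν0⟩ := exists_velocity_law hV hnonneg hreg hs hsA hw' h1 hσ
    have hg2 := hg
    obtain ⟨C, hC⟩ := hg2
    have h2 := tendsto_mass_of_velocity_law hμ hν hν0 (r := fun s => g s ^ 2) (C := C ^ 2)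
      (fun s => by
        rw [abs_of_nonneg (sq_nonneg _)]
        exact sq_le_sq' (abs_le.1 (hC s)).1 (abs_le.1 (hC s)).2) hR
      (fun s h => by rw [hp s h]) (fun s h => by rw [hq s h])
    have h3 := h2.sqrt
    simp only [← norm_cutOp_sq hg, Real.sqrt_sq (norm_nonneg _)] at h3
    refine ⟨_, (h3.const_mul ‖c‖).congr fun t => ?_⟩
    rw [map_smul, norm_smul]
    rfl

end HarmonicCrystal

namespace HarmonicCrystal

open Filter Topology Polynomial

/-! ### Asymptotic commutation with cutoff functions -/

section

variable {H : Type*} [NormedAddCommGroup H] [InnerProductSpace ℂ H] {T S Z : H →L[ℂ] H}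
  {U : ℝ → H →L[ℂ] H}

/-- The commutator of `T` and `Z` tends to zero along the trajectories of `U`. -/
def AsympCommute (U : ℝ → H →L[ℂ] H) (Z T : H →L[ℂ] H) : Prop :=
  ∀ w, Tendsto (fun t => T (Z (U t w)) - Z (T (U t w))) atTop (𝓝 0)

theorem AsympCommute.add (hT : AsympCommute U Z T) (hS : AsympCommute U Z S) :
    AsympCommute U Z (T + S) := fun w => by
  have h := (hT w).add (hS w)
  rw [add_zero] at h
  refine h.congr fun t => ?_
  simp only [add_apply, map_add]
  abel

theorem AsympCommute.const_smul (hT : AsympCommute U Z T) (c : ℂ) :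
    AsympCommute U Z (c • T) := fun w => by
  have h := (hT w).const_smul c
  rw [smul_zero] at h
  refine h.congr fun t => ?_
  simp only [smul_apply, map_smul, smul_sub]

theorem asympCommute_one : AsympCommute U Z 1 := fun w => by
  simp

theorem AsympCommute.mul (hT : AsympCommute U Z T) (hS : AsympCommute U Z S)
    (hSU : ∀ t, Commute S (U t)) : AsympCommute U Z (T * S) := fun w => by
  have h := ((T.continuous.tendsto _).comp (hS w)).add (hT (S w))
  rw [map_zero, add_zero] at h
  refine h.congr fun t => ?_
  have h1 : U t (S w) = S (U t w) := congrArg (fun L : H →L[ℂ] H => L w) (hSU t).symm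
  simp only [Function.comp_apply, map_sub, mul_apply_eq_comp, h1]
  abel

theorem AsympCommute.aeval (hT : AsympCommute U Z T) (hTU : ∀ t, Commute T (U t)) (P : ℂ[X]) :
    AsympCommute U Z (Polynomial.aeval T P) := by
  induction P using Polynomial.induction_on' with
  | add p q hp hq =>
    rw [map_add]
    exact hp.add hq
  | monomial k c =>
    rw [Polynomial.aeval_monomial, ← Algebra.smul_def]
    refine AsympCommute.const_smul ?_ c
    induction k with
    | zero =>
      rw [pow_zero]
      exact asympCommute_one
    | succ k ih =>
      rw [pow_succ]
      exact ih.mul hT hTU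

theorem AsympCommute.of_tendsto {T' : ℕ → H →L[ℂ] H} (h : ∀ j, AsympCommute U Z (T' j))
    (hlim : Tendsto T' atTop (𝓝 T)) (hU : ∀ t w, ‖U t w‖ ≤ ‖w‖) : AsympCommute U Z T := fun w => by
  refine Metric.tendsto_nhds.2 fun ε hε => ?_
  have hK : 0 < 2 * ‖Z‖ * ‖w‖ + 1 := by positivity
  obtain ⟨j, hj⟩ := (Metric.tendsto_nhds.1 hlim (ε / 2 / (2 * ‖Z‖ * ‖w‖ + 1)) (by positivity)).exists
  rw [dist_eq_norm, lt_div_iff₀ hK] at hj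
  filter_upwards [Metric.tendsto_nhds.1 (h j w) (ε / 2) (by positivity)] with t ht
  rw [dist_zero_right] at ht ⊢
  have h1 : T (Z (U t w)) - Z (T (U t w)) = (T' j (Z (U t w)) - Z (T' j (U t w))) -
      ((T' j - T) (Z (U t w)) - Z ((T' j - T) (U t w))) := by
    simp only [sub_apply, map_sub]
    abel
  have hD := norm_nonneg (T' j - T)
  have h2 : ‖(T' j - T) (Z (U t w))‖ ≤ ‖T' j - T‖ * (‖Z‖ * ‖w‖) :=
    ContinuousLinearMap.le_opNorm_of_le _ (ContinuousLinearMap.le_opNorm_of_le _ (hU t w))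
  have h3 : ‖Z ((T' j - T) (U t w))‖ ≤ ‖Z‖ * (‖T' j - T‖ * ‖w‖) :=
    ContinuousLinearMap.le_opNorm_of_le _ (ContinuousLinearMap.le_opNorm_of_le _ (hU t w))
  rw [h1]
  refine (norm_sub_le _ _).trans_lt ?_
  have h4 := norm_sub_le ((T' j - T) (Z (U t w))) (Z ((T' j - T) (U t w)))
  nlinarith

theorem AsympCommute.hasSum [CompleteSpace H] {ι : Type*} {S : ι → H →L[ℂ] H} {b : ι → ℝ}
    (h : ∀ i, AsympCommute U Z (S i)) (hST : HasSum S T) (hb : Summable b) (hS : ∀ i, ‖S i‖ ≤ b i)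
    (hU : ∀ t w, ‖U t w‖ ≤ ‖w‖) : AsympCommute U Z T := fun w => by
  have h1 : ∀ u, HasSum (fun i => S i u) (T u) := fun u =>
    (ContinuousLinearMap.apply ℂ H u).hasSum hST
  have hsum : ∀ u, HasSum (fun i => S i (Z u) - Z (S i u)) (T (Z u) - Z (T u)) := fun u =>
    (h1 _).sub (Z.hasSum (h1 u))
  have h0 := tendsto_tsum_of_dominated_convergence
    (f := fun t i => S i (Z (U t w)) - Z (S i (U t w))) (g := fun _ => (0 : H)) (𝓕 := atTop)
    (bound := fun i => b i * (2 * (‖Z‖ * ‖w‖))) (hb.mul_right _) (fun i => h i w)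
    (Eventually.of_forall fun t i => by
      have h2 : ‖S i (Z (U t w))‖ ≤ b i * (‖Z‖ * ‖w‖) :=
        ContinuousLinearMap.le_of_opNorm_le_of_le _ (hS i)
          (ContinuousLinearMap.le_opNorm_of_le _ (hU t w))
      have h3 : ‖Z (S i (U t w))‖ ≤ ‖Z‖ * (b i * ‖w‖) :=
        ContinuousLinearMap.le_opNorm_of_le _
          (ContinuousLinearMap.le_of_opNorm_le_of_le _ (hS i) (hU t w))
      have h4 := norm_sub_le (S i (Z (U t w))) (Z (S i (U t w)))
      linarith)
  simpa only [(hsum _).tsum_eq, tsum_zero] using h0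

end

variable {d n : ℕ} {V : Lattice d → Matrix (Fin n) (Fin n) ℝ}

/-- Each term of the interaction operator moves the cutoff function by a fixed amount, so the
commutator lives in a slab. -/
theorem asympCommute_interactionOp [NeZero d] {U : ℝ → CSeq d n →L[ℂ] CSeq d n} (hU : Escapes U)
    (hU1 : ∀ t w, ‖U t w‖ ≤ ‖w‖) (hV : ExpDecay V) {g : ℤ → ℝ} (hg : ∃ C : ℝ, ∀ s, |g s| ≤ C)
    {R p q : ℝ} (hp : ∀ s : ℤ, R < (s : ℝ) → g s = p) (hq : ∀ s : ℤ, (s : ℝ) < -R → g s = q) :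
    AsympCommute U (cutOp g hg) (interactionOp V) := by
  refine AsympCommute.hasSum (fun z w => ?_) hV.summable_interactionOp.hasSum hV.summable_norm_cmat
    (fun z => (norm_wshift_le _ _ _ _ _).trans (one_mul _).le) hU1
  have hη : ∃ C : ℝ, ∀ s, |g s - g (s + lastCoord z)| ≤ C := by
    obtain ⟨C, hC⟩ := hg
    exact ⟨C + C, fun s => (abs_sub _ _).trans (add_le_add (hC _) (hC _))⟩
  have hslab := hU.slab w _ hη (R + |(lastCoord z : ℝ)|) fun s hs => by
    have h2 := neg_abs_le (lastCoord z : ℝ)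
    have h3 := le_abs_self (lastCoord z : ℝ)
    have h4 := abs_nonneg (lastCoord z : ℝ)
    rcases lt_abs.1 hs with h | h
    · rw [hp s (by linarith), hp (s + lastCoord z) (by push_cast; linarith), sub_self]
    · rw [hq s (by linarith), hq (s + lastCoord z) (by push_cast; linarith), sub_self]
  have h := ((wshift (fun _ => (1 : ℂ)) 1 norm_one_le_one z (cmat (V z))).continuous.tendsto 0).comp
    hslab
  rw [map_zero] at h
  refine h.congr fun t => ?_
  ext1
  funext x
  rw [lp.coeFn_sub, Pi.sub_apply, cutOp_apply]
  simp only [Function.comp_apply, wshift_apply, cutOp_apply, one_smul, map_smul]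
  rw [← sub_smul]
  congr 1
  have : lastCoord (x - z) + lastCoord z = lastCoord x := sub_add_cancel _ _
  rw [this]
  push_cast
  rfl

theorem commute_interactionOp_fc (hV : ExpDecay V) (hnonneg : NonnegDefinite V) {f : ℝ → ℂ}
    (hf : Continuous f) : Commute (interactionOp V) (fc f (interactionOp V)) := by
  have h := fc_id (isSelfAdjoint_interactionOp hV hnonneg)
  have h1 := fc_mul Complex.continuous_ofReal hf (interactionOp V)
  have h2 := fc_mul hf Complex.continuous_ofReal (interactionOp V)
  simp only [h] at h1 h2
  simp only [mul_comm (f _)] at h2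
  exact h1.symm.trans h2

/-- Functions of the interaction operator commute asymptotically with cutoff functions. -/
theorem asympCommute_fc [NeZero d] (hV : ExpDecay V) (hnonneg : NonnegDefinite V) {m M : ℝ}
    (hs : spectrum ℝ (interactionOp V) ⊆ Set.Icc m M) {σ : ℝ}
    (hU : Escapes fun t => evol V (σ * t)) {g : ℤ → ℝ} (hg : ∃ C : ℝ, ∀ s, |g s| ≤ C)
    {R p q : ℝ} (hp : ∀ s : ℤ, R < (s : ℝ) → g s = p) (hq : ∀ s : ℤ, (s : ℝ) < -R → g s = q)
    {f : ℝ → ℂ} (hf : Continuous f) :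
    AsympCommute (fun t => evol V (σ * t)) (cutOp g hg) (fc f (interactionOp V)) := by
  obtain ⟨P, hP⟩ := exists_polynomial_seq hf m M
  have hU1 : ∀ t (w : CSeq d n), ‖evol V (σ * t) w‖ ≤ ‖w‖ := fun t w =>
    (norm_evol hV hnonneg _ w).le
  refine AsympCommute.of_tendsto (T' := fun j => Polynomial.aeval (interactionOp V) (P j))
    (fun j => (asympCommute_interactionOp hU hU1 hV hg hp hq).aeval (fun t =>
      commute_interactionOp_fc hV hnonneg (continuous_propFn _)) (P j)) ?_ hU1
  rw [tendsto_iff_norm_sub_tendsto_zero]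
  exact squeeze_zero (fun _ => norm_nonneg _) (fun j => norm_aeval_sub_fc_le
    (isSelfAdjoint_interactionOp hV hnonneg) hs hf (by positivity) (hP j))
    tendsto_one_div_add_atTop_nhds_zero_nat

end HarmonicCrystal

namespace HarmonicCrystal

open Filter Topology

/-! ### Complex components of real phase space vectors -/

variable {d n : ℕ} {V : Lattice d → Matrix (Fin n) (Fin n) ℝ}

/-- The inclusion `ℝⁿ ⊆ ℂⁿ`. -/
noncomputable def cplx (n : ℕ) : EuclideanSpace ℝ (Fin n) →L[ℝ] CVec n :=
  LinearMap.mkContinuous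
    { toFun := fun u => WithLp.toLp 2 fun i => (u i : ℂ)
      map_add' := fun u v => by
        ext i
        simp
      map_smul' := fun r u => by
        ext i
        simp } 1 fun u => by
    rw [one_mul, EuclideanSpace.norm_eq, EuclideanSpace.norm_eq]
    simp

theorem cplx_apply (u : EuclideanSpace ℝ (Fin n)) (i : Fin n) : cplx n u i = (u i : ℂ) := rfl

theorem norm_cplx (u : EuclideanSpace ℝ (Fin n)) : ‖cplx n u‖ = ‖u‖ := by
  rw [EuclideanSpace.norm_eq, EuclideanSpace.norm_eq]
  simp [cplx_apply]

theorem inner_cplx (u v : EuclideanSpace ℝ (Fin n)) :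
    inner ℂ (cplx n u) (cplx n v) = ((inner ℝ u v : ℝ) : ℂ) := by
  simp [PiLp.inner_apply, cplx_apply]

theorem cmat_cplx (M : Matrix (Fin n) (Fin n) ℝ) (u : EuclideanSpace ℝ (Fin n)) :
    cmat M (cplx n u) = cplx n (Matrix.toEuclideanLin M u) := by
  ext i
  change ((M.map Complex.ofReal).mulVec (fun i => (u i : ℂ))) i = ((M.mulVec u i : ℝ) : ℂ)
  simp [Matrix.mulVec, dotProduct]

/-- A component of a phase space vector, as a complex valued lattice function. -/
noncomputable def compSeq (L : PhaseVec n →L[ℝ] EuclideanSpace ℝ (Fin n)) (hL : ∀ w, ‖L w‖ ≤ ‖w‖) :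
    RSeq d n →L[ℝ] CSeq d n :=
  have key : ∀ (f : RSeq d n) (x : Lattice d), ‖cplx n (L (f x))‖ ^ 2 ≤ ‖f x‖ ^ 2 := fun f x => by
    rw [norm_cplx]
    exact pow_le_pow_left₀ (norm_nonneg _) (hL _) 2
  LinearMap.mkContinuous
    { toFun := fun f => ⟨fun x => cplx n (L (f x)), memlp_two_of_summable
        ((summable_norm_sq f).of_nonneg_of_le (fun _ => sq_nonneg _) (key f))⟩
      map_add' := fun f g => by
        ext1
        funext x
        simp only [lp.coeFn_add, Pi.add_apply, map_add]
      map_smul' := fun r f => by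
        ext1
        funext x
        simp } 1 fun f => by
    rw [one_mul]
    refine le_of_sq_le_sq ?_ (norm_nonneg _)
    rw [norm_sq_eq_tsum, norm_sq_eq_tsum]
    exact Summable.tsum_le_tsum (key f)
      ((summable_norm_sq f).of_nonneg_of_le (fun _ => sq_nonneg _) (key f)) (summable_norm_sq f)

theorem norm_compSeq_le (L : PhaseVec n →L[ℝ] EuclideanSpace ℝ (Fin n)) (hL : ∀ w, ‖L w‖ ≤ ‖w‖)
    (f : RSeq d n) : ‖compSeq L hL f‖ ≤ ‖f‖ := by
  have h : ‖(compSeq L hL : RSeq d n →L[ℝ] CSeq d n)‖ ≤ 1 := by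
    rw [compSeq]
    exact LinearMap.mkContinuous_norm_le _ zero_le_one _
  exact (ContinuousLinearMap.le_of_opNorm_le _ h f).trans (one_mul _).le

/-- The component `u` of `(u, v)`. -/
noncomputable def fstSeq (d n : ℕ) : RSeq d n →L[ℝ] CSeq d n := compSeq (fstL n) norm_fst_le

/-- The component `v` of `(u, v)`. -/
noncomputable def sndSeq (d n : ℕ) : RSeq d n →L[ℝ] CSeq d n := compSeq (sndL n) norm_snd_le

theorem fstSeq_apply (f : RSeq d n) (x : Lattice d) : fstSeq d n f x = cplx n (f x).fst := rfl

theorem sndSeq_apply (f : RSeq d n) (x : Lattice d) : sndSeq d n f x = cplx n (f x).snd := rfl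

theorem norm_fstSeq_le (f : RSeq d n) : ‖fstSeq d n f‖ ≤ ‖f‖ :=
  norm_compSeq_le _ _ f

theorem norm_sndSeq_le (f : RSeq d n) : ‖sndSeq d n f‖ ≤ ‖f‖ :=
  norm_compSeq_le _ _ f

theorem inner_eq_inner_components (f g : RSeq d n) :
    ((inner ℝ f g : ℝ) : ℂ) = inner ℂ (fstSeq d n f) (fstSeq d n g) +
      inner ℂ (sndSeq d n f) (sndSeq d n g) := by
  have h1 := Complex.ofRealCLM.hasSum (lp.hasSum_inner (𝕜 := ℝ) f g)
  refine h1.unique (((lp.hasSum_inner (fstSeq d n f) (fstSeq d n g)).add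
    (lp.hasSum_inner (sndSeq d n f) (sndSeq d n g))).congr_fun fun x => ?_)
  rw [fstSeq_apply, fstSeq_apply, sndSeq_apply, sndSeq_apply, inner_cplx, inner_cplx,
    ← Complex.ofReal_add, Complex.ofRealCLM_apply, WithLp.prod_inner_apply]
  rfl

open Classical in
/-- Vectors with components in the position or momentum space at a single site. -/
theorem exists_site_vectors (x : Lattice d) (k : Fin n) :
    (∃ y : RSeq d n, fstSeq d n y = lp.single 2 x (EuclideanSpace.single k (1 : ℂ)) ∧
      sndSeq d n y = 0) ∧
    ∃ y : RSeq d n, fstSeq d n y = 0 ∧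
      sndSeq d n y = lp.single 2 x (EuclideanSpace.single k (1 : ℂ)) := by
  have hc : cplx n (EuclideanSpace.single k (1 : ℝ)) = EuclideanSpace.single k (1 : ℂ) := by
    ext i
    rw [cplx_apply]
    by_cases h : i = k
    · subst h
      simp
    · simp [h]
  refine ⟨⟨lp.single 2 x (WithLp.toLp 2 (EuclideanSpace.single k (1 : ℝ), 0)), ?_, ?_⟩,
    ⟨lp.single 2 x (WithLp.toLp 2 (0, EuclideanSpace.single k (1 : ℝ))), ?_, ?_⟩⟩ <;>
  · ext1
    funext y
    rcases eq_or_ne y x with rfl | h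
    · simp [fstSeq_apply, sndSeq_apply, hc]
    · simp [fstSeq_apply, sndSeq_apply, h]

open Classical in
theorem ext_inner_site {f g : CSeq d n} (h : ∀ x k,
    inner ℂ f (lp.single 2 x (EuclideanSpace.single k (1 : ℂ))) =
      inner ℂ g (lp.single 2 x (EuclideanSpace.single k (1 : ℂ)))) : f = g := by
  ext1
  funext x
  ext k
  have h1 := h x k
  rw [lp.inner_single_right, lp.inner_single_right] at h1
  exact (starRingEnd ℂ).injective (by simpa [EuclideanSpace.inner_single_right] using h1)

/-! ### The dual dynamics -/

/-- The generator on `ℓ²`. -/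
noncomputable abbrev gen₀ (V : Lattice d → Matrix (Fin n) (Fin n) ℝ) : RSeq d n →L[ℝ] RSeq d n :=
  genL2 V (le_refl (0 : ℝ))

theorem hasSum_gen₀ (hV : ExpDecay V) (f : RSeq d n) (x : Lattice d) :
    HasSum (fun z => genBlock V z (f (x - z))) (gen₀ V f x) := by
  refine (hasSum_genL2 hV (le_refl (0 : ℝ)) f x).congr_fun fun z => ?_
  simp [weightRatio, weight]

theorem fstSeq_gen₀ (hV : ExpDecay V) (f : RSeq d n) :
    fstSeq d n (gen₀ V f) = sndSeq d n f := by
  ext1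
  funext x
  rw [fstSeq_apply, sndSeq_apply]
  congr 1
  have h := (fstL n).hasSum (hasSum_gen₀ hV f x)
  refine h.unique ?_
  refine (hasSum_ite_eq (0 : Lattice d) (f x).snd).congr_fun fun z => ?_
  simp only [fstL_apply, genBlock_fst]
  split_ifs with hz
  · rw [hz, sub_zero]
  · rfl

theorem sndSeq_gen₀ (hV : ExpDecay V) (f : RSeq d n) :
    sndSeq d n (gen₀ V f) = -interactionOp V (fstSeq d n f) := by
  ext1
  funext x
  rw [sndSeq_apply, lp.coeFn_neg, Pi.neg_apply]
  have h := (cplx n ∘L sndL n).hasSum (hasSum_gen₀ hV f x)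
  refine h.unique ((hV.hasSum_interactionOp (fstSeq d n f) x).neg.congr_fun fun z => ?_)
  rw [fstSeq_apply, cmat_cplx, ContinuousLinearMap.comp_apply, sndL_apply, genBlock_snd, map_neg]

theorem fstSeq_adjoint_gen₀ (hV : ExpDecay V) (hnonneg : NonnegDefinite V) (f : RSeq d n) :
    fstSeq d n ((gen₀ V).adjoint f) = -interactionOp V (sndSeq d n f) := by
  classical
  refine ext_inner_site fun x k => ?_
  obtain ⟨y, hy1, hy2⟩ := (exists_site_vectors x k).1
  have h := inner_eq_inner_components ((gen₀ V).adjoint f) y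
  rw [ContinuousLinearMap.adjoint_inner_left, inner_eq_inner_components, fstSeq_gen₀ hV,
    sndSeq_gen₀ hV, hy1, hy2, inner_zero_right, inner_zero_right, zero_add, add_zero] at h
  rw [← h, inner_neg_left, inner_neg_right]
  exact congrArg _ ((isSelfAdjoint_interactionOp hV hnonneg).isSymmetric _ _).symm

theorem sndSeq_adjoint_gen₀ (hV : ExpDecay V) (f : RSeq d n) :
    sndSeq d n ((gen₀ V).adjoint f) = fstSeq d n f := by
  classical
  refine ext_inner_site fun x k => ?_
  obtain ⟨y, hy1, hy2⟩ := (exists_site_vectors x k).2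
  have h := inner_eq_inner_components ((gen₀ V).adjoint f) y
  rw [ContinuousLinearMap.adjoint_inner_left, inner_eq_inner_components, fstSeq_gen₀ hV,
    sndSeq_gen₀ hV, hy1, hy2, map_zero, neg_zero, inner_zero_right, inner_zero_right, zero_add,
    add_zero] at h
  exact h.symm

section Propagator

variable {H : Type*} [NormedAddCommGroup H] [InnerProductSpace ℂ H] [CompleteSpace H]
  {a : H →L[ℂ] H}

/-- `τ ↦ e^{iτ√a} w` solves `ẇ = i√a w`. -/
theorem hasDerivAt_fc_propFn (ha : IsSelfAdjoint a) {M : ℝ} (hM : ∀ x ∈ spectrum ℝ a, x ≤ M)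
    (w : H) (τ : ℝ) :
    HasDerivAt (fun s => fc (propFn s) a w)
      (fc (fun x => Complex.I * ((√x : ℝ) : ℂ)) a (fc (propFn τ) a w)) τ := by
  set g : ℝ → ℂ := fun x => Complex.I * ((√x : ℝ) : ℂ)
  have hg : Continuous g := by fun_prop
  rw [hasDerivAt_iff_isLittleO_nhds_zero]
  have hsq : 0 ≤ √M := Real.sqrt_nonneg M
  have hO : (fun h : ℝ => fc (propFn (τ + h)) a w - fc (propFn τ) a w -
      h • fc g a (fc (propFn τ) a w)) =O[𝓝 0] fun h : ℝ => h ^ 2 := by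
    refine Asymptotics.IsBigO.of_bound (√M ^ 2 * ‖w‖) ?_
    have hev : ∀ᶠ h : ℝ in 𝓝 0, |h| * √M ≤ 1 := by
      have : Tendsto (fun h : ℝ => |h| * √M) (𝓝 0) (𝓝 (|0| * √M)) :=
        (continuous_abs.tendsto 0).mul_const _
      rw [abs_zero, zero_mul] at this
      exact (this.eventually_lt_const one_pos).mono fun _ h => h.le
    filter_upwards [hev] with h hh
    have h1 : fc (propFn (τ + h)) a w - fc (propFn τ) a w - h • fc g a (fc (propFn τ) a w) =
        fc (fun x => propFn (τ + h) x - propFn τ x - (h : ℂ) * (g x * propFn τ x)) a w := by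
      rw [fc_sub (by fun_prop) (by fun_prop), fc_sub (by fun_prop) (by fun_prop),
        fc_const_mul (h : ℂ) (f := fun x => g x * propFn τ x) (by fun_prop),
        ← fc_mul_apply hg (continuous_propFn τ)]
      rfl
    rw [h1]
    have h2 : ‖fc (fun x => propFn (τ + h) x - propFn τ x - (h : ℂ) * (g x * propFn τ x)) a‖ ≤
        √M ^ 2 * h ^ 2 := by
      refine norm_fc_le ha (by positivity) fun x hx => ?_
      have h3 : propFn (τ + h) x - propFn τ x - (h : ℂ) * (g x * propFn τ x) =
          propFn τ x * (Complex.exp (Complex.I * (h * √x : ℝ)) - 1 - Complex.I * (h * √x : ℝ)) := by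
        have : propFn (τ + h) x = propFn τ x * Complex.exp (Complex.I * (h * √x : ℝ)) := by
          rw [propFn, propFn, ← Complex.exp_add]
          congr 1
          push_cast
          ring
        rw [this]
        simp only [g]
        push_cast
        ring
      have h4 : ‖Complex.I * ((h * √x : ℝ) : ℂ)‖ = |h| * √x := by
        rw [norm_mul, Complex.norm_I, one_mul, Complex.norm_real, Real.norm_eq_abs, abs_mul,
          abs_of_nonneg (Real.sqrt_nonneg x)]
      have h5 : |h| * √x ≤ |h| * √M :=
        mul_le_mul_of_nonneg_left (Real.sqrt_le_sqrt (hM x hx)) (abs_nonneg h)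
      rw [h3, norm_mul, norm_propFn, one_mul]
      refine (Complex.norm_exp_sub_one_sub_id_le (h4.trans_le (h5.trans hh))).trans ?_
      rw [h4, ← sq_abs h, ← mul_pow, mul_comm (√M)]
      exact pow_le_pow_left₀ (by positivity) h5 2
    refine (ContinuousLinearMap.le_of_opNorm_le _ h2 w).trans (le_of_eq ?_)
    rw [Real.norm_of_nonneg (sq_nonneg h)]
    ring
  refine hO.trans_isLittleO ?_
  simpa using Asymptotics.isLittleO_pow_id (𝕜 := ℝ) one_lt_two

end Propagator

end HarmonicCrystal

namespace HarmonicCrystal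

open Filter Topology

variable {d n : ℕ} {V : Lattice d → Matrix (Fin n) (Fin n) ℝ}

/-! ### Normal modes -/

/-- The function `x ↦ x^{-1/2}` on `[m, ∞)`, extended continuously to a bounded function. -/
noncomputable def invSqrt (m x : ℝ) : ℂ := (((√(max x m))⁻¹ : ℝ) : ℂ)

theorem continuous_invSqrt {m : ℝ} (hm : 0 < m) : Continuous (invSqrt m) := by
  have h : ∀ x, √(max x m) ≠ 0 := fun x =>
    (Real.sqrt_pos.2 (lt_max_of_lt_right hm)).ne'
  exact Complex.continuous_ofReal.comp ((by fun_prop : Continuous fun x => √(max x m)).inv₀ h)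

theorem continuous_ofReal_sqrt : Continuous fun x : ℝ => ((√x : ℝ) : ℂ) := by fun_prop

theorem sqrt_mul_invSqrt {m x : ℝ} (hm : 0 < m) (hx : m ≤ x) :
    ((√x : ℝ) : ℂ) * invSqrt m x = 1 := by
  rw [invSqrt, max_eq_left hx, ← Complex.ofReal_mul,
    mul_inv_cancel₀ (Real.sqrt_pos.2 (hm.trans_le hx)).ne', Complex.ofReal_one]

theorem invSqrt_mul_self {m x : ℝ} (hm : 0 < m) (hx : m ≤ x) :
    invSqrt m x * (x : ℂ) = ((√x : ℝ) : ℂ) := by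
  have h : ((x : ℝ) : ℂ) = ((√x : ℝ) : ℂ) * ((√x : ℝ) : ℂ) := by
    rw [← Complex.ofReal_mul, Real.mul_self_sqrt (hm.le.trans hx)]
  rw [h, ← mul_assoc, mul_comm (invSqrt m x), sqrt_mul_invSqrt hm hx, one_mul]

/-- The trajectory of the adjoint of the dynamics on `ℓ²`. -/
noncomputable def dualTraj (V : Lattice d → Matrix (Fin n) (Fin n) ℝ) (t : ℝ) (c : RSeq d n) :
    RSeq d n := NormedSpace.exp (t • (gen₀ V).adjoint) c

/-- The normal modes `𝒱^{-1/2} u ± i v` of `(u, v)`. -/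
noncomputable def normalMode (V : Lattice d → Matrix (Fin n) (Fin n) ℝ) (m σ : ℝ) (c : RSeq d n) :
    CSeq d n :=
  fc (invSqrt m) (interactionOp V) (fstSeq d n c) + (σ * Complex.I) • sndSeq d n c

section

variable {m M : ℝ}

theorem fc_sqrt_fc_invSqrt (hV : ExpDecay V) (hnonneg : NonnegDefinite V) (hm : 0 < m)
    (hs : spectrum ℝ (interactionOp V) ⊆ Set.Icc m M) (w : CSeq d n) :
    fc (fun x => ((√x : ℝ) : ℂ)) (interactionOp V) (fc (invSqrt m) (interactionOp V) w) = w := by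
  have hsa := isSelfAdjoint_interactionOp hV hnonneg
  rw [← fc_mul_apply continuous_ofReal_sqrt (continuous_invSqrt hm),
    fc_congr hsa (g := fun _ => 1) fun x hx => sqrt_mul_invSqrt hm (hs hx).1, fc_one hsa]
  rfl

theorem fc_invSqrt_interactionOp (hV : ExpDecay V) (hnonneg : NonnegDefinite V) (hm : 0 < m)
    (hs : spectrum ℝ (interactionOp V) ⊆ Set.Icc m M) (w : CSeq d n) :
    fc (invSqrt m) (interactionOp V) (interactionOp V w) =
      fc (fun x => ((√x : ℝ) : ℂ)) (interactionOp V) w := by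
  have hsa := isSelfAdjoint_interactionOp hV hnonneg
  have h := fc_mul_apply (continuous_invSqrt hm) Complex.continuous_ofReal (interactionOp V) w
  rw [fc_id hsa] at h
  rw [← h, fc_congr hsa fun x hx => invSqrt_mul_self hm (hs hx).1]

/-- The dual dynamics acts on the normal modes by the propagators. -/
theorem normalMode_dualTraj (hV : ExpDecay V) (hnonneg : NonnegDefinite V) (hm : 0 < m)
    (hs : spectrum ℝ (interactionOp V) ⊆ Set.Icc m M) {σ : ℝ} (hσ : σ * σ = 1) (c : RSeq d n)
    (t : ℝ) : normalMode V m σ (dualTraj V t c) = evol V (σ * t) (normalMode V m σ c) := by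
  have hsa := isSelfAdjoint_interactionOp hV hnonneg
  set K := fc (invSqrt m) (interactionOp V)
  set Ω := fc (fun x => ((√x : ℝ) : ℂ)) (interactionOp V)
  have hΩ : fc (fun x => Complex.I * ((√x : ℝ) : ℂ)) (interactionOp V) = Complex.I • Ω :=
    fc_const_mul Complex.I continuous_ofReal_sqrt _
  have h1 : ∀ t, HasDerivAt (fun s => normalMode V m σ (dualTraj V s c))
      ((σ * Complex.I) • Ω (normalMode V m σ (dualTraj V t c))) t := fun t => by
    have h2 : HasDerivAt (fun s => dualTraj V s c) ((gen₀ V).adjoint (dualTraj V t c)) t :=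
      hasDerivAt_exp_smul_apply _ c t
    have h3 : HasDerivAt (fun s => fstSeq d n (dualTraj V s c))
        (fstSeq d n ((gen₀ V).adjoint (dualTraj V t c))) t :=
      (fstSeq d n).hasFDerivAt.comp_hasDerivAt t h2
    have h4 : HasDerivAt (fun s => sndSeq d n (dualTraj V s c))
        (sndSeq d n ((gen₀ V).adjoint (dualTraj V t c))) t :=
      (sndSeq d n).hasFDerivAt.comp_hasDerivAt t h2
    have h5 : HasDerivAt (fun s => K (fstSeq d n (dualTraj V s c)))
        (K (fstSeq d n ((gen₀ V).adjoint (dualTraj V t c)))) t :=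
      (K.hasFDerivAt.restrictScalars ℝ).comp_hasDerivAt t h3
    have h6 := h5.add (h4.const_smul ((σ : ℂ) * Complex.I))
    refine h6.congr_deriv ?_
    rw [fstSeq_adjoint_gen₀ hV hnonneg, sndSeq_adjoint_gen₀ hV, map_neg,
      fc_invSqrt_interactionOp hV hnonneg hm hs, normalMode, map_add,
      fc_sqrt_fc_invSqrt hV hnonneg hm hs, map_smul, smul_add, smul_smul]
    have h7 : (σ : ℂ) * Complex.I * (σ * Complex.I) = -1 := by
      calc (σ : ℂ) * Complex.I * (σ * Complex.I) = (σ * σ) * (Complex.I * Complex.I) := by ring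
        _ = -1 := by
          rw [← Complex.ofReal_mul, hσ, Complex.I_mul_I, Complex.ofReal_one, one_mul]
    rw [h7, neg_one_smul, add_comm]
  have h8 : ∀ t, HasDerivAt (fun s : ℝ => evol V (σ * s) (normalMode V m σ c))
      ((σ * Complex.I) • Ω (evol V (σ * t) (normalMode V m σ c))) t := fun t => by
    have h9 := hasDerivAt_fc_propFn hsa (fun x hx => (hs hx).2) (normalMode V m σ c) (σ * t)
    have h10 := h9.scomp t ((hasDerivAt_id t).const_mul σ)
    refine h10.congr_deriv ?_
    rw [hΩ, mul_one]
    change (σ : ℂ) • Complex.I • Ω _ = _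
    rw [smul_smul]
    rfl
  have h11 : LipschitzWith ‖(σ * Complex.I) • Ω‖₊ fun w => (σ * Complex.I) • Ω w :=
    ((σ * Complex.I) • Ω).lipschitz
  have h := ODE_solution_unique_univ (v := fun _ w => (σ * Complex.I) • Ω w)
    (s := fun _ => Set.univ) (t₀ := 0) (fun _ => h11.lipschitzOnWith)
    (fun t => ⟨h1 t, Set.mem_univ _⟩) (fun t => ⟨h8 t, Set.mem_univ _⟩) (by
      have h12 : fc (propFn 0) (interactionOp V) = 1 := by
        rw [← fc_one hsa]
        congr 1
        funext x
        simp [propFn]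
      simp [dualTraj, evol, h12])
  exact congrFun h t

end

section Cutoff

variable [NeZero d]

/-- The multiplication of a phase space vector by a function of the last coordinate. -/
noncomputable def cutSeq (g : ℤ → ℝ) (hg : ∃ C : ℝ, ∀ s, |g s| ≤ C) : RSeq d n →L[ℝ] RSeq d n :=
  wshift (fun x => g (lastCoord x)) hg.choose (fun _ => hg.choose_spec _) 0
    (ContinuousLinearMap.id ℝ _)

theorem cutSeq_apply {g : ℤ → ℝ} (hg : ∃ C : ℝ, ∀ s, |g s| ≤ C) (c : RSeq d n) (x : Lattice d) :
    cutSeq g hg c x = g (lastCoord x) • c x := by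
  rw [cutSeq, wshift_apply, sub_zero, ContinuousLinearMap.id_apply]

theorem fstSeq_cutSeq {g : ℤ → ℝ} (hg : ∃ C : ℝ, ∀ s, |g s| ≤ C) (c : RSeq d n) :
    fstSeq d n (cutSeq g hg c) = cutOp g hg (fstSeq d n c) := by
  ext1
  funext x
  rw [fstSeq_apply, cutSeq_apply, cutOp_apply, fstSeq_apply]
  exact map_smul (cplx n) _ _

theorem sndSeq_cutSeq {g : ℤ → ℝ} (hg : ∃ C : ℝ, ∀ s, |g s| ≤ C) (c : RSeq d n) :
    sndSeq d n (cutSeq g hg c) = cutOp g hg (sndSeq d n c) := by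
  ext1
  funext x
  rw [sndSeq_apply, cutSeq_apply, cutOp_apply, sndSeq_apply]
  exact map_smul (cplx n) _ _

end Cutoff

/-- The covariance `|𝒱^{-1/2} u|² + |v|²` of the Gibbs measure of temperature one. -/
noncomputable def gibbsForm (V : Lattice d → Matrix (Fin n) (Fin n) ℝ) (m : ℝ) (c : RSeq d n) : ℝ :=
  ‖fc (invSqrt m) (interactionOp V) (fstSeq d n c)‖ ^ 2 + ‖sndSeq d n c‖ ^ 2

theorem gibbsForm_eq_normalMode (m : ℝ) (c : RSeq d n) :
    gibbsForm V m c = (‖normalMode V m 1 c‖ ^ 2 + ‖normalMode V m (-1) c‖ ^ 2) / 2 := by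
  have h := parallelogram_law_with_norm ℂ (fc (invSqrt m) (interactionOp V) (fstSeq d n c))
    (Complex.I • sndSeq d n c)
  rw [norm_smul, Complex.norm_I, one_mul] at h
  have h1 : normalMode V m 1 c = fc (invSqrt m) (interactionOp V) (fstSeq d n c) +
      Complex.I • sndSeq d n c := by
    simp [normalMode]
  have h2 : normalMode V m (-1) c = fc (invSqrt m) (interactionOp V) (fstSeq d n c) -
      Complex.I • sndSeq d n c := by
    simp [normalMode, sub_eq_add_neg]
  rw [gibbsForm, h1, h2]
  linarith

/-- The covariance of a cut-off Gibbs measure converges along the dual dynamics. -/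
theorem exists_tendsto_gibbsForm [NeZero d] {m M : ℝ} (hV : ExpDecay V) (hnonneg : NonnegDefinite V)
    (hreg : ∀ᵐ θ : Fin d → ℝ, IsRegularPoint V θ) (hm : 0 < m)
    (hs : spectrum ℝ (interactionOp V) ⊆ Set.Icc m M)
    (hsA : ∀ θ, spectrum ℝ (symbolOp V θ) ⊆ Set.Icc m M)
    {g : ℤ → ℝ} (hg : ∃ C : ℝ, ∀ s, |g s| ≤ C) {R p q : ℝ} (hR : 0 ≤ R)
    (hp : ∀ s : ℤ, R < (s : ℝ) → g s = p) (hq : ∀ s : ℤ, (s : ℝ) < -R → g s = q) (c : RSeq d n) :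
    ∃ L, Tendsto (fun t => gibbsForm V m (cutSeq g hg (dualTraj V t c))) atTop (𝓝 L) := by
  set K := fc (invSqrt m) (interactionOp V)
  set Ω := fc (fun x => ((√x : ℝ) : ℂ)) (interactionOp V)
  set Z : CSeq d n →L[ℂ] CSeq d n := cutOp g hg
  have hE : ∀ σ : ℝ, σ * σ = 1 → Escapes fun t => evol V (σ * t) := fun σ hσ =>
    escapes_evol hV hnonneg hreg hs hsA (by rintro rfl; simp at hσ)
  -- the commutator of the cutoff with `𝒱^{-1/2}` vanishes asymptotically
  have hcomm : ∀ σ : ℝ, σ * σ = 1 → Tendsto (fun t =>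
      K (Z (Ω (normalMode V m σ (dualTraj V t c)))) - Z (K (Ω (normalMode V m σ (dualTraj V t c)))))
      atTop (𝓝 0) := fun σ hσ => by
    have h1 := asympCommute_fc hV hnonneg hs (hE σ hσ) hg hp hq (continuous_invSqrt hm)
      (Ω (normalMode V m σ c))
    have h2 : ∀ t, Ω (normalMode V m σ (dualTraj V t c)) =
        evol V (σ * t) (Ω (normalMode V m σ c)) := fun t => by
      rw [normalMode_dualTraj hV hnonneg hm hs hσ, evol,
        ← fc_mul_apply continuous_ofReal_sqrt (continuous_propFn _),
        ← fc_mul_apply (continuous_propFn _) continuous_ofReal_sqrt]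
      simp only [mul_comm]
    simpa only [h2] using h1
  have hcomm' : Tendsto (fun t => K (Z (fstSeq d n (dualTraj V t c))) -
      Z (K (fstSeq d n (dualTraj V t c)))) atTop (𝓝 0) := by
    have h1 := ((hcomm 1 (by norm_num)).add (hcomm (-1) (by norm_num))).const_smul (2⁻¹ : ℂ)
    rw [add_zero, smul_zero] at h1
    refine h1.congr fun t => ?_
    have h2 : fstSeq d n (dualTraj V t c) = (2⁻¹ : ℂ) • (Ω (normalMode V m 1 (dualTraj V t c)) +
        Ω (normalMode V m (-1) (dualTraj V t c))) := by
      have h3 : normalMode V m 1 (dualTraj V t c) + normalMode V m (-1) (dualTraj V t c) =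
          (2 : ℂ) • K (fstSeq d n (dualTraj V t c)) := by
        simp only [normalMode, two_smul]
        push_cast
        rw [neg_one_mul, neg_smul, one_mul]
        abel
      rw [← map_add, h3, map_smul, fc_sqrt_fc_invSqrt hV hnonneg hm hs, smul_smul]
      norm_num
    rw [h2]
    simp only [map_smul, map_add, smul_add, smul_sub]
    abel
  have hmode : ∀ σ : ℝ, σ * σ = 1 → ∃ L,
      Tendsto (fun t => ‖normalMode V m σ (cutSeq g hg (dualTraj V t c))‖) atTop (𝓝 L) :=
    fun σ hσ => by
      obtain ⟨L, hL⟩ := (hE σ hσ).halfSpace (normalMode V m σ c) g hg R p q hR hp hq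
      refine ⟨L, ?_⟩
      have h1 : ∀ t, normalMode V m σ (cutSeq g hg (dualTraj V t c)) =
          Z (evol V (σ * t) (normalMode V m σ c)) +
            (K (Z (fstSeq d n (dualTraj V t c))) - Z (K (fstSeq d n (dualTraj V t c)))) := fun t => by
        rw [← normalMode_dualTraj hV hnonneg hm hs hσ, normalMode, normalMode, fstSeq_cutSeq,
          sndSeq_cutSeq, map_add, map_smul]
        abel
      refine (tendsto_iff_of_dist ?_).1 hL
      refine squeeze_zero (fun t => dist_nonneg) (fun t => ?_) (tendsto_zero_iff_norm_tendsto_zero.1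
        hcomm')
      rw [h1, dist_comm]
      refine (abs_norm_sub_norm_le _ _).trans (le_of_eq ?_)
      rw [add_sub_cancel_left]
  obtain ⟨L₁, h1⟩ := hmode 1 (by norm_num)
  obtain ⟨L₂, h2⟩ := hmode (-1) (by norm_num)
  refine ⟨(L₁ ^ 2 + L₂ ^ 2) / 2, ?_⟩
  simp only [gibbsForm_eq_normalMode]
  exact ((h1.pow 2).add (h2.pow 2)).div_const 2

end HarmonicCrystal

namespace HarmonicCrystal

open Filter Topology MeasureTheory

/-! ### The covariance of the Gibbs measure -/

variable {d n : ℕ} {V : Lattice d → Matrix (Fin n) (Fin n) ℝ}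

/-- A test function as an element of `ℓ²`. -/
noncomputable def testSeq (d n : ℕ) : TestSpace d n →ₗ[ℝ] RSeq d n where
  toFun Ψ := ⟨fun x => Ψ x, memlp_two_of_summable (summable_of_ne_finset_zero (s := Ψ.support) fun x hx => by
    rw [Finsupp.notMem_support_iff.1 hx, norm_zero, sq, zero_mul])⟩
  map_add' _ _ := rfl
  map_smul' _ _ := rfl

theorem testSeq_apply (Ψ : TestSpace d n) (x : Lattice d) : testSeq d n Ψ x = Ψ x := rfl

theorem norm_testSeq_single (x : Lattice d) (p : PhaseVec n) :
    ‖testSeq d n (Finsupp.single x p)‖ ^ 2 = ‖p‖ ^ 2 := by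
  classical
  rw [norm_sq_eq_tsum, tsum_eq_single x]
  · simp [testSeq_apply]
  · intro y hy
    simp [testSeq_apply, hy.symm]

/-- The trigonometric polynomial with the coefficients `u`. -/
noncomputable def trigSum (s : Finset (Lattice d)) (u : Lattice d → EuclideanSpace ℝ (Fin n))
    (θ : Fin d → ℝ) : CVec n :=
  ∑ x ∈ s, Complex.exp (Complex.I * (phase x θ : ℂ)) • cplx n (u x)

theorem inner_toEuclideanCLM_cplx (M : Matrix (Fin n) (Fin n) ℂ) (u v : EuclideanSpace ℝ (Fin n)) :
    inner ℂ (cplx n u) (Matrix.toEuclideanCLM (𝕜 := ℂ) M (cplx n v)) =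
      ∑ k, ∑ l, M k l * ((u k * v l : ℝ) : ℂ) := by
  rw [PiLp.inner_apply]
  refine Finset.sum_congr rfl fun k _ => ?_
  have h : Matrix.toEuclideanCLM (𝕜 := ℂ) M (cplx n v) k = ∑ l, M k l * (v l : ℂ) := rfl
  rw [h, cplx_apply, RCLike.inner_apply, Complex.conj_ofReal, Finset.sum_mul]
  refine Finset.sum_congr rfl fun l _ => ?_
  push_cast
  ring

theorem inner_trigSum (M : Matrix (Fin n) (Fin n) ℂ) (s : Finset (Lattice d))
    (u : Lattice d → EuclideanSpace ℝ (Fin n)) (θ : Fin d → ℝ) :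
    inner ℂ (trigSum s u θ) (Matrix.toEuclideanCLM (𝕜 := ℂ) M (trigSum s u θ)) =
      ∑ x ∈ s, ∑ y ∈ s, ∑ k, ∑ l, Complex.exp (-(Complex.I * (phase (x - y) θ : ℂ))) * M k l *
        ((u x k * u y l : ℝ) : ℂ) := by
  rw [trigSum, map_sum, sum_inner]
  refine Finset.sum_congr rfl fun x _ => ?_
  rw [inner_sum]
  refine Finset.sum_congr rfl fun y _ => ?_
  rw [map_smul, inner_smul_left, inner_smul_right, inner_toEuclideanCLM_cplx, Finset.mul_sum,
    Finset.mul_sum]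
  refine Finset.sum_congr rfl fun k _ => ?_
  rw [Finset.mul_sum, Finset.mul_sum]
  refine Finset.sum_congr rfl fun l _ => ?_
  have h : Complex.exp (-(Complex.I * (phase (x - y) θ : ℂ))) =
      (starRingEnd ℂ) (Complex.exp (Complex.I * (phase x θ : ℂ))) *
        Complex.exp (Complex.I * (phase y θ : ℂ)) := by
    rw [← Complex.exp_conj, ← Complex.exp_add]
    congr 1
    have : phase (x - y) θ = phase x θ - phase y θ := by
      simp [phase, sub_mul, Finset.sum_sub_distrib]
    rw [this, map_mul, Complex.conj_I, Complex.conj_ofReal]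
    push_cast
    ring
  rw [h]
  ring

/-- Parseval's identity for the quadratic form of a translation invariant correlation function. -/
theorem sum_invFourier {f : (Fin d → ℝ) → Matrix (Fin n) (Fin n) ℂ} (hf : Continuous f)
    (s : Finset (Lattice d)) (u : Lattice d → EuclideanSpace ℝ (Fin n)) :
    ∑ x ∈ s, ∑ y ∈ s, ∑ k, ∑ l, invFourier f (x - y) k l * u x k * u y l =
      ((2 * Real.pi) ^ d)⁻¹ * (∫ θ in torusBox d, inner ℂ (trigSum s u θ)
        (Matrix.toEuclideanCLM (𝕜 := ℂ) (f θ) (trigSum s u θ))).re := by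
  have hint : ∀ (z : Lattice d) (k l : Fin n) (c : ℂ), IntegrableOn
      (fun θ => Complex.exp (-(Complex.I * (phase z θ : ℂ))) * f θ k l * c) (torusBox d) := by
    intro z k l c
    refine ContinuousOn.integrableOn_compact isCompact_Icc (Continuous.continuousOn ?_)
    have h1 : Continuous fun θ => f θ k l := hf.matrix_elem k l
    have h2 : Continuous fun θ => phase z θ := continuous_phase z
    fun_prop
  simp only [inner_trigSum]
  rw [integral_finsetSum _ fun x _ => integrable_finsetSum _ fun y _ => integrable_finsetSum _
    fun k _ => integrable_finsetSum _ fun l _ => hint _ k l _, Complex.re_sum, Finset.mul_sum]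
  refine Finset.sum_congr rfl fun x _ => ?_
  rw [integral_finsetSum _ fun y _ => integrable_finsetSum _
    fun k _ => integrable_finsetSum _ fun l _ => hint _ k l _, Complex.re_sum, Finset.mul_sum]
  refine Finset.sum_congr rfl fun y _ => ?_
  rw [integral_finsetSum _ fun k _ => integrable_finsetSum _ fun l _ => hint _ k l _,
    Complex.re_sum, Finset.mul_sum]
  refine Finset.sum_congr rfl fun k _ => ?_
  rw [integral_finsetSum _ fun l _ => hint _ k l _, Complex.re_sum, Finset.mul_sum]
  refine Finset.sum_congr rfl fun l _ => ?_
  rw [integral_mul_const, Complex.re_mul_ofReal, invFourier, Matrix.of_apply,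
    Complex.re_ofReal_mul]
  ring

theorem isFourier_trigSum {w : CSeq d n} {s : Finset (Lattice d)}
    {u : Lattice d → EuclideanSpace ℝ (Fin n)} (hw : ∀ x, w x = cplx n (u x))
    (hs : ∀ x ∉ s, u x = 0) : IsFourier w (trigSum s u) := by
  refine ⟨summable_of_ne_finset_zero (s := s) fun x hx => ?_, fun θ => ?_⟩
  · rw [hw, hs x hx, map_zero, norm_zero]
  · have h := hasSum_sum_of_ne_finset_zero (s := s) (L := SummationFilter.unconditional _)
      (f := fun x => Complex.exp (Complex.I * (phase x θ : ℂ)) • w x) fun x hx => by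
        rw [hw, hs x hx, map_zero, smul_zero]
    simp only [hw] at h
    simpa only [hw, trigSum] using h

/-- The correlation function with the symbol `|f(V̂)|²` is the covariance `|f(𝒱) w|²`. -/
theorem sum_invFourier_fc [NeZero d] (hV : ExpDecay V) (hnonneg : NonnegDefinite V) {m M : ℝ}
    (hs : spectrum ℝ (interactionOp V) ⊆ Set.Icc m M)
    (hsA : ∀ θ, spectrum ℝ (symbolOp V θ) ⊆ Set.Icc m M) {φ : ℝ → ℂ} (hφ : Continuous φ)
    (hφ1 : ∀ x, ‖φ x‖ ≤ 1) {f : (Fin d → ℝ) → Matrix (Fin n) (Fin n) ℂ} (hf : Continuous f)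
    (hfφ : ∀ θ, Matrix.toEuclideanCLM (𝕜 := ℂ) (f θ) =
      fc (fun x => star (φ x) * φ x) (symbolOp V θ))
    {w : CSeq d n} {s : Finset (Lattice d)} {u : Lattice d → EuclideanSpace ℝ (Fin n)}
    (hw : ∀ x, w x = cplx n (u x)) (hu : ∀ x ∉ s, u x = 0) :
    ∑ x ∈ s, ∑ y ∈ s, ∑ k, ∑ l, invFourier f (x - y) k l * u x k * u y l =
      ‖fc φ (interactionOp V) w‖ ^ 2 := by
  have h := inner_fc_modulation hV hnonneg hs hsA (isFourier_trigSum hw hu) hφ hφ1 0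
  have h0 : modulation 0 (fc φ (interactionOp V) w) = fc φ (interactionOp V) w := by
    ext1
    funext x
    rw [modulation, mulOp_apply]
    simp
  rw [h0, inner_self_eq_ofReal] at h
  simp only [zero_smul, add_zero, inner_fc_left, ← fc_mul_apply hφ.star hφ] at h
  rw [sum_invFourier hf]
  simp only [hfφ]
  rw [h, ← Complex.ofReal_mul, Complex.ofReal_re, ← mul_assoc, inv_mul_cancel₀ (by positivity),
    one_mul]

theorem invFourier_smul (c : ℝ) (f : (Fin d → ℝ) → Matrix (Fin n) (Fin n) ℂ) (z : Lattice d)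
    (k l : Fin n) : invFourier (fun θ => (c : ℂ) • f θ) z k l = c * invFourier f z k l := by
  have h : ∀ θ, Complex.exp (-(Complex.I * (phase z θ : ℂ))) * ((c : ℂ) • f θ) k l =
      (c : ℂ) * (Complex.exp (-(Complex.I * (phase z θ : ℂ))) * f θ k l) := fun θ => by
    rw [Matrix.smul_apply, smul_eq_mul]
    ring
  simp only [invFourier, Matrix.of_apply, h]
  rw [integral_const_mul, Complex.re_ofReal_mul, Complex.re_ofReal_mul, Complex.re_ofReal_mul]
  ring

theorem norm_sqrt_mul_invSqrt_le {m : ℝ} (hm : 0 < m) (x : ℝ) :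
    ‖((√m : ℝ) : ℂ) * invSqrt m x‖ ≤ 1 := by
  have h1 : 0 < max x m := lt_max_of_lt_right hm
  have h2 := Real.sqrt_pos.2 h1
  rw [invSqrt, ← Complex.ofReal_mul, Complex.norm_real, Real.norm_of_nonneg (by positivity),
    ← div_eq_mul_inv, div_le_one h2]
  exact Real.sqrt_le_sqrt (le_max_right _ _)

theorem toEuclideanCLM_inv_symbol (hnonneg : NonnegDefinite V)
    (hdet : ∀ θ, (symbol V θ).det ≠ 0) {m M : ℝ} (hm : 0 < m)
    (hsA : ∀ θ, spectrum ℝ (symbolOp V θ) ⊆ Set.Icc m M) (θ : Fin d → ℝ) :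
    Matrix.toEuclideanCLM (𝕜 := ℂ) (symbol V θ)⁻¹ =
      fc (fun x => invSqrt m x * invSqrt m x) (symbolOp V θ) := by
  have hsa := isSelfAdjoint_symbolOp hnonneg θ
  have h1 : Matrix.toEuclideanCLM (𝕜 := ℂ) (symbol V θ)⁻¹ * symbolOp V θ = 1 := by
    rw [symbolOp, ← map_mul, Matrix.nonsing_inv_mul _ (hdet θ).isUnit, map_one]
  have hK := continuous_invSqrt hm
  have h2 : symbolOp V θ * fc (fun x => invSqrt m x * invSqrt m x) (symbolOp V θ) = 1 := by
    have h3 := fc_mul (g := fun x => invSqrt m x * invSqrt m x) Complex.continuous_ofReal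
      (hK.mul hK) (symbolOp V θ)
    rw [fc_id hsa] at h3
    rw [← fc_one hsa, ← h3]
    refine fc_congr hsa fun x hx => ?_
    rw [← mul_assoc, mul_comm (x : ℂ), invSqrt_mul_self hm (hsA θ hx).1,
      sqrt_mul_invSqrt hm (hsA θ hx).1]
  calc _ = Matrix.toEuclideanCLM (𝕜 := ℂ) (symbol V θ)⁻¹ *
        (symbolOp V θ * fc (fun x => invSqrt m x * invSqrt m x) (symbolOp V θ)) := by
        rw [h2, mul_one]
    _ = _ := by rw [← mul_assoc, h1, one_mul]

/-- The quadratic form of the Gibbs measure. -/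
theorem correlationForm_gibbsSymbol [NeZero d] (hV : ExpDecay V) (hnonneg : NonnegDefinite V)
    (hdet : ∀ θ, (symbol V θ).det ≠ 0) {m M : ℝ} (hm : 0 < m)
    (hs : spectrum ℝ (interactionOp V) ⊆ Set.Icc m M)
    (hsA : ∀ θ, spectrum ℝ (symbolOp V θ) ⊆ Set.Icc m M) (T : ℝ) (Ψ : TestSpace d n) :
    correlationForm (fun i j => invFourier (gibbsSymbol V T i j)) Ψ =
      T * gibbsForm V m (testSeq d n Ψ) := by
  have hsupp : ∀ x ∉ Ψ.support, Ψ x = 0 := fun x hx => Finsupp.notMem_support_iff.1 hx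
  have hc := hV.continuous_symbol
  have hinv : Continuous fun θ => (symbol V θ)⁻¹ := by
    simp only [Matrix.inv_def, Ring.inverse_eq_inv']
    exact (hc.matrix_det.inv₀ hdet).smul hc.matrix_adjugate
  have hzero : ∀ z k l, invFourier (fun _ : Fin d → ℝ => (0 : Matrix (Fin n) (Fin n) ℂ)) z k l = 0 :=
    fun z k l => by simp [invFourier]
  -- momenta
  have h11 := sum_invFourier_fc hV hnonneg hs hsA (φ := fun _ => 1) continuous_const
    (fun _ => norm_one.le) (f := fun _ => 1) continuous_const (fun θ => by
      rw [map_one]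
      simp [fc_one (isSelfAdjoint_symbolOp hnonneg θ)])
    (w := sndSeq d n (testSeq d n Ψ)) (s := Ψ.support) (u := fun x => (Ψ x).snd)
    (fun x => rfl) (fun x hx => by rw [hsupp x hx]; rfl)
  rw [fc_one (isSelfAdjoint_interactionOp hV hnonneg)] at h11
  -- positions
  have h00 := sum_invFourier_fc hV hnonneg hs hsA (φ := fun x => ((√m : ℝ) : ℂ) * invSqrt m x)
    (continuous_const.mul (continuous_invSqrt hm)) (norm_sqrt_mul_invSqrt_le hm)
    (f := fun θ => (m : ℂ) • (symbol V θ)⁻¹) (hinv.const_smul (m : ℂ)) (fun θ => by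
      rw [map_smul, toEuclideanCLM_inv_symbol hnonneg hdet hm hsA,
        ← fc_const_mul _ (f := fun x => invSqrt m x * invSqrt m x)
          ((continuous_invSqrt hm).mul (continuous_invSqrt hm))]
      congr 1
      funext x
      have h : ((√m : ℝ) : ℂ) * ((√m : ℝ) : ℂ) = m := by
        rw [← Complex.ofReal_mul, Real.mul_self_sqrt hm.le]
      have h' : star (invSqrt m x) = invSqrt m x := Complex.conj_ofReal _
      have h'' : star ((√m : ℝ) : ℂ) = ((√m : ℝ) : ℂ) := Complex.conj_ofReal _
      rw [star_mul', h', h'', ← h]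
      ring)
    (w := fstSeq d n (testSeq d n Ψ)) (s := Ψ.support) (u := fun x => (Ψ x).fst)
    (fun x => rfl) (fun x hx => by rw [hsupp x hx]; rfl)
  rw [fc_const_mul _ (continuous_invSqrt hm), smul_apply, norm_smul, Complex.norm_real,
    mul_pow, Real.norm_eq_abs, sq_abs, Real.sq_sqrt hm.le] at h00
  simp only [invFourier_smul, mul_assoc, ← Finset.mul_sum] at h00
  have h00' := mul_left_cancel₀ hm.ne' h00
  have e00 : gibbsSymbol V T 0 0 = fun θ => (T : ℂ) • (symbol V θ)⁻¹ := rfl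
  have e01 : gibbsSymbol V T 0 1 = fun _ => 0 := rfl
  have e10 : gibbsSymbol V T 1 0 = fun _ => 0 := rfl
  have e11 : gibbsSymbol V T 1 1 = fun _ => (T : ℂ) • 1 := rfl
  have c0 : ∀ w : PhaseVec n, comp w 0 = w.fst := fun _ => rfl
  have c1 : ∀ w : PhaseVec n, comp w 1 = w.snd := fun _ => rfl
  simp only [mul_assoc] at h11
  simp only [correlationForm, Fin.sum_univ_two, e00, e01, e10, e11, c0, c1, hzero, invFourier_smul,
    zero_mul, Finset.sum_const_zero, add_zero, zero_add, mul_assoc, ← Finset.mul_sum]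
  rw [h00', h11, gibbsForm, mul_add]
  rfl

end HarmonicCrystal

namespace HarmonicCrystal

open Filter Topology MeasureTheory

/-! ### Existence and characteristic functional of the Gibbs measure -/

variable {d n : ℕ} {V : Lattice d → Matrix (Fin n) (Fin n) ℝ}

/-- The symmetric bilinear form of `gibbsForm`. -/
noncomputable def gibbsBilin (V : Lattice d → Matrix (Fin n) (Fin n) ℝ) (m : ℝ) :
    RSeq d n →ₗ[ℝ] RSeq d n →ₗ[ℝ] ℝ :=
  have h1 : ∀ (r : ℝ) (c : RSeq d n), fstSeq d n (r • c) = (r : ℂ) • fstSeq d n c :=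
    fun r c => map_smul (fstSeq d n) r c
  have h2 : ∀ (r : ℝ) (c : RSeq d n), sndSeq d n (r • c) = (r : ℂ) • sndSeq d n c :=
    fun r c => map_smul (sndSeq d n) r c
  LinearMap.mk₂ ℝ (fun c c' => (inner ℂ (fc (invSqrt m) (interactionOp V) (fstSeq d n c))
      (fc (invSqrt m) (interactionOp V) (fstSeq d n c')) + inner ℂ (sndSeq d n c) (sndSeq d n c')).re)
    (fun c₁ c₂ c => by
      simp only [map_add, inner_add_left, Complex.add_re]
      ring)
    (fun r c₁ c => by
      rw [h1, h2, map_smul, inner_smul_left, inner_smul_left, Complex.conj_ofReal,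
        ← mul_add, Complex.re_ofReal_mul, smul_eq_mul])
    (fun c c₁ c₂ => by
      simp only [map_add, inner_add_right, Complex.add_re]
      ring)
    (fun r c c₁ => by
      rw [h1, h2, map_smul, inner_smul_right, inner_smul_right, ← mul_add,
        Complex.re_ofReal_mul, smul_eq_mul])

theorem gibbsBilin_self (m : ℝ) (c : RSeq d n) : gibbsBilin V m c c = gibbsForm V m c := by
  rw [gibbsBilin, LinearMap.mk₂_apply, gibbsForm, inner_self_eq_ofReal, inner_self_eq_ofReal,
    ← Complex.ofReal_add, Complex.ofReal_re]

theorem gibbsBilin_comm (m : ℝ) (c c' : RSeq d n) : gibbsBilin V m c c' = gibbsBilin V m c' c := by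
  simp only [gibbsBilin, LinearMap.mk₂_apply, Complex.add_re]
  congr 1 <;> exact inner_re_symm (𝕜 := ℂ) _ _

theorem gibbsForm_nonneg (m : ℝ) (c : RSeq d n) : 0 ≤ gibbsForm V m c := by
  unfold gibbsForm
  positivity

theorem continuous_gibbsForm (m : ℝ) : Continuous (gibbsForm V m : RSeq d n → ℝ) := by
  have h1 : Continuous fun c => fc (invSqrt m) (interactionOp V) (fstSeq d n c) :=
    (fc (invSqrt m) (interactionOp V)).continuous.comp (fstSeq d n).continuous
  exact (h1.norm.pow 2).add ((sndSeq d n).continuous.norm.pow 2)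

theorem exists_gibbsForm_le (V : Lattice d → Matrix (Fin n) (Fin n) ℝ) (m : ℝ) :
    ∃ C : ℝ, 0 ≤ C ∧ ∀ c : RSeq d n, gibbsForm V m c ≤ C * ‖c‖ ^ 2 := by
  refine ⟨‖fc (invSqrt m) (interactionOp V)‖ ^ 2 + 1, by positivity, fun c => ?_⟩
  rw [add_mul, one_mul, ← mul_pow]
  refine add_le_add (pow_le_pow_left₀ (norm_nonneg _) ?_ 2)
    (pow_le_pow_left₀ (norm_nonneg _) (norm_sndSeq_le c) 2)
  exact ContinuousLinearMap.le_opNorm_of_le _ (norm_fstSeq_le c)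

theorem norm_sq_eq_components (c : RSeq d n) :
    ‖c‖ ^ 2 = ‖fstSeq d n c‖ ^ 2 + ‖sndSeq d n c‖ ^ 2 := by
  have h := inner_eq_inner_components c c
  rw [real_inner_self_eq_norm_sq, inner_self_eq_ofReal, inner_self_eq_ofReal,
    ← Complex.ofReal_add] at h
  exact Complex.ofReal_injective h

/-- The dual dynamics conserves the Gibbs covariance, which is equivalent to the squared norm. -/
theorem exists_norm_dualTraj_le {m M : ℝ} (hV : ExpDecay V) (hnonneg : NonnegDefinite V)
    (hm : 0 < m) (hs : spectrum ℝ (interactionOp V) ⊆ Set.Icc m M) :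
    ∃ C : ℝ, 0 ≤ C ∧ ∀ t (c : RSeq d n), ‖dualTraj V t c‖ ^ 2 ≤ C * ‖c‖ ^ 2 := by
  obtain ⟨C, hC0, hC⟩ := exists_gibbsForm_le V m
  set Ω := fc (fun x => ((√x : ℝ) : ℂ)) (interactionOp V)
  have hcons : ∀ t (c : RSeq d n), gibbsForm V m (dualTraj V t c) = gibbsForm V m c := fun t c => by
    rw [gibbsForm_eq_normalMode, gibbsForm_eq_normalMode,
      normalMode_dualTraj hV hnonneg hm hs (by norm_num),
      normalMode_dualTraj hV hnonneg hm hs (by norm_num), norm_evol hV hnonneg,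
      norm_evol hV hnonneg]
  have hlow : ∀ c : RSeq d n, ‖c‖ ^ 2 ≤ (‖Ω‖ ^ 2 + 1) * gibbsForm V m c := fun c => by
    have h1 : ‖fstSeq d n c‖ ≤ ‖Ω‖ * ‖fc (invSqrt m) (interactionOp V) (fstSeq d n c)‖ := by
      conv_lhs => rw [← fc_sqrt_fc_invSqrt hV hnonneg hm hs (fstSeq d n c)]
      exact ContinuousLinearMap.le_opNorm _ _
    have h2 := pow_le_pow_left₀ (norm_nonneg _) h1 2
    rw [mul_pow] at h2
    rw [norm_sq_eq_components, gibbsForm]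
    have h3 := mul_nonneg (sq_nonneg ‖Ω‖) (sq_nonneg ‖sndSeq d n c‖)
    have h4 := sq_nonneg ‖fc (invSqrt m) (interactionOp V) (fstSeq d n c)‖
    linarith
  refine ⟨(‖Ω‖ ^ 2 + 1) * C, by positivity, fun t c => (hlow _).trans ?_⟩
  rw [hcons, mul_assoc]
  exact mul_le_mul_of_nonneg_left (hC c) (by positivity)

/-- Gibbs measures exist, so that `gibbsMeasure` does not take its default value. -/
theorem isGibbs_gibbsMeasure [NeZero d] (hV : ExpDecay V) (hnonneg : NonnegDefinite V)
    (hdet : ∀ θ, (symbol V θ).det ≠ 0) {m M : ℝ} (hm : 0 < m)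
    (hs : spectrum ℝ (interactionOp V) ⊆ Set.Icc m M)
    (hsA : ∀ θ, spectrum ℝ (symbolOp V θ) ⊆ Set.Icc m M) {α : ℝ} (hα : α < -(d : ℝ) / 2)
    {T : ℝ} (hT : 0 ≤ T) : IsGibbs V T (gibbsMeasure (n := n) α V T) := by
  obtain ⟨C, hC0, hC⟩ := exists_gibbsForm_le V m
  have h : ∃ μ : Measure (PhaseSpace d n α), IsGibbs V T μ := by
    let B := T • (gibbsBilin V m).compl₁₂ (testSeq d n) (testSeq d n)
    have hB : ∀ Ψ Φ, B Ψ Φ = T * gibbsBilin V m (testSeq d n Ψ) (testSeq d n Φ) := fun _ _ => rfl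
    obtain ⟨μ, hμ, hμc⟩ := exists_gaussian hα B
      (fun Ψ Φ => by rw [hB, hB, gibbsBilin_comm])
      (fun Ψ => by
        rw [hB, gibbsBilin_self]
        exact mul_nonneg hT (gibbsForm_nonneg m _)) (T * C) (fun x p => by
        rw [hB, gibbsBilin_self, mul_assoc, ← norm_testSeq_single x p]
        exact mul_le_mul_of_nonneg_left (hC _) hT)
    refine ⟨μ, hμ, fun Ψ => ?_⟩
    rw [hμc, hB, gibbsBilin_self, correlationForm_gibbsSymbol hV hnonneg hdet hm hs hsA]
  rw [gibbsMeasure, dif_pos h]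
  exact h.choose_spec

/-! ### Continuous functionals on the phase space -/

theorem weight_le_one {α : ℝ} (hα : α ≤ 0) (x : Lattice d) : weight α x ≤ 1 :=
  Real.rpow_le_one_of_one_le_of_nonpos (by linarith [latticeSq_nonneg x]) hα

theorem norm_sqrt_weight_le {α : ℝ} (hα : α ≤ 0) (x : Lattice d) : ‖√(weight α x)‖ ≤ 1 := by
  rw [Real.norm_of_nonneg (Real.sqrt_nonneg _)]
  exact Real.sqrt_le_one.2 (weight_le_one hα x)

/-- The inclusion `ℓ² ⊆ H_α`. -/
noncomputable def incl {α : ℝ} (hα : α ≤ 0) : RSeq d n →L[ℝ] PhaseSpace d n α :=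
  (PhaseSpace.isoL2 (α := α)).symm.toContinuousLinearEquiv.toContinuousLinearMap ∘L
    wshift (fun x => √(weight α x)) 1 (norm_sqrt_weight_le hα) 0 (ContinuousLinearMap.id ℝ _)

theorem incl_apply {α : ℝ} (hα : α ≤ 0) (f : RSeq d n) (x : Lattice d) : incl hα f x = f x := by
  have h : wshift (fun x => √(weight α x)) 1 (norm_sqrt_weight_le hα) 0
      (ContinuousLinearMap.id ℝ (PhaseVec n)) f x = √(weight α x) • f x := by
    rw [wshift_apply, sub_zero, ContinuousLinearMap.id_apply]
  refine (PhaseSpace.isoL2_symm_apply _ x).trans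
    ((congrArg (fun v => (√(weight α x))⁻¹ • v) h).trans ?_)
  simp only
  rw [smul_smul, inv_mul_cancel₀ (PhaseSpace.sqrt_weight_pos α x).ne', one_smul]

/-- The coefficient sequence of a continuous functional on `H_α`. -/
noncomputable def coef {α : ℝ} (hα : α ≤ 0) (ℓ : PhaseSpace d n α →L[ℝ] ℝ) : RSeq d n :=
  (InnerProductSpace.toDual ℝ (RSeq d n)).symm (ℓ ∘L incl hα)

theorem inner_coef {α : ℝ} (hα : α ≤ 0) (ℓ : PhaseSpace d n α →L[ℝ] ℝ) (f : RSeq d n) :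
    inner ℝ (coef hα ℓ) f = ℓ (incl hα f) :=
  InnerProductSpace.toDual_symm_apply

theorem coef_eq {α : ℝ} (hα : α ≤ 0) {ℓ : PhaseSpace d n α →L[ℝ] ℝ} {c : RSeq d n}
    (h : ∀ f, inner ℝ c f = ℓ (incl hα f)) : coef hα ℓ = c :=
  ext_inner_right ℝ fun f => by rw [inner_coef, h]

theorem apply_singleL {α : ℝ} (hα : α ≤ 0) (ℓ : PhaseSpace d n α →L[ℝ] ℝ) (x : Lattice d)
    (p : PhaseVec n) : ℓ (PhaseSpace.singleL d n α x p) = inner ℝ (coef hα ℓ x) p := by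
  classical
  have h : PhaseSpace.singleL d n α x p = incl hα (lp.single 2 x p) := by
    refine PhaseSpace.ext fun y => ?_
    rw [PhaseSpace.singleL_apply, incl_apply]
    by_cases hy : y = x
    · subst hy
      simp
    · simp [hy]
  rw [h, ← inner_coef, lp.inner_single_right]

/-- The pairing with a test function as a continuous functional. -/
noncomputable def pairL (α : ℝ) (Ψ : TestSpace d n) : PhaseSpace d n α →L[ℝ] ℝ :=
  ∑ x ∈ Ψ.support, innerSL ℝ (Ψ x) ∘L PhaseSpace.evalL d n α x

theorem pairL_apply {α : ℝ} (Ψ : TestSpace d n) (Y : PhaseSpace d n α) :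
    pairL α Ψ Y = pairing Y Ψ := by
  rw [pairL, sum_apply, pairing]
  refine Finset.sum_congr rfl fun x _ => ?_
  rw [ContinuousLinearMap.comp_apply, PhaseSpace.evalL_apply, innerSL_apply_apply, real_inner_comm]

theorem coef_pairL {α : ℝ} (hα : α ≤ 0) (Ψ : TestSpace d n) :
    coef hα (pairL α Ψ) = testSeq d n Ψ := by
  refine coef_eq hα fun f => ?_
  rw [pairL_apply, pairing]
  have h1 := lp.hasSum_inner (𝕜 := ℝ) (testSeq d n Ψ) f
  have h2 := hasSum_sum_of_ne_finset_zero (s := Ψ.support) (L := SummationFilter.unconditional _)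
    (f := fun x => inner ℝ (testSeq d n Ψ x) (f x)) fun x hx => by
      rw [testSeq_apply, Finsupp.notMem_support_iff.1 hx, inner_zero_left]
  rw [h1.unique h2]
  refine Finset.sum_congr rfl fun x _ => ?_
  rw [incl_apply, testSeq_apply, real_inner_comm]

/-- The characteristic functional of the Gibbs measure at an arbitrary continuous functional. -/
theorem IsGibbs.integral_exp [NeZero d] (hV : ExpDecay V) (hnonneg : NonnegDefinite V)
    (hdet : ∀ θ, (symbol V θ).det ≠ 0) {m M : ℝ} (hm : 0 < m)
    (hs : spectrum ℝ (interactionOp V) ⊆ Set.Icc m M)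
    (hsA : ∀ θ, spectrum ℝ (symbolOp V θ) ⊆ Set.Icc m M) {α : ℝ} (hα : α ≤ 0)
    {T : ℝ} {μ : Measure (PhaseSpace d n α)} (hμ : IsGibbs V T μ) (ℓ : PhaseSpace d n α →L[ℝ] ℝ) :
    ∫ Y, Complex.exp (Complex.I * (ℓ Y : ℂ)) ∂μ =
      Complex.exp (-(1 / 2 : ℂ) * ((T * gibbsForm V m (coef hα ℓ) : ℝ) : ℂ)) := by
  classical
  have := hμ.1
  let Ψ : Finset (Lattice d) → TestSpace d n := fun s =>
    Finsupp.indicator s fun x _ => coef hα ℓ x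
  have hΨ : ∀ s x, Ψ s x = if x ∈ s then coef hα ℓ x else 0 := fun s x => by
    rw [Finsupp.indicator_apply]
    split_ifs <;> rfl
  have hpair : ∀ Y, Tendsto (fun s => pairing Y (Ψ s)) atTop (𝓝 (ℓ Y)) := fun Y => by
    have h1 := ℓ.hasSum (PhaseSpace.hasSum_singleL Y)
    refine Tendsto.congr (fun s => ?_) h1
    rw [pairing_eq_sum (Finsupp.support_indicator_subset s _)]
    refine Finset.sum_congr rfl fun x hx => ?_
    have e : Ψ s x = coef hα ℓ x := by rw [hΨ, if_pos hx]
    exact (apply_singleL hα ℓ x _).trans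
      ((real_inner_comm _ _).trans (congrArg (fun v => inner ℝ (Y x) v) e.symm))
  have hseq : Tendsto (fun s => testSeq d n (Ψ s)) atTop (𝓝 (coef hα ℓ)) := by
    refine Tendsto.congr (fun s => ?_) (lp.hasSum_single (p := 2) (by norm_num) (coef hα ℓ))
    ext1
    funext x
    rw [lp.coeFn_sum, Finset.sum_apply, testSeq_apply, hΨ]
    simp only [lp.single_apply, Pi.single_apply]
    simp
  have hl : Tendsto (fun s => charFunctional μ (Ψ s)) atTop
      (𝓝 (∫ Y, Complex.exp (Complex.I * (ℓ Y : ℂ)) ∂μ)) := by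
    refine tendsto_integral_filter_of_dominated_convergence (fun _ => 1)
      (Eventually.of_forall fun s => ?_)
      (Eventually.of_forall fun s => Eventually.of_forall fun Y => (norm_exp_I_mul_ofReal _).le)
      (integrable_const _) (Eventually.of_forall fun Y => ?_)
    · have hc := continuous_pairing (α := α) (Ψ s)
      exact Continuous.aestronglyMeasurable (by fun_prop)
    · exact ((by fun_prop : Continuous fun r : ℝ => Complex.exp (Complex.I * (r : ℂ))).tendsto
        _).comp (hpair Y)
  have hr : Tendsto (fun s => charFunctional μ (Ψ s)) atTop
      (𝓝 (Complex.exp (-(1 / 2 : ℂ) * ((T * gibbsForm V m (coef hα ℓ) : ℝ) : ℂ)))) := by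
    have h1 := ((continuous_gibbsForm (V := V) m).tendsto _).comp hseq
    have h2 := ((by fun_prop : Continuous fun r : ℝ =>
      Complex.exp (-(1 / 2 : ℂ) * ((T * r : ℝ) : ℂ))).tendsto _).comp h1
    refine h2.congr fun s => ?_
    rw [hμ.2, correlationForm_gibbsSymbol hV hnonneg hdet hm hs hsA]
    rfl
  exact tendsto_nhds_unique hl hr

theorem exp_smul_comp {E F : Type*} [NormedAddCommGroup E] [NormedSpace ℝ E] [CompleteSpace E]
    [NormedAddCommGroup F] [NormedSpace ℝ F] [CompleteSpace F] {A : E →L[ℝ] E} {B : F →L[ℝ] F}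
    {J : F →L[ℝ] E} (h : ∀ y, A (J y) = J (B y)) (t : ℝ) (y : F) :
    NormedSpace.exp (t • A) (J y) = J (NormedSpace.exp (t • B) y) := by
  have h1 := eq_exp_smul_apply A (Y := fun s => J (NormedSpace.exp (s • B) y)) (fun s => by
    rw [h]
    exact J.hasFDerivAt.comp_hasDerivAt s (hasDerivAt_exp_smul_apply B y s)) t
  simpa using h1.symm

theorem phaseGen_incl (hV : ExpDecay V) {α : ℝ} (hα : α ≤ 0) (f : RSeq d n) :
    phaseGen V hα (incl hα f) = incl hα (gen₀ V f) := by
  refine PhaseSpace.ext fun x => ?_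
  rw [incl_apply]
  have h := hasSum_phaseGen hV hα (incl hα f) x
  simp only [incl_apply] at h
  exact h.unique (hasSum_gen₀ hV f x)

/-- The evolution of coefficient sequences is dual to the flow on `H_α`. -/
theorem coef_comp_exp (hV : ExpDecay V) {α : ℝ} (hα : α ≤ 0) (ℓ : PhaseSpace d n α →L[ℝ] ℝ) (t : ℝ) :
    coef hα (ℓ ∘L NormedSpace.exp (t • phaseGen V hα)) = dualTraj V t (coef hα ℓ) := by
  refine coef_eq hα fun f => ?_
  rw [ContinuousLinearMap.comp_apply, exp_smul_comp (phaseGen_incl hV hα), ← inner_coef, dualTraj]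
  have h : NormedSpace.exp (t • (gen₀ V).adjoint) = (NormedSpace.exp (t • gen₀ V)).adjoint := by
    rw [← ContinuousLinearMap.star_eq_adjoint, ← ContinuousLinearMap.star_eq_adjoint,
      NormedSpace.star_exp, star_smul, star_trivial t]
  rw [h, ContinuousLinearMap.adjoint_inner_left]

/-- The cutoff as an operator on `H_α`. -/
noncomputable def cutoffL [NeZero d] (α : ℝ) (g : ℤ → ℝ) (hg : ∃ C : ℝ, ∀ s, |g s| ≤ C) :
    PhaseSpace d n α →L[ℝ] PhaseSpace d n α :=
  (PhaseSpace.isoL2 (α := α)).symm.toContinuousLinearEquiv.toContinuousLinearMap ∘L cutSeq g hg ∘L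
    (PhaseSpace.isoL2 (α := α)).toContinuousLinearEquiv.toContinuousLinearMap

theorem cutoffL_apply [NeZero d] {α : ℝ} {g : ℤ → ℝ} (hg : ∃ C : ℝ, ∀ s, |g s| ≤ C)
    (Y : PhaseSpace d n α) : cutoffL α g hg Y = cutoffMul g hg Y := by
  refine PhaseSpace.ext fun x => ?_
  have h : cutSeq g hg (PhaseSpace.isoL2 Y) x = g (lastCoord x) • √(weight α x) • Y x :=
    cutSeq_apply hg _ x
  refine (PhaseSpace.isoL2_symm_apply _ x).trans
    ((congrArg (fun v => (√(weight α x))⁻¹ • v) h).trans ?_)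
  simp only
  rw [smul_comm (g (lastCoord x)), smul_smul,
    inv_mul_cancel₀ (PhaseSpace.sqrt_weight_pos α x).ne', one_smul]
  rfl

theorem coef_comp_cutoffL [NeZero d] {α : ℝ} (hα : α ≤ 0) (ℓ : PhaseSpace d n α →L[ℝ] ℝ)
    {g : ℤ → ℝ} (hg : ∃ C : ℝ, ∀ s, |g s| ≤ C) :
    coef hα (ℓ ∘L cutoffL α g hg) = cutSeq g hg (coef hα ℓ) := by
  refine coef_eq hα fun f => ?_
  have h : cutoffL α g hg (incl hα f) = incl hα (cutSeq g hg f) := by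
    rw [cutoffL_apply]
    refine PhaseSpace.ext fun x => ?_
    rw [incl_apply, cutSeq_apply]
    exact congrArg (fun v => g (lastCoord x) • v) (incl_apply hα f x)
  rw [ContinuousLinearMap.comp_apply, h, ← inner_coef]
  refine (lp.hasSum_inner (𝕜 := ℝ) (cutSeq g hg (coef hα ℓ)) f).unique
    ((lp.hasSum_inner (𝕜 := ℝ) (coef hα ℓ) (cutSeq g hg f)).congr_fun fun x => ?_)
  rw [cutSeq_apply, cutSeq_apply, inner_smul_left, inner_smul_right]
  rfl

end HarmonicCrystal

namespace HarmonicCrystal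

open Filter Topology MeasureTheory

/-! ### Convergence of the covariances and the limit measure -/

/-- If the quadratic forms of symmetric bilinear forms converge, so do the bilinear forms. -/
theorem exists_bilin_tendsto {E : Type*} [AddCommGroup E] [Module ℝ E] {B : ℝ → E →ₗ[ℝ] E →ₗ[ℝ] ℝ}
    (hB : ∀ t x y, B t x y = B t y x) (h : ∀ x, ∃ L, Tendsto (fun t => B t x x) atTop (𝓝 L)) :
    ∃ B' : E →ₗ[ℝ] E →ₗ[ℝ] ℝ, ∀ x y, Tendsto (fun t => B t x y) atTop (𝓝 (B' x y)) := by
  choose L hL using h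
  have hlim : ∀ x y, Tendsto (fun t => B t x y) atTop (𝓝 ((L (x + y) - L x - L y) / 2)) :=
    fun x y => by
      refine (((hL (x + y)).sub (hL x)).sub (hL y)).div_const 2 |>.congr fun t => ?_
      simp only [map_add, LinearMap.add_apply]
      rw [hB t y x]
      ring
  refine ⟨LinearMap.mk₂ ℝ (fun x y => (L (x + y) - L x - L y) / 2) (fun x y z => ?_)
    (fun r x z => ?_) (fun x y z => ?_) (fun r x z => ?_), fun x y => hlim x y⟩
  · refine tendsto_nhds_unique (hlim (x + y) z) (((hlim x z).add (hlim y z)).congr fun t => ?_)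
    simp
  · refine tendsto_nhds_unique (hlim (r • x) z) (((hlim x z).const_mul r).congr fun t => ?_)
    simp
  · refine tendsto_nhds_unique (hlim x (y + z)) (((hlim x y).add (hlim x z)).congr fun t => ?_)
    simp
  · refine tendsto_nhds_unique (hlim x (r • z)) (((hlim x z).const_mul r).congr fun t => ?_)
    simp

variable {d n : ℕ} {V : Lattice d → Matrix (Fin n) (Fin n) ℝ}

theorem measurable_twoTemperature_map [NeZero d] {α : ℝ} (ζ : CutoffPair) :
    Measurable fun Y : PhaseSpace d n α × PhaseSpace d n α =>
      cutoffMul ζ.minus ζ.minus_bounded Y.1 + cutoffMul ζ.plus ζ.plus_bounded Y.2 := by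
  simp only [← cutoffL_apply]
  exact Continuous.measurable (by fun_prop)

theorem measurable_flow (hV : ExpDecay V) {α : ℝ} (hα : α ≤ 0) (t : ℝ) :
    Measurable (flow V t : PhaseSpace d n α → PhaseSpace d n α) := by
  have h : (flow V t : PhaseSpace d n α → PhaseSpace d n α) =
      fun Y => NormedSpace.exp (t • phaseGen V hα) Y := funext fun Y => flow_eq_exp hV hα t Y
  rw [h]
  exact (NormedSpace.exp (t • phaseGen V hα)).continuous.measurable

/-- The characteristic functional of the initial measure, evolved to time `t`. The two half crystals
are independent, so their covariances add up. -/
theorem charFunctional_evolved [NeZero d] (hV : ExpDecay V) (hnonneg : NonnegDefinite V)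
    (hdet : ∀ θ, (symbol V θ).det ≠ 0) {m M : ℝ} (hm : 0 < m)
    (hs : spectrum ℝ (interactionOp V) ⊆ Set.Icc m M)
    (hsA : ∀ θ, spectrum ℝ (symbolOp V θ) ⊆ Set.Icc m M) {α : ℝ} (hα : α < -(d : ℝ) / 2)
    {Tm Tp : ℝ} (hTm : 0 ≤ Tm) (hTp : 0 ≤ Tp) (ζ : CutoffPair) (t : ℝ) (Ψ : TestSpace d n) :
    charFunctional ((twoTemperature α V Tm Tp ζ).map (flow V t)) Ψ =
      Complex.exp (-(1 / 2 : ℂ) *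
        ((Tm * gibbsForm V m (cutSeq ζ.minus ζ.minus_bounded (dualTraj V t (testSeq d n Ψ))) +
          Tp * gibbsForm V m (cutSeq ζ.plus ζ.plus_bounded (dualTraj V t (testSeq d n Ψ))) : ℝ) :
            ℂ)) := by
  have hα0 : α ≤ 0 := by
    have : (0 : ℝ) ≤ d := Nat.cast_nonneg d
    linarith
  have hgm := isGibbs_gibbsMeasure (n := n) hV hnonneg hdet hm hs hsA hα hTm
  have hgp := isGibbs_gibbsMeasure (n := n) hV hnonneg hdet hm hs hsA hα hTp
  have := hgm.1
  have := hgp.1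
  set ℓ : PhaseSpace d n α →L[ℝ] ℝ := pairL α Ψ ∘L NormedSpace.exp (t • phaseGen V hα0)
  have hℓ : ∀ Y, pairing (flow V t Y) Ψ = ℓ Y := fun Y => by
    rw [flow_eq_exp hV hα0, ← pairL_apply]
    rfl
  have hcoef : coef hα0 ℓ = dualTraj V t (testSeq d n Ψ) := by
    rw [coef_comp_exp hV, coef_pairL]
  clear_value ℓ
  have hexp : ∀ Φ : TestSpace d n, Continuous fun Y : PhaseSpace d n α =>
      Complex.exp (Complex.I * (pairing Y Φ : ℂ)) := fun Φ => by
    have hc := continuous_pairing (α := α) Φ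
    fun_prop
  have hℓc : Continuous fun Y : PhaseSpace d n α => Complex.exp (Complex.I * (ℓ Y : ℂ)) := by
    fun_prop
  rw [charFunctional, integral_map (measurable_flow hV hα0 t).aemeasurable
    (hexp Ψ).aestronglyMeasurable]
  simp only [hℓ]
  rw [twoTemperature, integral_map (measurable_twoTemperature_map ζ).aemeasurable
    hℓc.aestronglyMeasurable]
  have hprod : ∀ Y : PhaseSpace d n α × PhaseSpace d n α, Complex.exp (Complex.I *
      (ℓ (cutoffMul ζ.minus ζ.minus_bounded Y.1 + cutoffMul ζ.plus ζ.plus_bounded Y.2) : ℂ)) =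
      Complex.exp (Complex.I * ((ℓ ∘L cutoffL α ζ.minus ζ.minus_bounded) Y.1 : ℂ)) *
        Complex.exp (Complex.I * ((ℓ ∘L cutoffL α ζ.plus ζ.plus_bounded) Y.2 : ℂ)) := fun Y => by
    rw [← Complex.exp_add, map_add, ContinuousLinearMap.comp_apply, ContinuousLinearMap.comp_apply,
      cutoffL_apply, cutoffL_apply]
    push_cast
    rw [mul_add]
  simp only [hprod]
  rw [integral_prod_mul (fun Y => Complex.exp (Complex.I *
      ((ℓ ∘L cutoffL α ζ.minus ζ.minus_bounded) Y : ℂ))) fun Y => Complex.exp (Complex.I *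
      ((ℓ ∘L cutoffL α ζ.plus ζ.plus_bounded) Y : ℂ)),
    hgm.integral_exp hV hnonneg hdet hm hs hsA hα0, hgp.integral_exp hV hnonneg hdet hm hs hsA hα0,
    coef_comp_cutoffL, coef_comp_cutoffL, hcoef, ← Complex.exp_add]
  congr 1
  push_cast
  ring

theorem CutoffPair.a_nonneg (ζ : CutoffPair) : 0 ≤ ζ.a := by
  by_contra h
  rw [not_le] at h
  have h1 := ζ.plus_one 0 (by simpa using h)
  have h2 := ζ.plus_zero 0 (by simpa using h)
  rw [h1] at h2
  exact one_ne_zero h2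

end HarmonicCrystal

open HarmonicCrystal in
theorem theorem3p1 {d n : ℕ} [NeZero d] [NeZero n]
    (V : HarmonicCrystal.Lattice d → Matrix (Fin n) (Fin n) ℝ)
    (hdecay : HarmonicCrystal.ExpDecay V)
    (hsymm : HarmonicCrystal.Symmetric V)
    (hnonneg : HarmonicCrystal.NonnegDefinite V)
    (hhess : HarmonicCrystal.NondegenerateHessians V)
    (hdet : ∀ θ : Fin d → ℝ, (HarmonicCrystal.symbol V θ).det ≠ 0)
    (Tm Tp : ℝ) (hTm : 0 ≤ Tm) (hTp : 0 ≤ Tp)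
    (ζ : HarmonicCrystal.CutoffPair)
    (α : ℝ) (hα : α < -(d : ℝ) / 2) :
    ∃ gInf : MeasureTheory.Measure (HarmonicCrystal.PhaseSpace d n α),
      MeasureTheory.IsProbabilityMeasure gInf ∧
      HarmonicCrystal.IsGaussianMeasure gInf ∧
      ∀ f : HarmonicCrystal.PhaseSpace d n α →ᵇ ℝ,
        Filter.Tendsto
          (fun t : ℝ => ∫ Y, f Y
            ∂((HarmonicCrystal.twoTemperature α V Tm Tp ζ).map (HarmonicCrystal.flow V t)))
          Filter.atTop (nhds (∫ Y, f Y ∂gInf)) := by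
  classical
  obtain ⟨m, M, hm, hs, hsA⟩ := exists_spectral_bounds hdecay hnonneg hdet
  have hreg := ae_isRegularPoint hdecay hnonneg hhess hdet
  -- the covariance at time `t` as a bilinear form
  let S : (g : ℤ → ℝ) → (∃ C : ℝ, ∀ s, |g s| ≤ C) → ℝ → TestSpace d n →ₗ[ℝ] RSeq d n :=
    fun g hg t => (cutSeq g hg).toLinearMap ∘ₗ
      (NormedSpace.exp (t • (gen₀ V).adjoint)).toLinearMap ∘ₗ testSeq d n
  have hS : ∀ g hg t Ψ, S g hg t Ψ = cutSeq g hg (dualTraj V t (testSeq d n Ψ)) :=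
    fun _ _ _ _ => rfl
  let B : ℝ → TestSpace d n →ₗ[ℝ] TestSpace d n →ₗ[ℝ] ℝ := fun t =>
    Tm • (gibbsBilin V m).compl₁₂ (S ζ.minus ζ.minus_bounded t) (S ζ.minus ζ.minus_bounded t) +
      Tp • (gibbsBilin V m).compl₁₂ (S ζ.plus ζ.plus_bounded t) (S ζ.plus ζ.plus_bounded t)
  have hB : ∀ t Ψ Φ, B t Ψ Φ =
      Tm * gibbsBilin V m (S ζ.minus ζ.minus_bounded t Ψ) (S ζ.minus ζ.minus_bounded t Φ) +
        Tp * gibbsBilin V m (S ζ.plus ζ.plus_bounded t Ψ) (S ζ.plus ζ.plus_bounded t Φ) :=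
    fun _ _ _ => rfl
  have hBself : ∀ t Ψ, B t Ψ Ψ =
      Tm * gibbsForm V m (cutSeq ζ.minus ζ.minus_bounded (dualTraj V t (testSeq d n Ψ))) +
        Tp * gibbsForm V m (cutSeq ζ.plus ζ.plus_bounded (dualTraj V t (testSeq d n Ψ))) :=
    fun t Ψ => by rw [hB, gibbsBilin_self, gibbsBilin_self, hS, hS]
  have hBsymm : ∀ t Ψ Φ, B t Ψ Φ = B t Φ Ψ := fun t Ψ Φ => by
    rw [hB, hB, gibbsBilin_comm, gibbsBilin_comm m (S ζ.plus _ _ _)]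
  have hBpos : ∀ t Ψ, 0 ≤ B t Ψ Ψ := fun t Ψ => by
    rw [hBself]
    exact add_nonneg (mul_nonneg hTm (gibbsForm_nonneg m _)) (mul_nonneg hTp (gibbsForm_nonneg m _))
  -- the covariances are uniformly bounded
  obtain ⟨C, hC⟩ : ∃ C, ∀ t x p, B t (Finsupp.single x p) (Finsupp.single x p) ≤ C * ‖p‖ ^ 2 := by
    obtain ⟨C₁, h10, h1⟩ := exists_gibbsForm_le V m
    obtain ⟨C₂, h20, h2⟩ := exists_norm_dualTraj_le hdecay hnonneg hm hs
    have h3 : ∀ g hg t x p, gibbsForm V m (S g hg t (Finsupp.single x p)) ≤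
        C₁ * (‖(cutSeq g hg : RSeq d n →L[ℝ] RSeq d n)‖ ^ 2 * C₂) * ‖p‖ ^ 2 :=
      fun g hg t x p => by
        refine (h1 _).trans ?_
        rw [mul_assoc, mul_assoc, hS, ← norm_testSeq_single x p]
        refine mul_le_mul_of_nonneg_left ?_ h10
        refine (pow_le_pow_left₀ (norm_nonneg _) ((cutSeq g hg).le_opNorm _) 2).trans ?_
        rw [mul_pow]
        exact mul_le_mul_of_nonneg_left (h2 t _) (sq_nonneg _)
    refine ⟨Tm * (C₁ * (‖(cutSeq ζ.minus ζ.minus_bounded : RSeq d n →L[ℝ] RSeq d n)‖ ^ 2 * C₂)) +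
      Tp * (C₁ * (‖(cutSeq ζ.plus ζ.plus_bounded : RSeq d n →L[ℝ] RSeq d n)‖ ^ 2 * C₂)),
      fun t x p => ?_⟩
    rw [hB, gibbsBilin_self, gibbsBilin_self]
    refine (add_le_add (mul_le_mul_of_nonneg_left (h3 _ _ t x p) hTm)
      (mul_le_mul_of_nonneg_left (h3 _ _ t x p) hTp)).trans (le_of_eq ?_)
    rw [← mul_assoc, ← mul_assoc Tp, ← add_mul]
  -- the covariances converge
  obtain ⟨B', hB'⟩ := exists_bilin_tendsto hBsymm fun Ψ => by
    obtain ⟨L₁, hL₁⟩ := exists_tendsto_gibbsForm hdecay hnonneg hreg hm hs hsA ζ.minus_bounded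
      ζ.a_nonneg (p := 0) (q := 1) (fun s h => ζ.minus_zero s (by linarith))
      (fun s h => ζ.minus_one s (by linarith)) (testSeq d n Ψ)
    obtain ⟨L₂, hL₂⟩ := exists_tendsto_gibbsForm hdecay hnonneg hreg hm hs hsA ζ.plus_bounded
      ζ.a_nonneg (p := 1) (q := 0) (fun s h => ζ.plus_one s h)
      (fun s h => ζ.plus_zero s h) (testSeq d n Ψ)
    simp only [hBself]
    exact ⟨_, (hL₁.const_mul Tm).add (hL₂.const_mul Tp)⟩
  have hpos' : ∀ Ψ, 0 ≤ B' Ψ Ψ := fun Ψ => ge_of_tendsto' (hB' Ψ Ψ) fun t => hBpos t Ψ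
  obtain ⟨gInf, hprob, hgauss⟩ := exists_gaussian hα B'
    (fun Ψ Φ => tendsto_nhds_unique (hB' Ψ Φ) ((hB' Φ Ψ).congr fun t => hBsymm t Φ Ψ)) hpos' C
    (fun x p => le_of_tendsto' (hB' _ _) fun t => hC t x p)
  refine ⟨gInf, hprob, ⟨LinearMap.BilinMap.toQuadraticMap B', fun Ψ => ?_, fun Ψ => ?_⟩, fun f => ?_⟩
  · exact hpos' Ψ
  · exact hgauss Ψ
  have hα0 : α ≤ 0 := by
    have : (0 : ℝ) ≤ d := Nat.cast_nonneg d
    linarith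
  have hprob₀ : ∀ t, MeasureTheory.IsProbabilityMeasure
      ((twoTemperature α V Tm Tp ζ).map (flow V t)) := fun t => by
    have := (isGibbs_gibbsMeasure (n := n) hdecay hnonneg hdet hm hs hsA hα hTm).1
    have := (isGibbs_gibbsMeasure (n := n) hdecay hnonneg hdet hm hs hsA hα hTp).1
    have : MeasureTheory.IsProbabilityMeasure (twoTemperature α V Tm Tp ζ) :=
      MeasureTheory.Measure.isProbabilityMeasure_map (measurable_twoTemperature_map ζ).aemeasurable
    exact MeasureTheory.Measure.isProbabilityMeasure_map (measurable_flow hdecay hα0 t).aemeasurable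
  refine tendsto_integral_of_tendsto_covariance hα hprob₀ hprob (Q := fun t Ψ => B t Ψ Ψ)
    (Q₀ := fun Ψ => B' Ψ Ψ) hBpos (fun t r Ψ => ?_) hC (fun Ψ => hB' Ψ Ψ) (fun t Ψ => ?_) hgauss f
  · rw [map_smul, map_smul, LinearMap.smul_apply, smul_eq_mul, smul_eq_mul]
    ring
  · rw [charFunctional_evolved hdecay hnonneg hdet hm hs hsA hα hTm hTp, hBself]
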